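/- All graphs are finite and simple; $n$ and $m$ denote the numbers of vertices and edges of the input graph. A weighted graph is a graph with a real weight $w(v)\ge 0$ for every vertex $v$; the weight of a set of vertices is the sum of the weights of its elements. A hole is a chordless cycle of length at least $4$; a graph is 4-hole-free (respectively even-hole-free) if it has no hole of length $4$ (respectively of even length). A graph is odd-signable if its edges can be given weights $0,1$ so that every chordless cycle (triangles included) has odd weight. An ordering $(v_1,\dots,v_n)$ of the vertices is a LexBFS ordering if it can be produced by lexicographic breadth-first search: when a vertex is visited as the $j$-th vertex, the number $n-j+1$ is appended to the labels (initially empty lists) of its unvisited neighbours, and the next vertex visited is always an unvisited vertex with lexicographically largest label. A certificate for $G$ consists of a LexBFS ordering $(v_1,\dots,v_n)$ of $G$, an index $i$, and a hole of $G$ (its vertices listed in cyclic order) all of whose vertices are neighbours of $v_i$ belonging to $\{v_1,\dots,v_{i-1}\}$. Running times count steps of a random access machine. Its integer cells can be set to a constant, copied, incremented, decremented, compared and used as addresses (so all integers stay polynomially bounded within polynomial time), and its real cells, holding weights, can be copied, added and compared; each such operation takes one step. The input is given by adjacency lists (stored in an array, each list in any order) and the array of weights. **Theorem.** There is an algorithm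 (a program for this machine) that, for every weighted graph $G$ as input, halts within $O(nm)$ steps — precisely, within $C\cdot\max(n,1)\cdot\max(m,1)$ steps for an absolute constant $C$, that is, within $Cnm$ steps whenever $G$ has an edge — and outputs a maximum-weight clique of $G$ or a certificate for $G$. Every graph that has a certificate is not both 4-hole-free and odd-signable, so the certificate proves that $G$ is not 4-hole-free odd-signable. In particular, if $G$ is even-hole-free, the output is a maximum-weight clique of $G$. -/

import Mathlib

open scoped NNReal

/-! ### Machine model

A random access machine in structured form. Integer cells hold natural numbers and can only be set
to a program constant, copied, incremented, decremented, compared and used as addresses; hence in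
`t` steps no integer exceeds the largest input integer or program constant by more than `t`.
Weights live in cells of their own, which can only be copied, added and compared. -/

namespace RAM

/-- The memory of the machine: integer registers, integer arrays, weight registers, weight arrays
and a write-only output tape. A program mentions only finitely many registers and arrays. -/
structure State where
  reg : ℕ → ℕ
  arr : ℕ → ℕ → ℕ
  wreg : ℕ → ℝ≥0
  warr : ℕ → ℕ → ℝ≥0
  out : List ℕ

/-- Elementary instructions. Register and array names are fixed in the program; array cells are
addressed indirectly, through the content of a register. -/
inductive Instr where
  /-- `reg r := k` -/
  | const (r k : ℕ)
  /-- `reg r := reg s` -/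
  | copy (r s : ℕ)
  /-- `reg r := reg r + 1` -/
  | inc (r : ℕ)
  /-- `reg r := reg r - 1`, and `0` stays `0` -/
  | dec (r : ℕ)
  /-- `reg r := arr a [reg i]` -/
  | load (r a i : ℕ)
  /-- `arr a [reg i] := reg r` -/
  | store (a i r : ℕ)
  /-- `wreg x := 0` -/
  | wzero (x : ℕ)
  /-- `wreg x := wreg y` -/
  | wcopy (x y : ℕ)
  /-- `wreg x := wreg x + wreg y` -/
  | wadd (x y : ℕ)
  /-- `wreg x := warr a [reg i]` -/
  | wload (x a i : ℕ)
  /-- `warr a [reg i] := wreg x` -/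
  | wstore (a i x : ℕ)
  /-- append `reg r` to the output -/
  | emit (r : ℕ)

/-- The effect of an elementary instruction. -/
noncomputable def Instr.run : Instr → State → State
  | .const r k, s => { s with reg := Function.update s.reg r k }
  | .copy r q, s => { s with reg := Function.update s.reg r (s.reg q) }
  | .inc r, s => { s with reg := Function.update s.reg r (s.reg r + 1) }
  | .dec r, s => { s with reg := Function.update s.reg r (s.reg r - 1) }
  | .load r a i, s => { s with reg := Function.update s.reg r (s.arr a (s.reg i)) }
  | .store a i r, s =>
      { s with arr := Function.update s.arr a (Function.update (s.arr a) (s.reg i) (s.reg r)) }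
  | .wzero x, s => { s with wreg := Function.update s.wreg x 0 }
  | .wcopy x y, s => { s with wreg := Function.update s.wreg x (s.wreg y) }
  | .wadd x y, s => { s with wreg := Function.update s.wreg x (s.wreg x + s.wreg y) }
  | .wload x a i, s => { s with wreg := Function.update s.wreg x (s.warr a (s.reg i)) }
  | .wstore a i x, s =>
      { s with warr := Function.update s.warr a (Function.update (s.warr a) (s.reg i) (s.wreg x)) }
  | .emit r, s => { s with out := s.out ++ [s.reg r] }

/-- Elementary tests. -/
inductive Test where
  /-- `reg r < reg q` -/
  | lt (r q : ℕ)
  /-- `reg r = reg q` -/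
  | eq (r q : ℕ)
  /-- `wreg x < wreg y` -/
  | wlt (x y : ℕ)

/-- The test `b` succeeds in the state `s`. -/
def Test.Holds : Test → State → Prop
  | .lt r q, s => s.reg r < s.reg q
  | .eq r q, s => s.reg r = s.reg q
  | .wlt x y, s => s.wreg x < s.wreg y

/-- Programs. -/
inductive Program where
  | skip
  | instr (i : Instr)
  | seq (p q : Program)
  | cond (b : Test) (p q : Program)
  | loop (b : Test) (p : Program)

/-- `Exec p s s' t`: started in the state `s`, the program `p` halts in the state `s'` after exactly
`t` steps. Every elementary instruction and every evaluation of a test counts as one step. -/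
inductive Exec : Program → State → State → ℕ → Prop where
  | skip (s : State) : Exec .skip s s 1
  | instr (i : Instr) (s : State) : Exec (.instr i) s (i.run s) 1
  | seq {p q : Program} {s₁ s₂ s₃ : State} {t₁ t₂ : ℕ} :
      Exec p s₁ s₂ t₁ → Exec q s₂ s₃ t₂ → Exec (.seq p q) s₁ s₃ (t₁ + t₂)
  | condTrue {b : Test} {p q : Program} {s s' : State} {t : ℕ} :
      b.Holds s → Exec p s s' t → Exec (.cond b p q) s s' (t + 1)
  | condFalse {b : Test} {p q : Program} {s s' : State} {t : ℕ} :
      ¬ b.Holds s → Exec q s s' t → Exec (.cond b p q) s s' (t + 1)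
  | loopDone {b : Test} {p : Program} {s : State} :
      ¬ b.Holds s → Exec (.loop b p) s s 1
  | loopStep {b : Test} {p : Program} {s₁ s₂ s₃ : State} {t₁ t₂ : ℕ} :
      b.Holds s₁ → Exec p s₁ s₂ t₁ → Exec (.loop b p) s₂ s₃ t₂ →
      Exec (.loop b p) s₁ s₃ (t₁ + t₂ + 1)

end RAM

/-! ### Input: weighted graphs given by adjacency lists -/

/-- `L v` lists the neighbours of `v`, each once, in any order. -/
def IsAdjacencyLists {n : ℕ} (G : SimpleGraph (Fin n)) (L : Fin n → List (Fin n)) : Prop :=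
  ∀ v, (L v).Nodup ∧ ∀ u, u ∈ L v ↔ G.Adj v u

/-- The initial memory. Register `0` holds `n`; array `1` holds the concatenation of the adjacency
lists `L 0, …, L (n-1)`; cell `k ≤ n` of array `0` holds the position in array `1` where the list
of vertex `k` begins (for `k = n`, where the last list ends); cell `v < n` of weight array `0` holds
the weight of `v`. Everything else is `0` and the output is empty. -/
noncomputable def inputState {n : ℕ} (w : Fin n → ℝ≥0) (L : Fin n → List (Fin n)) : RAM.State where
  reg r := if r = 0 then n else 0
  arr a k :=
    if a = 0 then (if k ≤ n then ∑ v : Fin n with v.val < k, (L v).length else 0)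
    else if a = 1 then (((List.finRange n).flatMap L).map Fin.val).getD k 0
    else 0
  wreg _ := 0
  warr a k := if a = 0 then (if h : k < n then w ⟨k, h⟩ else 0) else 0
  out := []

/-! ### Graph classes -/

section Graphs

variable {V : Type*}

/-- No hole (chordless cycle of length at least `4`) of even length. -/
def EvenHoleFree (G : SimpleGraph V) : Prop :=
  ∀ k : ℕ, 4 ≤ k → Even k → IsEmpty (SimpleGraph.cycleGraph k ↪g G)

/-- No hole of length `4`. -/
def FourHoleFree (G : SimpleGraph V) : Prop :=
  IsEmpty (SimpleGraph.cycleGraph 4 ↪g G)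

open Classical in
/-- The edges can be given weights `0`, `1` such that every chordless cycle (triangles included) has
odd weight. -/
def OddSignable (G : SimpleGraph V) : Prop :=
  ∃ σ : Sym2 V → ℕ, (∀ e ∈ G.edgeSet, σ e = 0 ∨ σ e = 1) ∧
    ∀ k : ℕ, 3 ≤ k → ∀ f : SimpleGraph.cycleGraph k ↪g G,
      Odd (∑ e ∈ (SimpleGraph.cycleGraph k).edgeFinset, σ (e.map f))

end Graphs

/-! ### Output -/

/-- `S` is a clique of maximum weight. -/
def IsMaxWeightClique {n : ℕ} (G : SimpleGraph (Fin n)) (w : Fin n → ℝ≥0)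
    (S : Finset (Fin n)) : Prop :=
  G.IsClique (S : Set (Fin n)) ∧
    ∀ T : Finset (Fin n), G.IsClique (T : Set (Fin n)) → ∑ v ∈ T, w v ≤ ∑ v ∈ S, w v

/-- The output `0` followed by the elements of `S`, each once. -/
def IsCliqueOutput {n : ℕ} (out : List ℕ) (S : Finset (Fin n)) : Prop :=
  ∃ l : List (Fin n), l.Nodup ∧ l.toFinset = S ∧ out = 0 :: l.map Fin.val

open Classical in
/-- The LexBFS label of the vertex `u` when the vertices `order 0, …, order (i-1)` have been
visited: the visited vertices receive the numbers `n, n-1, …`, and the label of `u` is the list of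
the numbers of its visited neighbours, in the order of the visit. -/
noncomputable def lexLabel {n : ℕ} (G : SimpleGraph (Fin n)) (order : Equiv.Perm (Fin n))
    (i : Fin n) (u : Fin n) : List ℕ :=
  ((List.finRange n).filter (fun k => k < i ∧ G.Adj (order k) u)).map (fun k => n - k.val)

/-- `order` can be produced by LexBFS: the next vertex visited always has a lexicographically
largest label among the unvisited vertices. -/
def IsLexBFSOrdering {n : ℕ} (G : SimpleGraph (Fin n)) (order : Equiv.Perm (Fin n)) : Prop :=
  ∀ i j : Fin n, i ≤ j → lexLabel G order i (order j) ≤ lexLabel G order i (order i)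

/-- The data of a certificate: an ordering of the vertices, a position in it, and a list of
vertices. -/
structure Certificate (n : ℕ) where
  order : Equiv.Perm (Fin n)
  pos : Fin n
  hole : List (Fin n)

/-- `order` is a LexBFS ordering, and `hole` lists, in cyclic order, the vertices of a hole of `G`
all of which are neighbours of the vertex at position `pos` and precede it in the ordering. -/
def Certificate.Valid {n : ℕ} (c : Certificate n) (G : SimpleGraph (Fin n)) : Prop :=
  IsLexBFSOrdering G c.order ∧
    ∃ k : ℕ, 4 ≤ k ∧ ∃ f : SimpleGraph.cycleGraph k ↪g G, c.hole = List.ofFn f ∧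
      ∀ j : Fin k, G.Adj (c.order c.pos) (f j) ∧ c.order.symm (f j) < c.pos

/-- The output `1`, the position, the ordering, the hole. -/
def Certificate.encode {n : ℕ} (c : Certificate n) : List ℕ :=
  1 :: c.pos.val :: ((List.ofFn c.order).map Fin.val ++ c.hole.map Fin.val)

/-! The algorithm tries to show that every earlier neighbourhood in a LexBFS ordering of the graph
is chordal. Let `v` be a vertex and `K` the set of its neighbours that precede it. Every nonempty
clique has a last vertex `v`, and the rest of it lies in `K`. The program runs LexBFS again, on `K`.
If in this second ordering the earlier neighbours `S` of each vertex `u` form a clique, then a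
clique whose last vertex is `v`, and whose remaining part ends at `u` in the second ordering, lies
in the clique `{v, u} ∪ S`. So `{v}` and one candidate for each `u ∈ K` are enough. To see that `S`
is a clique it suffices to compare it with the neighbourhood of its last element (`Earlier.cliq`).

If the comparison fails, some `u` has two nonadjacent earlier neighbours `p` and `q` in `K`. The key
fact about LexBFS is `LexRule.exists_conn`: among the neighbours of the last vertex `z`, all those
that miss another neighbour of `z` have neighbours in one and the same connected set of
non-neighbours of `z`. With `z = u` this yields a path from `p` to `q` whose interior avoids the
neighbours of `u`. A shortest such path together with `u` is a hole, and it lies in `K`. This is the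
certificate (`Conflict.reached`, `Conflict.closes`).

The same fact with `z = v`, in the ordering of the whole graph, shows what a certificate proves.
Each vertex of a hole in `K` misses another vertex of the hole, so all of them have neighbours in
one connected set `C` outside the closed neighbourhood of `v`. By `Wheel.exists_not_attached` this
is impossible in a 4-hole-free odd-signable graph. The argument there is a parity count. The hole is
odd, and stretches of it between successive vertices attached to `C` have even length unless they
are single edges (`Wheel.even_gap`), so the number of edges with both ends attached is odd
(`Wheel.odd_card_attachedEdges`). A minimal connected set with at least two such edges is then taken
apart by removing non-cut vertices.

Even-hole-free graphs are odd-signable with weight `1` on every edge, so they have no certificate.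

For the running time, LexBFS is implemented with integer ranks instead of labels (`RankInv.step`).
One step costs `O(n)`, so a search of `K` costs `O(|K| n)`, and the sizes of the sets `K` sum to at
most the sum of the degrees. In the search of the whole graph the isolated vertices are set apart,
which leaves at most `2m` rounds. The search for a hole takes place at most once. -/

/-! ### Induced paths and chordless cycles as lists -/

section ChordlessCycles

variable {V : Type*}

/-- The vertices of a chordless path, in order. -/
def IndPath (G : SimpleGraph V) : List V → Prop
  | [] => True
  | [_] => True
  | a :: b :: l => G.Adj a b ∧ (∀ x ∈ l, a ≠ x ∧ ¬ G.Adj a x) ∧ IndPath G (b :: l)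

/-- `c` followed by the chordless path `P` is a chordless cycle. -/
def Closes (G : SimpleGraph V) (c : V) (P : List V) : Prop :=
  IndPath G P ∧ 2 ≤ P.length ∧
    ∀ x ∈ P, c ≠ x ∧ (G.Adj c x ↔ P.head? = some x ∨ P.getLast? = some x)

/-- The total weight modulo `2` of the edges of a path. -/
def pathWeight (s : V → V → ZMod 2) : List V → ZMod 2
  | [] => 0
  | [_] => 0
  | a :: b :: l => s a b + pathWeight s (b :: l)

variable {G : SimpleGraph V}

theorem IndPath.get {l : List V} (h : IndPath G l) :
    ∀ i j (hij : i < j) (hj : j < l.length),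
      l[i] ≠ l[j] ∧ (G.Adj l[i] l[j] ↔ j = i + 1) := by
  induction l with
  | nil => intro i j _ hj; simp at hj
  | cons a t ih =>
    cases t with
    | nil => intro i j hij hj; simp at hj; omega
    | cons b l =>
      obtain ⟨h1, h2, h3⟩ := h
      intro i j hij hj
      cases j with
      | zero => omega
      | succ j =>
        cases i with
        | succ i =>
          have := ih h3 i j (by omega) (by simpa using hj)
          simpa using this
        | zero =>
          cases j with
          | zero => simpa using ⟨h1.ne, h1⟩
          | succ j =>
            have := h2 (l[j]'(by simpa using hj)) (List.getElem_mem _)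
            simpa using this

theorem IndPath.nodup {l : List V} (h : IndPath G l) : l.Nodup := by
  rw [List.nodup_iff_injective_getElem]
  intro i j hij
  rcases lt_trichotomy i.1 j.1 with h1 | h1 | h1
  · exact absurd hij (h.get _ _ h1 j.2).1
  · exact Fin.ext h1
  · exact absurd hij.symm (h.get _ _ h1 i.2).1

theorem IndPath.cons_iff {a : V} {l : List V} :
    IndPath G (a :: l) ↔
      IndPath G l ∧ ∀ x ∈ l, a ≠ x ∧ (G.Adj a x ↔ l.head? = some x) := by
  cases l with
  | nil => simp [IndPath]
  | cons b l =>
    constructor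
    · intro h
      have hn := h.nodup
      obtain ⟨h1, h2, h3⟩ := h
      refine ⟨h3, fun x hx => ?_⟩
      rcases List.mem_cons.1 hx with rfl | hx
      · simp [h1, h1.ne]
      · have := h2 x hx
        have hb : b ≠ x := by rintro rfl; simp_all
        simp [this, hb]
    · rintro ⟨h3, h⟩
      have hn := h3.nodup
      refine ⟨by simpa using (h b (by simp)).2, fun x hx => ?_, h3⟩
      have hb : b ≠ x := by rintro rfl; simp_all
      have := h x (by simp [hx])
      simpa [hb] using this

theorem IndPath.append {l₁ l₂ : List V} (h₁ : IndPath G l₁) (h₂ : IndPath G l₂)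
    (h : ∀ x ∈ l₁, ∀ y ∈ l₂, x ≠ y ∧
      (G.Adj x y ↔ l₁.getLast? = some x ∧ l₂.head? = some y)) : IndPath G (l₁ ++ l₂) := by
  induction l₁ with
  | nil => simpa using h₂
  | cons a t ih =>
    have hn := h₁.nodup
    rw [IndPath.cons_iff] at h₁
    rw [List.cons_append, IndPath.cons_iff]
    cases t with
    | nil =>
      refine ⟨by simpa using h₂, fun x hx => ?_⟩
      simpa using h a (by simp) x (by simpa using hx)
    | cons b t =>
      refine ⟨ih h₁.1 fun x hx y hy => ?_, fun x hx => ?_⟩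
      · have := h x (by simp [List.mem_cons.1 hx]) y hy
        simpa [List.getLast?_cons_cons] using this
      · rcases List.mem_append.1 hx with hx | hx
        · simpa using h₁.2 x hx
        · have h5 := h a (by simp) x hx
          have h6 := h b (by simp) x hx
          refine ⟨h5.1, ?_⟩
          rw [h5.2]
          constructor
          · rintro ⟨h7, -⟩
            rw [List.getLast?_cons_cons] at h7
            have := List.mem_of_getLast? h7
            simp_all
          · intro h7
            simp at h7
            exact absurd h7 h6.1

theorem cycleGraph_adj_of_lt {k : ℕ} (hk : 3 ≤ k) (i j : Fin k) (hij : i < j) :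
    (SimpleGraph.cycleGraph k).Adj i j ↔ j.val = i.val + 1 ∨ (i.val = 0 ∧ j.val = k - 1) := by
  have := i.2
  have := j.2
  have h : i.val < j.val := hij
  have h' : (i - j).val = k + i.val - j.val := by
    rw [Fin.sub_def]
    change (k - j.val + i.val) % k = _
    rw [Nat.mod_eq_of_lt] <;> omega
  rw [SimpleGraph.cycleGraph_adj', Fin.sub_val_of_le hij.le, h']
  omega

/-- The embedding of a cycle given by the list of its vertices. -/
theorem Closes.exists_embedding {c : V} {P : List V} (h : Closes G c P) :
    ∃ f : SimpleGraph.cycleGraph (P.length + 1) ↪g G, List.ofFn f = c :: P := by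
  obtain ⟨hP, hlen, hc⟩ := h
  have key : ∀ i j : Fin (P.length + 1), i < j → (c :: P)[i.1] ≠ (c :: P)[j.1] ∧
      (G.Adj (c :: P)[i.1] (c :: P)[j.1] ↔
        (SimpleGraph.cycleGraph (P.length + 1)).Adj i j) := by
    rintro ⟨i, hi⟩ ⟨j, hj⟩ hij
    rw [cycleGraph_adj_of_lt (by omega) _ _ hij]
    replace hij : i < j := hij
    obtain ⟨j, rfl⟩ : ∃ j', j = j' + 1 := ⟨j - 1, by omega⟩
    have hj' : j < P.length := by omega
    cases i with
    | succ i =>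
      have := hP.get i j (by omega) hj'
      simp only [List.getElem_cons_succ]
      refine ⟨this.1, this.2.trans ?_⟩
      simp
    | zero =>
      have := hc P[j] (List.getElem_mem _)
      simp only [List.getElem_cons_succ, List.getElem_cons_zero]
      refine ⟨this.1, this.2.trans ?_⟩
      rw [List.head?_eq_getElem?, List.getLast?_eq_getElem?]
      rw [List.getElem?_eq_getElem (by omega), List.getElem?_eq_getElem (by omega)]
      simp only [Option.some.injEq, hP.nodup.getElem_inj_iff]
      simp; omega
  refine ⟨⟨⟨fun i => (c :: P)[i.1]'(by simp; omega), ?_⟩, ?_⟩, ?_⟩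
  · intro i j hij
    rcases lt_trichotomy i j with h1 | h1 | h1
    · exact absurd hij (key i j h1).1
    · exact h1
    · exact absurd hij.symm (key j i h1).1
  · intro i j
    rcases lt_trichotomy i j with h1 | h1 | h1
    · exact (key i j h1).2
    · subst h1; simp
    · rw [SimpleGraph.adj_comm, SimpleGraph.adj_comm _ i]; exact (key j i h1).2
  · apply List.ext_getElem
    · simp
    · intro i h1 h2
      rw [List.getElem_ofFn]
      rfl

theorem pathWeight_ofFn (s : V → V → ZMod 2) : ∀ (m : ℕ) (f : Fin (m + 1) → V),
    pathWeight s (List.ofFn f) = ∑ i : Fin m, s (f i.castSucc) (f i.succ)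
  | 0, f => by simp [pathWeight]
  | m + 1, f => by
    have := pathWeight_ofFn s m (fun i => f i.succ)
    rw [Fin.sum_univ_succ, List.ofFn_succ, List.ofFn_succ, pathWeight]
    rw [List.ofFn_succ] at this
    simp only [Fin.succ_castSucc] at this ⊢
    rw [this]
    rfl

-- Cutting the cycle at the edge between its last and its first vertex turns a sum over edges into a
-- sum along a path and one closing term. This connects `OddSignable`, stated with `edgeFinset`, to
-- weights of lists of vertices.
open Classical in
theorem sum_cycleGraph_edgeFinset {M : Type*} [AddCommMonoid M] (m : ℕ) (hm : 2 ≤ m)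
    (g : Sym2 (Fin (m + 1)) → M) :
    ∑ e ∈ (SimpleGraph.cycleGraph (m + 1)).edgeFinset, g e =
      ∑ i : Fin m, g s(i.castSucc, i.succ) + g s(0, Fin.last m) := by
  have : ∑ i : Fin m, g s(i.castSucc, i.succ) + g s(0, Fin.last m) =
      ∑ i : Option (Fin m), g (i.elim s(0, Fin.last m) fun i => s(i.castSucc, i.succ)) := by
    rw [Fintype.sum_option, add_comm]; rfl
  rw [this]
  symm
  refine Finset.sum_bij (fun i _ => i.elim s(0, Fin.last m) fun i => s(i.castSucc, i.succ))
    ?_ ?_ ?_ (fun _ _ => rfl)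
  · rintro (_ | i) -
    · simp only [Option.elim_none, SimpleGraph.mem_edgeFinset, SimpleGraph.mem_edgeSet]
      rw [cycleGraph_adj_of_lt (by omega) _ _ (by simp [Fin.lt_def]; omega)]
      simp
    · simp only [Option.elim_some, SimpleGraph.mem_edgeFinset, SimpleGraph.mem_edgeSet]
      rw [cycleGraph_adj_of_lt (by omega) _ _ (by simp [Fin.lt_def])]
      simp
  · rintro (_ | ⟨i, hi⟩) - (_ | ⟨j, hj⟩) - h
    · rfl
    · simp [Fin.ext_iff] at h; omega
    · simp [Fin.ext_iff] at h; omega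
    · simp [Fin.ext_iff] at h; simp; omega
  · intro e he
    induction e using Sym2.ind with
    | _ x y =>
      have main : ∀ x y : Fin (m + 1), x < y → (SimpleGraph.cycleGraph (m + 1)).Adj x y →
          ∃ a, ∃ (_ : a ∈ Finset.univ), Option.elim a s(0, Fin.last m)
            (fun i : Fin m => s(i.castSucc, i.succ)) = s(x, y) := by
        rintro ⟨x, hx⟩ ⟨y, hy⟩ hxy h
        rw [cycleGraph_adj_of_lt (by omega) _ _ hxy] at h
        simp at h
        rcases h with h | h
        · exact ⟨some ⟨x, by omega⟩, by simp, by simp [h]⟩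
        · refine ⟨none, by simp, ?_⟩
          obtain ⟨rfl, rfl⟩ := h
          simp [Fin.ext_iff]
      simp only [SimpleGraph.mem_edgeFinset, SimpleGraph.mem_edgeSet] at he
      rcases lt_trichotomy x y with h | h | h
      · exact main x y h he
      · subst h; simp at he
      · rw [Sym2.eq_swap (a := x)]; exact main y x h he.symm

/-- A weighting modulo `2` for which all chordless cycles are odd. -/
def OddWeights (G : SimpleGraph V) (s : V → V → ZMod 2) : Prop :=
  (∀ a b, s a b = s b a) ∧ ∀ c P a b, Closes G c P → P.head? = some a → P.getLast? = some b →
    pathWeight s P + s c a + s c b = 1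

/-- Only parities matter from here on. Over `ZMod 2` the double counting of edges becomes a linear
identity between weights of cycles. -/
theorem OddSignable.exists_oddWeights (h : OddSignable G) : ∃ s, OddWeights G s := by
  classical
  obtain ⟨σ, -, hσ⟩ := h
  refine ⟨fun a b => (σ s(a, b) : ZMod 2), fun a b => by beta_reduce; rw [Sym2.eq_swap], ?_⟩
  intro c P a b hc ha hb
  obtain ⟨f, hf⟩ := hc.exists_embedding
  have h2 : 2 ≤ P.length := hc.2.1
  have h1 := hσ (P.length + 1) (by omega) f
  have h3 := ZMod.natCast_eq_one_iff_odd.2 h1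
  rw [Nat.cast_sum] at h3
  have h4 := sum_cycleGraph_edgeFinset P.length h2 (fun e => (σ (e.map f) : ZMod 2))
  have h5 := pathWeight_ofFn (fun a b => (σ s(a, b) : ZMod 2)) P.length f
  rw [hf] at h5
  have h0 : f 0 = c := by
    have : (List.ofFn f)[0]'(by simp) = (c :: P)[0] := by simp only [hf]
    simpa using this
  have hl : f (Fin.last P.length) = b := by
    have : (List.ofFn f).getLast? = (c :: P).getLast? := by rw [hf]
    rw [List.getLast?_cons, hb, List.getLast?_eq_getElem?] at this
    rw [List.getElem?_eq_getElem (by simp), List.getElem_ofFn] at this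
    simpa [Fin.last] using this
  simp only [Sym2.map_mk, h0, hl] at h4
  rw [← h5] at h4
  have h6 : pathWeight (fun a b => (σ s(a, b) : ZMod 2)) (c :: P) =
      (σ s(c, a) : ZMod 2) + pathWeight (fun a b => (σ s(a, b) : ZMod 2)) P := by
    cases P with
    | nil => simp at ha
    | cons x P => simp at ha; subst ha; rfl
  rw [h6] at h4
  have h7 := h4.symm.trans (Eq.trans (by congr!) h3)
  rw [← h7]; ring

theorem pathWeight_append (s : V → V → ZMod 2) {l₁ l₂ : List V} {a b : V}
    (ha : l₁.getLast? = some a) (hb : l₂.head? = some b) :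
    pathWeight s (l₁ ++ l₂) = pathWeight s l₁ + s a b + pathWeight s l₂ := by
  induction l₁ with
  | nil => simp at ha
  | cons x t ih =>
    cases t with
    | nil =>
      cases l₂ with
      | nil => simp at hb
      | cons y l₂ => simp at ha hb; subst ha hb; simp [pathWeight]
    | cons y t =>
      rw [List.getLast?_cons_cons] at ha
      have := ih ha
      simp only [List.cons_append, pathWeight] at this ⊢
      rw [this]; ring

/-- In an even-hole-free graph all chordless cycles are odd. -/
theorem EvenHoleFree.oddSignable (h : EvenHoleFree G) : OddSignable G := by
  classical
  -- With all weights `1` the weight of a cycle is its length, and the only chordless cycles that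
  -- are not holes are triangles.
  refine ⟨fun _ => 1, fun _ _ => Or.inr rfl, fun k hk f => ?_⟩
  by_contra hodd
  obtain ⟨m, rfl⟩ : ∃ m, k = m + 1 := ⟨k - 1, by omega⟩
  have h4 := sum_cycleGraph_edgeFinset m (by omega) (fun _ => 1)
  have h5 : ∑ e ∈ (SimpleGraph.cycleGraph (m + 1)).edgeFinset, 1 = m + 1 := by
    rw [h4]; simp
  rw [Nat.not_odd_iff_even] at hodd
  have h6 : Even (m + 1) := by
    rw [← h5]; convert hodd
  refine (h (m + 1) ?_ h6).false f
  by_contra h7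
  obtain rfl : m = 2 := by omega
  exact absurd h6 (by decide)

theorem EvenHoleFree.fourHoleFree (h : EvenHoleFree G) : FourHoleFree G :=
  h 4 le_rfl (by decide)

end ChordlessCycles

/-! ### Connected sets of vertices -/

section ConnectedSets

variable {V : Type*} {G : SimpleGraph V}

/-- The finite set `C` induces a connected subgraph. -/
def Conn (G : SimpleGraph V) (C : Finset V) : Prop :=
  C.Nonempty ∧ ∀ D ⊆ C, D.Nonempty → D ≠ C → ∃ a ∈ D, ∃ b ∈ C, b ∉ D ∧ G.Adj a b

theorem Conn.singleton (a : V) : Conn G {a} := by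
  refine ⟨by simp, fun D h1 h2 h3 => ?_⟩
  rcases Finset.subset_singleton_iff.1 h1 with rfl | rfl
  · simp at h2
  · simp at h3

theorem Conn.insert_adj [DecidableEq V] {C : Finset V} (h : Conn G C) {a w : V} (ha : a ∈ C) (haw : G.Adj a w) :
    Conn G (insert w C) := by
  refine ⟨by simp, fun D h1 h2 h3 => ?_⟩
  by_cases hD : (D ∩ C).Nonempty
  · by_cases hDC : D ∩ C = C
    · refine ⟨a, ?_, w, by simp, ?_, haw⟩
      · rw [← hDC] at ha; exact (Finset.mem_inter.1 ha).1
      · intro hw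
        apply h3
        apply Finset.Subset.antisymm h1
        intro x hx
        rcases Finset.mem_insert.1 hx with rfl | hx
        · exact hw
        · rw [← hDC] at hx; exact (Finset.mem_inter.1 hx).1
    · obtain ⟨x, hx, y, hy, hyD, hxy⟩ := h.2 (D ∩ C) Finset.inter_subset_right hD hDC
      simp only [Finset.mem_inter] at hx hyD
      exact ⟨x, hx.1, y, by simp [hy], fun hyD' => hyD ⟨hyD', hy⟩, hxy⟩
  · have hD' : ∀ x ∈ D, x = w := by
      intro x hx
      rcases Finset.mem_insert.1 (h1 hx) with rfl | hx'
      · rfl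
      · exact absurd ⟨x, Finset.mem_inter.2 ⟨hx, hx'⟩⟩ hD
    obtain ⟨x, hx⟩ := h2
    obtain rfl := hD' x hx
    refine ⟨x, hx, a, by simp [ha], fun haD => ?_, haw.symm⟩
    exact haw.ne (hD' a haD)

/-- A connected proper subset of a connected set avoids some non-cut vertex. -/
theorem Conn.exists_erase [DecidableEq V] {C D : Finset V} (hC : Conn G C) (hD : Conn G D) (hDC : D ⊂ C) :
    ∃ w ∈ C, w ∉ D ∧ Conn G (C.erase w) := by
  classical
  -- A maximal connected proper subset `X` of `C` containing `D` can be enlarged by an adjacent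
  -- vertex `b` of `C`. By maximality the result is `C`, so `X` is `C` without `b`.
  obtain ⟨X, hX, hmax⟩ := Finset.exists_max_image
    (C.powerset.filter fun X => D ⊆ X ∧ X ≠ C ∧ Conn G X) Finset.card
    ⟨D, by simp [hDC.1, hD, hDC.ne]⟩
  simp only [Finset.mem_filter, Finset.mem_powerset] at hX hmax
  obtain ⟨h1, h2, h3, h4⟩ := hX
  obtain ⟨a, ha, b, hb, hbX, hab⟩ := hC.2 X h1 h4.1 h3
  have h5 := h4.insert_adj ha hab
  have h6 : insert b X = C := by
    by_contra h7
    have := hmax (insert b X) ⟨Finset.insert_subset hb h1, h2.trans (Finset.subset_insert _ _),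
      h7, h5⟩
    rw [Finset.card_insert_of_notMem hbX] at this
    omega
  refine ⟨b, hb, fun h => hbX (h2 h), ?_⟩
  rwa [← h6, Finset.erase_insert hbX]

/-- If no connected proper subset of `C` contains both of its non-cut vertices `u` and `u'`, then
`C` remains connected when they are removed. -/
theorem Conn.erase_erase [DecidableEq V] {C : Finset V} {u u' w : V} (hu : u ∈ C)
    (hu' : u' ∈ C) (huu : u ≠ u') (h : Conn G (C.erase u)) (h' : Conn G (C.erase u'))
    (hmin : ∀ D ⊆ C, Conn G D → u ∈ D → u' ∈ D → D = C) (hw : w ∈ C) (hwu : w ≠ u)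
    (hwu' : w ≠ u') : Conn G ((C.erase u).erase u') := by
  classical
  -- Let `A` be a largest connected subset of `C` without `u` and `u'`. Edges leave `A` inside `C -
  -- u` and inside `C - u'`, and by maximality they end in `u'` and `u` respectively. So `A` with
  -- `u` and `u'` is connected, hence equal to `C` by `hmin`.
  obtain ⟨A, hA, hmax⟩ := Finset.exists_max_image
    (((C.erase u).erase u').powerset.filter fun X => Conn G X) Finset.card
    ⟨{w}, by simp [Conn.singleton, hw, hwu, hwu']⟩
  simp only [Finset.mem_filter, Finset.mem_powerset] at hA hmax
  obtain ⟨h1, h2⟩ := hA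
  have hAm : ∀ x ∈ A, x ≠ u' ∧ x ≠ u ∧ x ∈ C := fun x hx => by simpa using h1 hx
  have cross : ∀ x ∈ A, ∀ y ∈ C, y ∉ A → G.Adj x y → y = u ∨ y = u' := by
    intro x hx y hy hyA hxy
    by_contra hne
    push Not at hne
    have := hmax (insert y A) ⟨?_, h2.insert_adj hx hxy⟩
    · rw [Finset.card_insert_of_notMem hyA] at this
      omega
    · intro z hz
      rcases Finset.mem_insert.1 hz with rfl | hz
      · simp [hy, hne]
      · exact h1 hz
  obtain ⟨x, hx, y, hy, hyA, hxy⟩ := h.2 A (fun x hx => by simp [hAm x hx]) h2.1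
    (fun hA => (hAm u' (by simp [hA, hu', huu.symm])).1 rfl)
  obtain ⟨x', hx', z, hz, hzA, hxz⟩ := h'.2 A (fun x hx => by simp [hAm x hx]) h2.1
    (fun hA => (hAm u (by simp [hA, hu, huu])).2.1 rfl)
  simp only [Finset.mem_erase] at hy hz
  obtain rfl := (cross x hx y hy.2 hyA hxy).resolve_left hy.1
  obtain rfl := (cross x' hx' z hz.2 hzA hxz).resolve_right hz.1
  have := hmin _ ?_ ((h2.insert_adj hx hxy).insert_adj (a := x') (by simp [hx']) hxz) (by simp) (by simp)
  · have h3 : A = (C.erase z).erase y := by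
      rw [← this]
      ext t
      simp only [Finset.mem_erase, Finset.mem_insert]
      constructor
      · intro ht; have := hAm t ht; tauto
      · tauto
    rwa [← h3]
  · intro t ht
    simp only [Finset.mem_insert] at ht
    rcases ht with rfl | rfl | ht
    · exact hu
    · exact hu'
    · exact (hAm t ht).2.2

/-- Some vertex with the property `B` is reached from `x` in `n` steps inside `C`. -/
def ReachIn (G : SimpleGraph V) (C : Finset V) (B : V → Prop) : ℕ → V → Prop
  | 0, x => x ∈ C ∧ B x
  | n + 1, x => x ∈ C ∧ ∃ y, G.Adj x y ∧ ReachIn G C B n y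

/-- No edge of `C` leaves the set of vertices with a walk to `B`, and this set is nonempty, so it is
all of `C`. -/
theorem Conn.exists_reachIn {C : Finset V} (hC : Conn G C) {B : V → Prop} (hB : ∃ x ∈ C, B x) :
    ∀ x ∈ C, ∃ n, ReachIn G C B n x := by
  classical
  by_contra hne
  push Not at hne
  obtain ⟨x, hx, hxn⟩ := hne
  obtain ⟨b, hb, hbB⟩ := hB
  obtain ⟨a, ha, c, hc, hcn, hac⟩ := hC.2 (C.filter fun x => ∃ n, ReachIn G C B n x)
    (Finset.filter_subset _ _) ⟨b, by simp only [Finset.mem_filter]; exact ⟨hb, 0, hb, hbB⟩⟩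
    (fun h => by rw [← h] at hx; obtain ⟨n, hn⟩ := (Finset.mem_filter.1 hx).2; exact hxn n hn)
  simp only [Finset.mem_filter] at ha hcn
  obtain ⟨n, hn⟩ := ha.2
  exact hcn ⟨hc, n + 1, hc, a, hac.symm, hn⟩

/-- A shortest walk is chordless, since a chord would shorten it. The last clause, that the later
vertices are closer to `B`, is carried along because the induction needs it to exclude chords. -/
theorem ReachIn.exists_indPath {C : Finset V} {B : V → Prop} : ∀ (n : ℕ) (x : V),
    ReachIn G C B n x → (∀ m < n, ¬ ReachIn G C B m x) →
    ∃ l, IndPath G l ∧ l.head? = some x ∧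
      ∀ y ∈ l, y ∈ C ∧ (B y ↔ l.getLast? = some y) ∧ (y = x ∨ ∃ m < n, ReachIn G C B m y)
  | 0, x, h, _ => ⟨[x], trivial, rfl, fun y hy => by
      obtain rfl := List.mem_singleton.1 hy
      exact ⟨h.1, by simp [h.2], Or.inl rfl⟩⟩
  | n + 1, x, h, hmin => by
    obtain ⟨hx, y, hxy, hy⟩ := h
    obtain ⟨l, hl, hhead, hl'⟩ := ReachIn.exists_indPath n y hy fun m hm hmy =>
      hmin (m + 1) (by omega) ⟨hx, y, hxy, hmy⟩
    have hne : l ≠ [] := by rintro rfl; simp at hhead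
    have hxl : ∀ z ∈ l, x ≠ z ∧ (G.Adj x z ↔ l.head? = some z) := by
      intro z hz
      rcases (hl' z hz).2.2 with rfl | ⟨m, hm, hmz⟩
      · simp [hhead, hxy, hxy.ne]
      · have h1 : x ≠ z := by rintro rfl; exact hmin m (by omega) hmz
        have h2 : ¬ G.Adj x z := fun h => hmin (m + 1) (by omega) ⟨hx, z, h, hmz⟩
        refine ⟨h1, iff_of_false h2 ?_⟩
        rw [hhead]
        rintro ⟨⟩
        exact h2 hxy
    refine ⟨x :: l, IndPath.cons_iff.2 ⟨hl, hxl⟩, rfl, fun z hz => ?_⟩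
    have hlast : (x :: l).getLast? = l.getLast? := by
      cases l with
      | nil => simp at hne
      | cons a t => exact List.getLast?_cons_cons
    rw [hlast]
    rcases List.mem_cons.1 hz with rfl | hz
    · refine ⟨hx, ?_, Or.inl rfl⟩
      refine iff_of_false (fun hB => hmin 0 (by omega) ⟨hx, hB⟩) fun hla => ?_
      exact (hxl z (List.mem_of_getLast? hla)).1 rfl
    · obtain ⟨h1, h2, h3⟩ := hl' z hz
      refine ⟨h1, h2, Or.inr ?_⟩
      rcases h3 with rfl | ⟨m, hm, hmz⟩
      · exact ⟨n, by omega, hy⟩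
      · exact ⟨m, by omega, hmz⟩

/-- A connected set that meets `A` and `B` contains a chordless path whose only vertex in `A` is the
first and whose only vertex in `B` is the last one. -/
theorem Conn.exists_indPath {C : Finset V} (hC : Conn G C) {A B : V → Prop} (hA : ∃ x ∈ C, A x)
    (hB : ∃ x ∈ C, B x) :
    ∃ l, IndPath G l ∧ l ≠ [] ∧
      ∀ x ∈ l, x ∈ C ∧ (A x ↔ l.head? = some x) ∧ (B x ↔ l.getLast? = some x) := by
  classical
  -- Minimizing the length over all starting points in `A` keeps the later vertices of the path out
  -- of `A`, as they are closer to `B`.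
  have hex : ∃ n x, A x ∧ ReachIn G C B n x := by
    obtain ⟨x, hx, hxA⟩ := hA
    obtain ⟨n, hn⟩ := hC.exists_reachIn hB x hx
    exact ⟨n, x, hxA, hn⟩
  obtain ⟨x, hxA, hx⟩ := Nat.find_spec hex
  have hmin : ∀ m < Nat.find hex, ∀ y, A y → ¬ ReachIn G C B m y := fun m hm y hy hmy =>
    Nat.find_min hex hm ⟨y, hy, hmy⟩
  obtain ⟨l, h1, h2, h3⟩ := ReachIn.exists_indPath _ x hx fun m hm => hmin m hm x hxA
  refine ⟨l, h1, by rintro rfl; simp at h2, fun y hy => ?_⟩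
  obtain ⟨h4, h5, h6⟩ := h3 y hy
  refine ⟨h4, ?_, h5⟩
  rw [h2]
  constructor
  · intro hyA
    rcases h6 with rfl | ⟨m, hm, hmy⟩
    · rfl
    · exact absurd hmy (hmin m hm y hyA)
  · rintro ⟨⟩; exact hxA

end ConnectedSets

/-! ### Holes in neighbourhoods -/

section Wheels

variable {V : Type*}

/-- A hole, with vertices `h i`, in the neighbourhood of `v`, in a graph without holes of length
`4` and with weights for which all chordless cycles are odd. -/
structure Wheel (G : SimpleGraph V) (s : V → V → ZMod 2) (v : V) (n : ℕ) (h : ZMod n → V) :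
    Prop where
  odd : OddWeights G s
  four : ∀ c P, Closes G c P → P.length ≠ 3
  four_le : 4 ≤ n
  adj : ∀ i j, G.Adj (h i) (h j) ↔ i = j + 1 ∨ j = i + 1
  inj : Function.Injective h
  adj_center : ∀ i, G.Adj v (h i)

variable {G : SimpleGraph V} {s : V → V → ZMod 2} {v : V} {n : ℕ} {h : ZMod n → V}

theorem OddWeights.triangle (hs : OddWeights G s) {a b c : V} (hab : G.Adj a b) (hbc : G.Adj b c)
    (hac : G.Adj a c) : s b c + s a b + s a c = 1 := by
  have := hs.2 a [b, c] b c ⟨⟨hbc, by simp, trivial⟩, by simp, ?_⟩ rfl rfl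
  · simpa [pathWeight] using this
  · intro x hx
    simp at hx
    rcases hx with rfl | rfl
    · simp [hab, hab.ne]
    · simp [hac, hac.ne]

theorem ZMod.natCast_eq_zero_of_lt {n t : ℕ} (h : (t : ZMod n) = 0) (ht : t < n) : t = 0 :=
  Nat.eq_zero_of_dvd_of_lt ((ZMod.natCast_eq_zero_iff t n).1 h) ht

/-- A chordless path `R` avoiding the closed neighbourhood of `v` joins two neighbours of `v`. -/
theorem OddWeights.path (hs : OddWeights G s) {x y r t : V} {R : List V}
    (hx : G.Adj v x) (hy : G.Adj v y) (hxy : x ≠ y) (hxy' : ¬ G.Adj x y) (hR : IndPath G R)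
    (hr : R.head? = some r) (ht : R.getLast? = some t)
    (hRv : ∀ u ∈ R, u ≠ v ∧ ¬ G.Adj v u) (hRx : ∀ u ∈ R, G.Adj u x ↔ R.head? = some u)
    (hRy : ∀ u ∈ R, G.Adj u y ↔ R.getLast? = some u) :
    pathWeight s R + s x r + s y t + s v x + s v y = 1 := by
  have hne : R ≠ [] := by rintro rfl; simp at hr
  have hP : IndPath G (R ++ [y]) := by
    refine IndPath.append (l₂ := [y]) hR (by trivial) ?_
    intro u hu z hz
    simp at hz
    subst hz
    refine ⟨?_, by simp [hRy u hu]⟩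
    rintro rfl
    exact (hRv u hu).2 hy
  -- The hole runs through `v`, `x`, the path `R` and `y`.
  have hclose : Closes G v (x :: (R ++ [y])) := by
    refine ⟨IndPath.cons_iff.2 ⟨hP, ?_⟩, by simp, ?_⟩
    · intro u hu
      rw [List.head?_append_of_ne_nil _ hne]
      rcases List.mem_append.1 hu with hu | hu
      · refine ⟨?_, by rw [G.adj_comm, hRx u hu]⟩
        rintro rfl
        exact (hRv _ hu).2 hx
      · simp at hu
        subst hu
        refine ⟨hxy, iff_of_false hxy' fun hh => ?_⟩
        exact (hRv u (List.mem_of_mem_head? hh)).2 hy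
    · intro u hu
      have hl : (x :: (R ++ [y])).getLast? = some y := by
        rw [← List.cons_append, List.getLast?_concat]
      rw [hl]
      simp only [List.mem_cons, List.mem_append, List.not_mem_nil, or_false] at hu
      rcases hu with rfl | hu | rfl
      · simp [hx, hx.ne]
      · refine ⟨(hRv u hu).1.symm, iff_of_false (hRv u hu).2 ?_⟩
        rintro (hh | hh)
        · simp at hh; subst hh; exact (hRv _ hu).2 hx
        · simp at hh; subst hh; exact (hRv _ hu).2 hy
      · simp [hy, hy.ne]
  have h1 := hs.2 v _ x y hclose rfl (by rw [← List.cons_append, List.getLast?_concat])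
  have h2 : pathWeight s (x :: (R ++ [y])) = s x r + pathWeight s (R ++ [y]) := by
    obtain ⟨R', rfl⟩ : ∃ R', R = r :: R' := by
      cases R with
      | nil => simp at hne
      | cons a l => simp at hr; exact ⟨l, by rw [hr]⟩
    rfl
  rw [h2, pathWeight_append s ht rfl, hs.1 t y] at h1
  simp only [pathWeight] at h1
  rw [← h1]; ring

/-- `m + 1` consecutive vertices of a hole. -/
def holeArc (h : ZMod n → V) (j : ZMod n) : ℕ → List V
  | 0 => [h j]
  | m + 1 => h j :: holeArc h (j + 1) m

theorem holeArc_head (j : ZMod n) (m : ℕ) : (holeArc h j m).head? = some (h j) := by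
  cases m <;> rfl

theorem holeArc_ne_nil (j : ZMod n) (m : ℕ) : holeArc h j m ≠ [] := by
  cases m <;> simp [holeArc]

theorem holeArc_length (j : ZMod n) (m : ℕ) : (holeArc h j m).length = m + 1 := by
  induction m generalizing j with
  | zero => rfl
  | succ m ih => simp [holeArc, ih]

theorem holeArc_getLast (j : ZMod n) (m : ℕ) : (holeArc h j m).getLast? = some (h (j + m)) := by
  induction m generalizing j with
  | zero => simp [holeArc]
  | succ m ih =>
    rw [holeArc, List.getLast?_cons, ih]
    simp only [Option.getD_some, Option.some.injEq]
    push_cast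
    ring_nf

theorem mem_holeArc {j : ZMod n} {m : ℕ} {x : V} :
    x ∈ holeArc h j m ↔ ∃ t ≤ m, x = h (j + t) := by
  induction m generalizing j with
  | zero => simp [holeArc]
  | succ m ih =>
    rw [holeArc, List.mem_cons, ih]
    constructor
    · rintro (rfl | ⟨t, ht, rfl⟩)
      · exact ⟨0, by omega, by simp⟩
      · exact ⟨t + 1, by omega, by push_cast; ring_nf⟩
    · rintro ⟨t, ht, rfl⟩
      cases t with
      | zero => simp
      | succ t => exact Or.inr ⟨t, by omega, by push_cast; ring_nf⟩

theorem Wheel.indPath_holeArc (W : Wheel G s v n h) (j : ZMod n) (m : ℕ) (hm : m + 2 ≤ n) :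
    IndPath G (holeArc h j m) := by
  induction m generalizing j with
  | zero => trivial
  | succ m ih =>
    refine IndPath.cons_iff.2 ⟨ih (j + 1) (by omega), fun x hx => ?_⟩
    obtain ⟨t, ht, rfl⟩ := mem_holeArc.1 hx
    have h1 : j ≠ j + 1 + t := by
      intro hj
      have : ((t + 1 : ℕ) : ZMod n) = 0 := by push_cast; linear_combination -hj
      have := ZMod.natCast_eq_zero_of_lt this (by omega)
      omega
    refine ⟨fun hh => h1 (W.inj hh), ?_⟩
    rw [W.adj, holeArc_head, Option.some.injEq, W.inj.eq_iff]
    constructor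
    · rintro (hj | hj)
      · have : ((t + 2 : ℕ) : ZMod n) = 0 := by push_cast; linear_combination -hj
        have := ZMod.natCast_eq_zero_of_lt this (by omega)
        omega
      · exact hj.symm
    · intro hj; exact Or.inr hj.symm

/-- The triangles formed by `v` and the edges of the arc are odd. In the sum of their weights every
inner spoke occurs twice, so only the arc and its two outer spokes remain. -/
theorem Wheel.pathWeight_holeArc (W : Wheel G s v n h) (j : ZMod n) (m : ℕ) :
    pathWeight s (holeArc h j m) + s v (h j) + s v (h (j + m)) = m := by
  induction m generalizing j with
  | zero => simp [holeArc, pathWeight]; exact CharTwo.add_self_eq_zero _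
  | succ m ih =>
    have h1 := ih (j + 1)
    have h2 : pathWeight s (holeArc h j (m + 1)) =
        s (h j) (h (j + 1)) + pathWeight s (holeArc h (j + 1) m) := by
      cases m <;> rfl
    have h3 := W.odd.triangle (W.adj_center j) ((W.adj j (j + 1)).2 (Or.inr rfl))
      (W.adj_center (j + 1))
    rw [h2]
    have h4 : j + ((m + 1 : ℕ) : ZMod n) = j + 1 + m := by push_cast; ring
    rw [h4]
    push_cast
    have h5 := CharTwo.add_self_eq_zero (s v (h (j + 1)))
    linear_combination h1 + h3 - h5

/-- Sum the weights of the `n` triangles formed by the centre and the edges of the hole. Every spoke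
cancels, so `n` has the parity of the weight of the hole, which is odd. -/
theorem Wheel.natCast_eq_one (W : Wheel G s v n h) : (n : ZMod 2) = 1 := by
  have hn := W.four_le
  obtain ⟨m, rfl⟩ : ∃ m, n = m + 2 := ⟨n - 2, by omega⟩
  have hm : (1 : ZMod (m + 2)) + m = -1 := by
    have : ((m + 2 : ℕ) : ZMod (m + 2)) = 0 := ZMod.natCast_self _
    push_cast at this
    linear_combination this
  have hclose : Closes G (h 0) (holeArc h 1 m) := by
    refine ⟨W.indPath_holeArc 1 m le_rfl, by rw [holeArc_length]; omega, fun x hx => ?_⟩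
    obtain ⟨t, ht, rfl⟩ := mem_holeArc.1 hx
    rw [holeArc_head, holeArc_getLast, hm]
    simp only [Option.some.injEq, W.inj.eq_iff, W.adj, W.inj.ne_iff]
    refine ⟨fun h0 => ?_, ?_⟩
    · have : ((t + 1 : ℕ) : ZMod (m + 2)) = 0 := by push_cast; linear_combination -h0
      have := ZMod.natCast_eq_zero_of_lt this (by omega)
      omega
    · constructor
      · rintro (h0 | h0)
        · right; linear_combination h0
        · left; linear_combination -h0
      · rintro (h0 | h0)
        · right; linear_combination -h0
        · left; linear_combination h0
  have h1 := W.odd.2 _ _ _ _ hclose (holeArc_head _ _) (holeArc_getLast _ _)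
  have h2 := W.pathWeight_holeArc 1 m
  rw [hm] at h1 h2
  have h3 := W.odd.triangle (W.adj_center 0) ((W.adj 0 1).2 (Or.inr (by simp))) (W.adj_center 1)
  have h4 := W.odd.triangle (W.adj_center 0) ((W.adj 0 (-1)).2 (Or.inl (by simp)))
    (W.adj_center (-1))
  have e1 := CharTwo.add_self_eq_zero (s v (h 0))
  push_cast
  linear_combination h1 - h2 - h3 - h4 + e1 + CharTwo.add_self_eq_zero (s v (h 1)) +
    CharTwo.add_self_eq_zero (s v (h (-1)))

/-- Two neighbours of `v` with a common neighbour not adjacent to `v` are adjacent. -/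
theorem Wheel.adj_of_common (W : Wheel G s v n h) {x y u : V} (hx : G.Adj v x) (hy : G.Adj v y)
    (hxy : x ≠ y) (hu : u ≠ v) (hvu : ¬ G.Adj v u) (hux : G.Adj u x) (huy : G.Adj u y) :
    G.Adj x y := by
  by_contra hxy'
  -- Otherwise `v`, `x`, `u`, `y` would be a hole of length `4`.
  refine W.four v [x, u, y] ⟨⟨hux.symm, ?_, huy, by simp, trivial⟩, by simp, ?_⟩ rfl
  · simp [hxy, hxy']
  · simp [hx, hy, hx.ne, hy.ne, hu.symm, hvu, hux.ne', huy.ne']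

/-- The path `R` lies on two chordless cycles: one returns through the centre, the other along the
arc, whose inner vertices have no neighbours on `R`. When their odd weights are added, `R` and its
connections to the hole cancel. What remains is the arc and its two outer spokes, of weight `m` by
`Wheel.pathWeight_holeArc`. -/
theorem Wheel.even_arc (W : Wheel G s v n h) {j : ZMod n} {m : ℕ} (hm : 2 ≤ m) (hmn : m + 2 ≤ n)
    {R : List V} (hR : IndPath G R) (hne : R ≠ []) (hRv : ∀ u ∈ R, u ≠ v ∧ ¬ G.Adj v u)
    (hRx : ∀ u ∈ R, G.Adj u (h (j + m)) ↔ R.head? = some u)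
    (hRy : ∀ u ∈ R, G.Adj u (h j) ↔ R.getLast? = some u)
    (hRi : ∀ u ∈ R, ∀ t, 0 < t → t < m → ¬ G.Adj u (h (j + (t : ℕ)))) : (m : ZMod 2) = 0 := by
  obtain ⟨r, hr⟩ : ∃ r, R.head? = some r := by
    cases R with
    | nil => simp at hne
    | cons a l => exact ⟨a, rfl⟩
  obtain ⟨t, ht⟩ : ∃ t, R.getLast? = some t := ⟨R.getLast hne, List.getLast?_eq_getLast_of_ne_nil hne⟩
  have hnot : ∀ a : ℕ, 0 < a → a < n → j ≠ j + a := by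
    intro a ha han hj
    have : (a : ZMod n) = 0 := by linear_combination -hj
    have := ZMod.natCast_eq_zero_of_lt this han
    omega
  obtain ⟨m, rfl⟩ : ∃ m', m = m' + 1 := ⟨m - 1, by omega⟩
  have hjm : j + 1 + (m : ZMod n) = j + ((m + 1 : ℕ) : ZMod n) := by push_cast; ring
  have hfar : ¬ G.Adj (h (j + ((m + 1 : ℕ) : ZMod n))) (h j) := by
    rw [W.adj]
    rintro (h1 | h1)
    · have : (m : ZMod n) = 0 := by push_cast at h1; linear_combination h1
      have := ZMod.natCast_eq_zero_of_lt this (by omega)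
      omega
    · exact hnot (m + 2) (by omega) (by omega) (by push_cast at h1 ⊢; linear_combination h1)
  have h1 := W.odd.path (W.adj_center _) (W.adj_center j)
    (fun hh => hnot (m + 1) (by omega) (by omega) (W.inj hh).symm) hfar hR hr ht hRv hRx hRy
  have h2 := W.pathWeight_holeArc j (m + 1)
  have hRH : ∀ u ∈ R, ∀ i, u ≠ h i := fun u hu i hh => (hRv u hu).2 (hh ▸ W.adj_center i)
  have hclose : Closes G (h j) (holeArc h (j + 1) m ++ R) := by
    refine ⟨(W.indPath_holeArc _ _ (by omega)).append hR ?_, ?_, ?_⟩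
    · intro x hx y hy
      obtain ⟨a, ha, rfl⟩ := mem_holeArc.1 hx
      refine ⟨fun hh => hRH y hy _ hh.symm, ?_⟩
      rw [holeArc_getLast, Option.some.injEq, W.inj.eq_iff, hjm]
      by_cases ham : a = m
      · subst ham
        rw [hjm, G.adj_comm, hRx y hy]; simp
      · have e : j + 1 + (a : ZMod n) = j + ((a + 1 : ℕ) : ZMod n) := by push_cast; ring
        refine iff_of_false (fun hh => hRi y hy (a + 1) (by omega) (by omega) ?_) ?_
        · rw [← e]; exact hh.symm
        · rintro ⟨hh, -⟩
          obtain ⟨d, rfl⟩ : ∃ d, m = a + d := ⟨m - a, by omega⟩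
          have : (d : ZMod n) = 0 := by push_cast at hh; linear_combination hh
          have := ZMod.natCast_eq_zero_of_lt this (by omega)
          omega
    · rw [List.length_append, holeArc_length]; omega
    · intro x hx
      rw [List.head?_append_of_ne_nil _ (holeArc_ne_nil _ _),
        List.getLast?_append_of_ne_nil _ hne, holeArc_head]
      rcases List.mem_append.1 hx with hx | hx
      · obtain ⟨a, ha, rfl⟩ := mem_holeArc.1 hx
        have e : j + 1 + (a : ZMod n) = j + ((a + 1 : ℕ) : ZMod n) := by push_cast; ring
        refine ⟨fun hh => hnot (a + 1) (by omega) (by omega) ?_, ?_⟩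
        · rw [← e]; exact W.inj hh
        · rw [W.adj, Option.some.injEq, W.inj.eq_iff]
          constructor
          · rintro (hh | hh)
            · exact absurd hh fun hh => hnot (a + 2) (by omega) (by omega)
                (by push_cast; linear_combination hh)
            · exact Or.inl hh.symm
          · rintro (hh | hh)
            · exact Or.inr hh.symm
            · exact absurd (List.mem_of_getLast? hh) fun hh => hRH _ hh _ rfl
      · refine ⟨(hRH x hx _).symm, ?_⟩
        rw [G.adj_comm, hRy x hx]
        refine ⟨Or.inr, fun hh => hh.resolve_left fun hh => ?_⟩
        exact hRH x hx _ (Option.some.inj hh).symm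
  have h3 := W.odd.2 _ _ (h (j + 1)) t hclose
    (by rw [List.head?_append_of_ne_nil _ (holeArc_ne_nil _ _), holeArc_head])
    (by rw [List.getLast?_append_of_ne_nil _ hne, ht])
  rw [pathWeight_append s (holeArc_getLast _ _) hr, hjm] at h3
  have h4 : pathWeight s (holeArc h j (m + 1)) =
      s (h j) (h (j + 1)) + pathWeight s (holeArc h (j + 1) m) := by
    cases m <;> rfl
  rw [h4] at h2
  linear_combination h1 - h2 + h3 - CharTwo.add_self_eq_zero (pathWeight s R) -
    CharTwo.add_self_eq_zero (s (h (j + ((m + 1 : ℕ) : ZMod n))) r) -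
    CharTwo.add_self_eq_zero (s (h j) t) + CharTwo.add_self_eq_zero (1 : ZMod 2)

end Wheels

/-! ### Connected sets attached to a hole in a neighbourhood. -/

section WheelComponents

variable {V : Type*} {G : SimpleGraph V} {s : V → V → ZMod 2} {v : V} {n : ℕ} {h : ZMod n → V}

/-- The vertex `x` has a neighbour in `C`. -/
def Attached (G : SimpleGraph V) (C : Finset V) (x : V) : Prop := ∃ u ∈ C, G.Adj u x

theorem Attached.mono {C D : Finset V} (hCD : C ⊆ D) {x : V} (hx : Attached G C x) :
    Attached G D x := by
  obtain ⟨u, hu, hux⟩ := hx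
  exact ⟨u, hCD hu, hux⟩

open Classical in
/-- The edges of the hole `h` both ends of which have neighbours in `C`. -/
noncomputable def attachedEdges [NeZero n] (G : SimpleGraph V) (h : ZMod n → V) (C : Finset V) :
    Finset (ZMod n) :=
  Finset.univ.filter fun i => Attached G C (h i) ∧ Attached G C (h (i + 1))

theorem mem_attachedEdges [NeZero n] {C : Finset V} {i : ZMod n} :
    i ∈ attachedEdges G h C ↔ Attached G C (h i) ∧ Attached G C (h (i + 1)) := by
  simp [attachedEdges]

theorem attachedEdges_mono [NeZero n] {C D : Finset V} (hCD : C ⊆ D) :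
    attachedEdges G h C ⊆ attachedEdges G h D := by
  intro i hi
  rw [mem_attachedEdges] at hi ⊢
  exact ⟨hi.1.mono hCD, hi.2.mono hCD⟩

/-- A gap whose ends are nonadjacent is closed by a chordless path through `C`, and `Wheel.even_arc`
applies. The only other gap has `n - 1` edges, and `n` is odd. -/
theorem Wheel.even_gap (W : Wheel G s v n h) {C : Finset V} (hC : Conn G C)
    (hCv : ∀ u ∈ C, u ≠ v ∧ ¬ G.Adj v u) {j : ZMod n} {m : ℕ} (hm : 2 ≤ m) (hmn : m < n)
    (hj : Attached G C (h j)) (hjm : Attached G C (h (j + m)))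
    (hi : ∀ t : ℕ, 0 < t → t < m → ¬ Attached G C (h (j + t))) : (m : ZMod 2) = 0 := by
  by_cases hmn' : m + 2 ≤ n
  · obtain ⟨R, hR, hne, hR'⟩ := hC.exists_indPath hjm hj
    exact W.even_arc hm hmn' hR hne (fun u hu => hCv u (hR' u hu).1) (fun u hu => (hR' u hu).2.1)
      (fun u hu => (hR' u hu).2.2) fun u hu t h1 h2 h3 => hi t h1 h2 ⟨u, (hR' u hu).1, h3⟩
  · obtain rfl : n = m + 1 := by omega
    have := W.natCast_eq_one
    push_cast at this
    simpa using this

/-- If at least two vertices of the hole have neighbours in the connected set `C`, then the number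
of edges between such vertices is odd. -/
theorem Wheel.odd_card_attachedEdges [NeZero n] (W : Wheel G s v n h) {C : Finset V}
    (hC : Conn G C) (hCv : ∀ u ∈ C, u ≠ v ∧ ¬ G.Adj v u) {a b : ZMod n} (hab : a ≠ b)
    (ha : Attached G C (h a)) (hb : Attached G C (h b)) : Odd (attachedEdges G h C).card := by
  classical
  set p : ℕ → Prop := fun t => Attached G C (h (a + t)) with hp
  have hn := W.four_le
  have hp0 : p 0 := by simpa [hp] using ha
  obtain ⟨t₀, ht₀, ht₀n, hpt₀⟩ : ∃ t₀ : ℕ, 0 < t₀ ∧ t₀ < n ∧ p t₀ := by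
    refine ⟨(b - a).val, ?_, ZMod.val_lt _, by simpa [hp] using hb⟩
    rw [Nat.pos_iff_ne_zero]
    intro h0
    rw [ZMod.val_eq_zero] at h0
    exact hab (sub_eq_zero.1 h0).symm
  -- Walk around the hole from `a`. Up to an attached vertex at distance `m`, the steps are single
  -- attached edges and gaps of even length, so the number of attached edges has the parity of `m`.
  -- A full turn gives the parity of `n`.
  have key : ∀ m ≤ n, p m →
      (((Finset.range m).filter fun t => p t ∧ p (t + 1)).card : ZMod 2) = m := by
    intro m
    induction m using Nat.strong_induction_on with
    | _ m ih =>
      intro hmn hpm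
      rcases Nat.eq_zero_or_pos m with rfl | hm
      · simp
      obtain ⟨j, hjm, hpj, hlast⟩ : ∃ j < m, p j ∧ ∀ t, j < t → t < m → ¬ p t := by
        obtain ⟨j, hj, hmax⟩ := Finset.exists_max_image ((Finset.range m).filter p) id
          ⟨0, by simp [hm, hp0]⟩
        simp only [Finset.mem_filter, Finset.mem_range] at hj hmax
        exact ⟨j, hj.1, hj.2, fun t h1 h2 h3 => by have := hmax t ⟨h2, h3⟩; simp at this; omega⟩
      have hj := ih j hjm (by omega) hpj
      by_cases hm1 : m = j + 1
      · subst hm1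
        rw [Finset.range_add_one, Finset.filter_insert, if_pos ⟨hpj, hpm⟩,
          Finset.card_insert_of_notMem (by simp)]
        push_cast
        rw [hj]
      · have h1 : ((Finset.range m).filter fun t => p t ∧ p (t + 1)) =
            ((Finset.range j).filter fun t => p t ∧ p (t + 1)) := by
          ext t
          simp only [Finset.mem_filter, Finset.mem_range]
          constructor
          · rintro ⟨h1, h2, h3⟩
            refine ⟨?_, h2, h3⟩
            by_contra h4
            by_cases h5 : t = j
            · subst h5
              exact hlast (t + 1) (by omega) (by omega) h3
            · exact hlast t (by omega) h1 h2
          · rintro ⟨h1, h2, h3⟩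
            exact ⟨by omega, h2, h3⟩
        rw [h1, hj]
        obtain ⟨d, rfl⟩ : ∃ d, m = j + d := ⟨m - j, by omega⟩
        have hd : (d : ZMod 2) = 0 := by
          refine W.even_gap hC hCv (j := a + j) (by omega) ?_ hpj ?_ ?_
          -- A gap of `n` edges would mean that `h a` is the only attached vertex, which `t₀`
          -- excludes.
          · by_contra hdn
            obtain rfl : j = 0 := by omega
            exact hlast t₀ ht₀ (by omega) hpt₀
          · have := hpm
            simp only [hp] at this
            push_cast at this
            rwa [← add_assoc] at this
          · intro t h2 h3 h4
            refine hlast (j + t) (by omega) (by omega) ?_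
            simp only [hp]
            push_cast
            rwa [← add_assoc]
        push_cast
        rw [hd, add_zero]
  have hfin := key n le_rfl (by simpa [hp] using ha)
  rw [W.natCast_eq_one, ZMod.natCast_eq_one_iff_odd] at hfin
  convert hfin using 1
  symm
  refine Finset.card_bij (fun t _ => a + t) ?_ ?_ ?_
  · intro t ht
    simp only [Finset.mem_filter, hp] at ht
    rw [mem_attachedEdges]
    refine ⟨ht.2.1, ?_⟩
    have := ht.2.2
    push_cast at this
    rwa [← add_assoc] at this
  · intro t ht t' ht' htt
    simp only [Finset.mem_filter, Finset.mem_range] at ht ht'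
    have := add_left_cancel htt
    rw [ZMod.natCast_eq_natCast_iff', Nat.mod_eq_of_lt ht.1, Nat.mod_eq_of_lt ht'.1] at this
    exact this
  · intro i hi
    rw [mem_attachedEdges] at hi
    refine ⟨(i - a).val, ?_, by simp⟩
    simp only [Finset.mem_filter, Finset.mem_range, ZMod.val_lt, hp, true_and]
    refine ⟨by simpa using hi.1, ?_⟩
    have := hi.2
    push_cast
    rw [ZMod.natCast_val, ZMod.cast_id', id, ← add_assoc]
    simpa using this

/-- If `u` is the only vertex of `C` with neighbours among the adjacent vertices `p` and `q`, and
adjacent to both, then the other neighbour of `q` on the hole has no neighbour in `C`. -/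
theorem Wheel.not_attached (W : Wheel G s v n h) {C : Finset V} (hC : Conn G C)
    (hCv : ∀ u ∈ C, u ≠ v ∧ ¬ G.Adj v u) {p q a u : V} (hvp : G.Adj v p) (hvq : G.Adj v q)
    (hva : G.Adj v a) (hpq : G.Adj p q) (hqa : G.Adj q a) (hpa : p ≠ a) (hpa' : ¬ G.Adj p a)
    (hu : u ∈ C) (hup : G.Adj u p) (huq : G.Adj u q) (hup' : ∀ w ∈ C, G.Adj w p → w = u)
    (huq' : ∀ w ∈ C, G.Adj w q → w = u) : ¬ Attached G C a := by
  intro ha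
  have hua : ¬ G.Adj u a := fun hua =>
    hpa' (W.adj_of_common hvp hva hpa (hCv u hu).1 (hCv u hu).2 hup hua)
  obtain ⟨R, hR, hne, hR'⟩ := hC.exists_indPath (A := fun x => G.Adj x p)
    (B := fun x => G.Adj x a) ⟨u, hu, hup⟩ ha
  obtain ⟨t, ht⟩ : ∃ t, R.getLast? = some t :=
    ⟨R.getLast hne, List.getLast?_eq_getLast_of_ne_nil hne⟩
  have hr : R.head? = some u := by
    cases R with
    | nil => simp at hne
    | cons a l =>
      have := (hR' a (by simp)).2.1.2 rfl
      rw [hup' a (hR' a (by simp)).1 this]; rfl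
  have hRC : ∀ x ∈ R, x ∈ C := fun x hx => (hR' x hx).1
  have hRq : ∀ x ∈ R, (G.Adj x q ↔ R.head? = some x) := by
    intro x hx
    rw [hr, Option.some.injEq]
    exact ⟨fun hh => (huq' x (hRC x hx) hh).symm, fun hh => hh ▸ huq⟩
  have h1 := W.odd.path hvp hva hpa hpa' hR hr ht (fun x hx => hCv x (hRC x hx))
    (fun x hx => (hR' x hx).2.1) (fun x hx => (hR' x hx).2.2)
  have hclose : Closes G q (R ++ [a]) := by
    refine ⟨IndPath.append (l₂ := [a]) hR (by trivial) ?_, ?_, ?_⟩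
    · intro x hx y hy
      simp at hy
      subst hy
      refine ⟨?_, by simp [(hR' x hx).2.2]⟩
      rintro rfl
      exact (hCv x (hRC x hx)).2 hva
    · cases R with
      | nil => simp at hne
      | cons b l => simp
    · intro x hx
      rw [List.head?_append_of_ne_nil _ hne, List.getLast?_concat]
      rcases List.mem_append.1 hx with hx | hx
      · refine ⟨?_, ?_⟩
        · rintro rfl
          exact (hCv q (hRC q hx)).2 hvq
        · rw [G.adj_comm, hRq x hx]
          refine ⟨Or.inl, fun hh => hh.resolve_right fun hh => ?_⟩
          simp at hh
          subst hh
          exact (hCv a (hRC a hx)).2 hva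
      · simp at hx
        subst hx
        simp [hqa, hqa.ne]
  have h2 := W.odd.2 _ _ u a hclose (by rw [List.head?_append_of_ne_nil _ hne, hr])
    (by rw [List.getLast?_concat])
  rw [pathWeight_append s ht rfl, W.odd.1 t a] at h2
  simp only [pathWeight] at h2
  have h3 := W.odd.triangle hup hpq huq
  have h4 := W.odd.triangle hvp hpq hvq
  have h5 := W.odd.triangle hvq hqa hva
  rw [W.odd.1 u p, W.odd.1 u q] at h3
  have e : ∀ x : ZMod 2, x + x = 0 := CharTwo.add_self_eq_zero
  -- Five odd cycles: the holes `v p R a` and `q R a` and the triangles `u p q`, `v p q`, `v q a`.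
  -- Every edge lies on exactly two of them, so the sum of the five weights is both `1` and `0`.
  have : (1 : ZMod 2) = 0 := by
    linear_combination -h1 - h2 - h3 - h4 - h5 + e (pathWeight s R) + e (s p u) + e (s a t) +
      e (s v p) + e (s v a) + e (s q u) + e (s q a) + e (s p q) + e (s v q) - 2 * e 1
  exact one_ne_zero this

/-- The neighbours on the hole of a vertex outside the closed neighbourhood of the centre are
consecutive. -/
theorem Wheel.consecutive (W : Wheel G s v n h) {u : V} (hu : u ≠ v ∧ ¬ G.Adj v u) {i j : ZMod n}
    (hi : G.Adj u (h i)) (hj : G.Adj u (h j)) : i = j ∨ i = j + 1 ∨ j = i + 1 := by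
  by_cases hij : i = j
  · exact Or.inl hij
  · exact Or.inr ((W.adj i j).1 (W.adj_of_common (W.adj_center i) (W.adj_center j)
      (fun hh => hij (W.inj hh)) hu.1 hu.2 hi hj))

/-- The length of the hole is odd and at least `4`, hence at least `5`. So indices that differ by at
most `4` can be told apart. -/
theorem Wheel.natCast_ne_zero (W : Wheel G s v n h) {t : ℕ} (ht : 0 < t) (htn : t ≤ 4) :
    (t : ZMod n) ≠ 0 := by
  intro h0
  have h1 := W.natCast_eq_one
  have hn := W.four_le
  have : n ≠ 4 := by rintro rfl; revert h1; decide
  have := ZMod.natCast_eq_zero_of_lt h0 (by omega)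
  omega

/-- How a non-cut vertex `u` of a minimal connected set is attached to the hole. -/
theorem Wheel.exists_private [DecidableEq V] [NeZero n] (W : Wheel G s v n h) {C : Finset V}
    (hC : Conn G C) (hCv : ∀ u ∈ C, u ≠ v ∧ ¬ G.Adj v u)
    (hE : 3 ≤ (attachedEdges G h C).card) {u : V} (hu : u ∈ C)
    (hE' : (attachedEdges G h (C.erase u)).card ≤ 1) :
    ∃ i, G.Adj u (h i) ∧ ¬ Attached G (C.erase u) (h i) ∧ i ∈ attachedEdges G h C ∧
      i - 1 ∈ attachedEdges G h C ∧ (attachedEdges G h C).card = 3 ∧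
      ∀ j ≠ i, Attached G C (h j) → Attached G (C.erase u) (h j) := by
  have h1 : ((1 : ℕ) : ZMod n) ≠ 0 := W.natCast_ne_zero (by omega) (by omega)
  have h2 : ((2 : ℕ) : ZMod n) ≠ 0 := W.natCast_ne_zero (by omega) (by omega)
  have h3 : ((3 : ℕ) : ZMod n) ≠ 0 := W.natCast_ne_zero (by omega) (by omega)
  push_cast at h1 h2 h3
  have hsub : attachedEdges G h (C.erase u) ⊆ attachedEdges G h C :=
    attachedEdges_mono (Finset.erase_subset _ _)
  have priv : ∀ i, Attached G C (h i) → ¬ Attached G (C.erase u) (h i) →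
      G.Adj u (h i) ∧ ∀ w ∈ C, G.Adj w (h i) → w = u := by
    rintro i ⟨w, hw, hwi⟩ hn
    have h4 : ∀ w ∈ C, G.Adj w (h i) → w = u := by
      intro w hw hwi
      by_contra hne
      exact hn ⟨w, Finset.mem_erase.2 ⟨hne, hw⟩, hwi⟩
    have := h4 w hw hwi
    subst this
    exact ⟨hwi, h4⟩
  -- If `h i` and `h (i + 1)` both lost their attachment with `u`, then by `Wheel.not_attached` the
  -- vertices on either side of them were not attached at all. So only the edge `i` could have been
  -- lost, while at least two edges are.
  have pair : ∀ i, Attached G C (h i) → ¬ Attached G (C.erase u) (h i) →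
      Attached G C (h (i + 1)) → ¬ Attached G (C.erase u) (h (i + 1)) → False := by
    intro i hi hni hi' hni'
    obtain ⟨ha, hb⟩ := priv i hi hni
    obtain ⟨hc, hd⟩ := priv _ hi' hni'
    have hadj : G.Adj (h i) (h (i + 1)) := (W.adj _ _).2 (Or.inr rfl)
    have ne1 : i ≠ i + 1 + 1 := fun hh => h2 (by linear_combination -hh)
    have ne2 : i + 1 ≠ i - 1 := fun hh => h2 (by linear_combination hh)
    have x1 : ¬ Attached G C (h (i + 1 + 1)) :=
      W.not_attached hC hCv (W.adj_center i) (W.adj_center _) (W.adj_center _) hadj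
        ((W.adj _ _).2 (Or.inr rfl)) (fun hh => ne1 (W.inj hh))
        (by rw [W.adj]
            rintro (hh | hh)
            · exact h3 (by linear_combination -hh)
            · exact h1 (by linear_combination hh)) hu ha hc hb hd
    have x2 : ¬ Attached G C (h (i - 1)) :=
      W.not_attached hC hCv (W.adj_center (i + 1)) (W.adj_center i) (W.adj_center _) hadj.symm
        ((W.adj _ _).2 (Or.inl (by ring))) (fun hh => ne2 (W.inj hh))
        (by rw [W.adj]
            rintro (hh | hh)
            · exact h1 (by linear_combination hh)
            · exact h3 (by linear_combination -hh)) hu hc ha hd hb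
    have hlost : attachedEdges G h C ⊆ insert i (attachedEdges G h (C.erase u)) := by
      intro j hj
      rw [Finset.mem_insert, mem_attachedEdges]
      rw [mem_attachedEdges] at hj
      by_contra hcon
      push Not at hcon
      obtain ⟨hji, hcon⟩ := hcon
      by_cases hja : Attached G (C.erase u) (h j)
      · obtain ⟨hk, -⟩ := priv _ hj.2 (hcon hja)
        rcases W.consecutive (hCv u hu) ha hk with hh | hh | hh
        · subst hh
          apply x2
          have : j + 1 - 1 = j := by ring
          rw [this]; exact hj.1
        · rcases W.consecutive (hCv u hu) hc hk with h' | h' | h'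
          · exact hji (add_right_cancel h').symm
          · exact h1 (by linear_combination h' - hh)
          · exact h3 (by linear_combination -h' - hh)
        · exact hji (add_right_cancel hh)
      · obtain ⟨hk, -⟩ := priv _ hj.1 hja
        rcases W.consecutive (hCv u hu) ha hk with hh | hh | hh
        · exact hji hh.symm
        · rcases W.consecutive (hCv u hu) hc hk with h' | h' | h'
          · exact h2 (by linear_combination h' - hh)
          · exact h1 (by linear_combination h' - hh)
          · exact h3 (by linear_combination -h' - hh)
        · subst hh
          exact x1 hj.2
    have := (Finset.card_le_card hlost).trans (Finset.card_insert_le _ _)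
    omega
  obtain ⟨j, hj, hj'⟩ : ∃ j ∈ attachedEdges G h C, j ∉ attachedEdges G h (C.erase u) := by
    by_contra hcon
    push Not at hcon
    have := Finset.card_le_card hcon
    omega
  obtain ⟨i, hi, hni⟩ : ∃ i, Attached G C (h i) ∧ ¬ Attached G (C.erase u) (h i) := by
    rw [mem_attachedEdges] at hj hj'
    by_cases hja : Attached G (C.erase u) (h j)
    · exact ⟨j + 1, hj.2, fun hh => hj' ⟨hja, hh⟩⟩
    · exact ⟨j, hj.1, hja⟩
  have huniq : ∀ j ≠ i, Attached G C (h j) → Attached G (C.erase u) (h j) := by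
    intro k hk hka
    by_contra hkn
    rcases W.consecutive (hCv u hu) (priv k hka hkn).1 (priv i hi hni).1 with hh | hh | hh
    · exact hk hh
    · subst hh; exact pair i hi hni hka hkn
    · subst hh; exact pair k hka hkn hi hni
  -- Only edges ending at `h i` are lost, so exactly two are. This forces the number of attached
  -- edges to drop from `3` to `1`.
  have hlost : attachedEdges G h C \ attachedEdges G h (C.erase u) ⊆ {i - 1, i} := by
    intro k hk
    rw [Finset.mem_sdiff, mem_attachedEdges, mem_attachedEdges] at hk
    simp only [Finset.mem_insert, Finset.mem_singleton]
    by_contra hcon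
    push Not at hcon
    refine hk.2 ⟨huniq k hcon.2 hk.1.1, huniq _ (fun hh => hcon.1 ?_) hk.1.2⟩
    rw [← hh]; ring
  have hcard := Finset.card_sdiff_add_card_eq_card hsub
  have h4 := Finset.card_le_card hlost
  have h5 : ({i - 1, i} : Finset (ZMod n)).card ≤ 2 := Finset.card_le_two
  have h6 := Finset.eq_of_subset_of_card_le hlost (by omega)
  have hin : ∀ k ∈ ({i - 1, i} : Finset (ZMod n)), k ∈ attachedEdges G h C := by
    intro k hk
    rw [← h6] at hk
    exact (Finset.mem_sdiff.1 hk).1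
  exact ⟨i, (priv i hi hni).1, hni, hin i (by simp), hin _ (by simp), by omega, huniq⟩

/-- Suppose all vertices of the hole are attached to `C`, and let `D ⊆ C` be a smallest connected
set with at least two attached edges. Their number is odd, so at least `3`, and removing any non-cut
vertex leaves at most one. By `Wheel.exists_private` there are exactly three attached edges, and
every non-cut vertex has a private neighbour on the hole at which two of them meet. The private
neighbours of two non-cut vertices `u`, `u'` are therefore consecutive, which leaves no room for a
third non-cut vertex. Hence `D` without `u` and `u'` is still connected (`Conn.erase_erase`). It is
attached to the outermost ends of the three edges, so it has an attached edge by parity, yet each of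
the three edges ends at a private neighbour of `u` or `u'`. -/
theorem Wheel.exists_not_attached (W : Wheel G s v n h) {C : Finset V} (hC : Conn G C)
    (hCv : ∀ u ∈ C, u ≠ v ∧ ¬ G.Adj v u) : ∃ i, ¬ Attached G C (h i) := by
  classical
  by_contra hall
  push Not at hall
  have : NeZero n := ⟨by have := W.four_le; omega⟩
  have h1 : ((1 : ℕ) : ZMod n) ≠ 0 := W.natCast_ne_zero (by omega) (by omega)
  have h2 : ((2 : ℕ) : ZMod n) ≠ 0 := W.natCast_ne_zero (by omega) (by omega)
  have h3 : ((3 : ℕ) : ZMod n) ≠ 0 := W.natCast_ne_zero (by omega) (by omega)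
  push_cast at h1 h2 h3
  have hfull : attachedEdges G h C = Finset.univ := by
    ext i; simp [mem_attachedEdges, hall]
  obtain ⟨D, hD, hmin⟩ := Finset.exists_min_image
    (C.powerset.filter fun X => Conn G X ∧ 2 ≤ (attachedEdges G h X).card) Finset.card
    ⟨C, by
      simp only [Finset.mem_filter, Finset.mem_powerset, Finset.Subset.refl, true_and]
      refine ⟨hC, ?_⟩
      rw [hfull, Finset.card_univ, ZMod.card]
      have := W.four_le
      omega⟩
  simp only [Finset.mem_filter, Finset.mem_powerset] at hD hmin
  obtain ⟨hDC, hDconn, hDE⟩ := hD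
  have hDv : ∀ u ∈ D, u ≠ v ∧ ¬ G.Adj v u := fun u hu => hCv u (hDC hu)
  have hsmall : ∀ X ⊂ D, Conn G X → (attachedEdges G h X).card ≤ 1 := by
    intro X hX hXc
    by_contra hcon
    have := hmin X ⟨hX.1.trans hDC, hXc, by omega⟩
    have := Finset.card_lt_card hX
    omega
  have hDE3 : 3 ≤ (attachedEdges G h D).card := by
    obtain ⟨a, ha⟩ : (attachedEdges G h D).Nonempty := Finset.card_pos.1 (by omega)
    rw [mem_attachedEdges] at ha
    have := W.odd_card_attachedEdges hDconn hDv (a := a) (b := a + 1)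
      (fun hh => h1 (by linear_combination -hh)) ha.1 ha.2
    obtain ⟨k, hk⟩ := this
    omega
  have hpriv : ∀ u ∈ D, Conn G (D.erase u) → _ := fun u hu hc =>
    W.exists_private hDconn hDv hDE3 hu (hsmall _ (Finset.erase_ssubset hu) hc)
  -- The neighbours on the hole of a single vertex are pairwise equal or consecutive, so they span
  -- at most one edge.
  have hne : ∀ u ∈ D, D ≠ {u} := by
    rintro u hu rfl
    obtain ⟨k, hk, l, hl, hkl⟩ := Finset.one_lt_card.1 (show 1 < (attachedEdges G h {u}).card by omega)
    have hadj : ∀ i, Attached G {u} (h i) → G.Adj u (h i) := by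
      rintro i ⟨w, hw, hwi⟩
      rw [Finset.mem_singleton] at hw
      rwa [hw] at hwi
    rw [mem_attachedEdges] at hk hl
    have a1 := W.consecutive (hDv u hu) (hadj _ hk.1) (hadj _ hl.2)
    have a2 := W.consecutive (hDv u hu) (hadj _ hk.2) (hadj _ hl.1)
    rcases a1 with a1 | a1 | a1
    · rcases a2 with a2 | a2 | a2
      · exact h2 (by linear_combination a2 - a1)
      · exact h1 (by linear_combination a2 - a1)
      · exact h3 (by linear_combination -a2 - a1)
    · rcases a2 with a2 | a2 | a2
      · exact h3 (by linear_combination a2 - a1)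
      · exact h2 (by linear_combination a2 - a1)
      · have : ((4 : ℕ) : ZMod n) ≠ 0 := W.natCast_ne_zero (by omega) (by omega)
        push_cast at this
        exact this (by linear_combination -a2 - a1)
    · exact hkl (add_right_cancel a1).symm
  -- two non-cut vertices with consecutive private neighbours
  have hseq : ∀ u ∈ D, ∀ u' ∈ D, u ≠ u' → ∀ i i', G.Adj u (h i) →
      ¬ Attached G (D.erase u) (h i) → i ∈ attachedEdges G h D → i - 1 ∈ attachedEdges G h D →
      (attachedEdges G h D).card = 3 → G.Adj u' (h i') → ¬ Attached G (D.erase u') (h i') →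
      i' ∈ attachedEdges G h D → i' - 1 ∈ attachedEdges G h D →
      i ≠ i' ∧ (i' = i + 1 ∨ i = i' + 1) := by
    intro u hu u' hu' huu i i' hi hni m1 m2 hcard hi' hni' m3 m4
    have hii : i ≠ i' := by
      rintro rfl
      exact hni ⟨u', Finset.mem_erase.2 ⟨huu.symm, hu'⟩, hi'⟩
    refine ⟨hii, ?_⟩
    by_contra hcon
    push Not at hcon
    -- If the private neighbours were not consecutive, these four attached edges would be distinct,
    -- but there are only three.
    have hsub : ({i, i - 1, i', i' - 1} : Finset (ZMod n)) ⊆ attachedEdges G h D := by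
      intro k hk
      simp only [Finset.mem_insert, Finset.mem_singleton] at hk
      rcases hk with rfl | rfl | rfl | rfl <;> assumption
    have := Finset.card_le_card hsub
    rw [Finset.card_insert_of_notMem, Finset.card_insert_of_notMem,
      Finset.card_insert_of_notMem, Finset.card_singleton] at this
    · omega
    · simp only [Finset.mem_singleton]
      exact fun hh => h1 (by linear_combination hh)
    · simp only [Finset.mem_insert, Finset.mem_singleton]
      rintro (hh | hh)
      · exact hcon.2 (by rw [← hh]; ring)
      · exact hii (by linear_combination hh)
    · simp only [Finset.mem_insert, Finset.mem_singleton]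
      rintro (hh | hh | hh)
      · exact h1 (by linear_combination hh)
      · exact hii hh
      · exact hcon.1 (by rw [hh]; ring)
  obtain ⟨x, hx⟩ := hDconn.1
  obtain ⟨u, hu, -, huc⟩ := hDconn.exists_erase (Conn.singleton x)
    ((Finset.singleton_subset_iff.2 hx).ssubset_of_ne (hne x hx).symm)
  obtain ⟨u', hu', huu', huc'⟩ := hDconn.exists_erase (Conn.singleton u)
    ((Finset.singleton_subset_iff.2 hu).ssubset_of_ne (hne u hu).symm)
  rw [Finset.mem_singleton] at huu'
  have final : ∀ u ∈ D, ∀ u' ∈ D, u' ≠ u → Conn G (D.erase u) → Conn G (D.erase u') →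
      ∀ i, G.Adj u (h i) → ¬ Attached G (D.erase u) (h i) → i ∈ attachedEdges G h D →
      i - 1 ∈ attachedEdges G h D → (attachedEdges G h D).card = 3 →
      (∀ j ≠ i, Attached G D (h j) → Attached G (D.erase u) (h j)) →
      G.Adj u' (h (i + 1)) → ¬ Attached G (D.erase u') (h (i + 1)) →
      i + 1 ∈ attachedEdges G h D →
      (∀ j ≠ i + 1, Attached G D (h j) → Attached G (D.erase u') (h j)) → False := by
    intro u hu u' hu' huu' huc huc' i p1 p2 p3 p4 p5 p6 q1 q2 q3 q6
    -- A proper connected subset containing `u` and `u'` would avoid some further non-cut vertex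
    -- `w`. Its private neighbour would have to be consecutive both to `h i` and to `h (i + 1)`.
    have hmin' : ∀ X ⊆ D, Conn G X → u ∈ X → u' ∈ X → X = D := by
      intro X hX hXc hux hux'
      by_contra hXD
      obtain ⟨w, hw, hwX, hwc⟩ := hDconn.exists_erase hXc (hX.ssubset_of_ne hXD)
      have hwu : u ≠ w := by rintro rfl; exact hwX hux
      have hwu' : u' ≠ w := by rintro rfl; exact hwX hux'
      obtain ⟨j, r1, r2, r3, r4, -, -⟩ := hpriv w hw hwc
      obtain ⟨-, c1⟩ := hseq u hu w hw hwu i j p1 p2 p3 p4 p5 r1 r2 r3 r4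
      obtain ⟨c3, c2⟩ := hseq u' hu' w hw hwu' (i + 1) j q1 q2 q3 (by simpa using p3) p5 r1 r2 r3 r4
      rcases c1 with c1 | c1
      · exact c3 c1.symm
      · rcases c2 with c2 | c2
        · exact h3 (by linear_combination -c1 - c2)
        · exact h1 (by linear_combination c2 - c1)
    have hatt : Attached G D (h (i - 1)) := (mem_attachedEdges.1 p4).1
    have hatt' : Attached G D (h (i + 1 + 1)) := (mem_attachedEdges.1 q3).2
    obtain ⟨w, hw, hwi⟩ := p6 (i - 1) (fun hh => h1 (by linear_combination -hh)) hatt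
    obtain ⟨w', hw', hwi'⟩ := q6 (i + 1 + 1) (fun hh => h1 (by linear_combination hh)) hatt'
    rw [Finset.mem_erase] at hw hw'
    have hwu' : w ≠ u' := by
      rintro rfl
      rcases W.consecutive (hDv w hw.2) hwi q1 with hh | hh | hh
      · exact h2 (by linear_combination -hh)
      · exact h3 (by linear_combination -hh)
      · exact h1 (by linear_combination hh)
    have hwu : w' ≠ u := by
      rintro rfl
      rcases W.consecutive (hDv w' hw'.2) hwi' p1 with hh | hh | hh
      · exact h2 (by linear_combination hh)
      · exact h1 (by linear_combination hh)
      · exact h3 (by linear_combination -hh)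
    have hX := Conn.erase_erase hu hu' huu'.symm huc huc' hmin' hw.2 hw.1 hwu'
    have hsub1 : (D.erase u).erase u' ⊆ D.erase u := Finset.erase_subset _ _
    have hsub2 : (D.erase u).erase u' ⊆ D.erase u' := by
      intro t ht
      simp only [Finset.mem_erase] at ht ⊢
      exact ⟨ht.1, ht.2.2⟩
    -- The remaining set is attached to `h (i - 1)` and `h (i + 2)`, through `w` and `w'`. So it has
    -- an attached edge, which must be one of `i - 1`, `i`, `i + 1`; each of these has an end
    -- private to `u` or to `u'`.
    have hodd := W.odd_card_attachedEdges hX (fun t ht => hDv t (by simp at ht; exact ht.2.2))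
      (a := i - 1) (b := i + 1 + 1) (fun hh => h3 (by linear_combination -hh))
      ⟨w, by simp [hw, hwu'], hwi⟩ ⟨w', by simp [hw', hwu], hwi'⟩
    obtain ⟨k, hk⟩ : (attachedEdges G h ((D.erase u).erase u')).Nonempty :=
      Finset.card_pos.1 hodd.pos
    have hkD : k ∈ attachedEdges G h D := attachedEdges_mono (hsub1.trans (Finset.erase_subset _ _)) hk
    have hE : ({i - 1, i, i + 1} : Finset (ZMod n)) = attachedEdges G h D := by
      apply Finset.eq_of_subset_of_card_le
      · intro k hk
        simp only [Finset.mem_insert, Finset.mem_singleton] at hk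
        rcases hk with rfl | rfl | rfl <;> assumption
      · rw [p5, Finset.card_insert_of_notMem, Finset.card_insert_of_notMem,
          Finset.card_singleton]
        · simp only [Finset.mem_singleton]
          exact fun hh => h1 (by linear_combination -hh)
        · simp only [Finset.mem_insert, Finset.mem_singleton]
          rintro (hh | hh)
          · exact h1 (by linear_combination -hh)
          · exact h2 (by linear_combination -hh)
    rw [← hE] at hkD
    rw [mem_attachedEdges] at hk
    simp only [Finset.mem_insert, Finset.mem_singleton] at hkD
    rcases hkD with rfl | rfl | rfl
    · apply p2
      have := hk.2.mono hsub1
      rwa [sub_add_cancel] at this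
    · exact p2 (hk.1.mono hsub1)
    · exact q2 (hk.1.mono hsub2)
  obtain ⟨i, p1, p2, p3, p4, p5, p6⟩ := hpriv u hu huc
  obtain ⟨i', q1, q2, q3, q4, q5, q6⟩ := hpriv u' hu' huc'
  obtain ⟨-, c | c⟩ := hseq u hu u' hu' (Ne.symm huu') i i' p1 p2 p3 p4 p5 q1 q2 q3 q4
  · subst c
    exact final u hu u' hu' huu' huc huc' i p1 p2 p3 p4 p5 p6 q1 q2 q3 q6
  · subst c
    exact final u' hu' u hu (Ne.symm huu') huc' huc i' q1 q2 q3 q4 q5 q6 p1 p2 p3 p6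

end WheelComponents

/-! ### Lexicographic breadth-first search -/

section LexBFS

variable {V : Type*} {G : SimpleGraph V}

/-- The rule of lexicographic breadth-first search for the vertices of `B`, visited by increasing
`ρ`: at the first vertex `d` where the neighbourhoods of `x` and a later `y` differ, `x` wins. -/
def LexRule (G : SimpleGraph V) (B : Finset V) (ρ : V → ℕ) : Prop :=
  ∀ x ∈ B, ∀ y ∈ B, ρ x < ρ y → ∀ d ∈ B, ρ d < ρ x → G.Adj d y → ¬ G.Adj d x →
    ¬ ∀ e ∈ B, ρ e < ρ d → (G.Adj e x ↔ G.Adj e y)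

/-- `LexRule` only forbids that the later vertex wins at the first difference. Whenever there is
some difference, the earlier vertex therefore wins at the first one, and this is the form in which
the rule is used. -/
theorem LexRule.exists_first {B : Finset V} {ρ : V → ℕ} (h : LexRule G B ρ) {x y d : V}
    (hx : x ∈ B) (hy : y ∈ B) (hxy : ρ x < ρ y) (hd : d ∈ B) (hdx : ρ d < ρ x)
    (hne : ¬ (G.Adj d x ↔ G.Adj d y)) :
    ∃ e ∈ B, ρ e ≤ ρ d ∧ G.Adj e x ∧ ¬ G.Adj e y ∧
      ∀ f ∈ B, ρ f < ρ e → (G.Adj f x ↔ G.Adj f y) := by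
  classical
  obtain ⟨e, he, hmin⟩ := Finset.exists_min_image
    (B.filter fun e => ¬ (G.Adj e x ↔ G.Adj e y)) ρ ⟨d, Finset.mem_filter.2 ⟨hd, hne⟩⟩
  rw [Finset.mem_filter] at he
  have hed := hmin d (Finset.mem_filter.2 ⟨hd, hne⟩)
  have hall : ∀ f ∈ B, ρ f < ρ e → (G.Adj f x ↔ G.Adj f y) := by
    intro f hf hfe
    by_contra hcon
    have := hmin f (Finset.mem_filter.2 ⟨hf, hcon⟩)
    omega
  have := h x hx y hy hxy e he.1 (by omega)
  refine ⟨e, he.1, hed, ?_, ?_, hall⟩ <;> tauto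

/-- The neighbours of the last vertex `z` that do not see all other neighbours of `z` have
neighbours in one connected set of non-neighbours of `z`. -/
theorem LexRule.exists_conn {B : Finset V} {ρ : V → ℕ} (h : LexRule G B ρ)
    (hinj : ∀ x ∈ B, ∀ y ∈ B, ρ x = ρ y → x = y) {z : V} (hz : z ∈ B)
    (hlast : ∀ x ∈ B, x ≠ z → ρ x < ρ z) {p q : V} (hp : p ∈ B) (hq : q ∈ B) (hzp : G.Adj z p)
    (hzq : G.Adj z q) (hpq : p ≠ q) (hpq' : ¬ G.Adj p q) :
    ∃ C ⊆ B, Conn G C ∧ (∀ u ∈ C, u ≠ z ∧ ¬ G.Adj z u) ∧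
      ∀ x ∈ B, G.Adj z x → (∃ c ∈ B, G.Adj z c ∧ c ≠ x ∧ ¬ G.Adj c x) → Attached G C x := by
  classical
  set M := B.filter fun e => e ≠ z ∧ ¬ G.Adj e z with hM
  have hMB : ∀ e, e ∈ M ↔ e ∈ B ∧ e ≠ z ∧ ¬ G.Adj e z := fun e => by simp [hM]
  have hMlt : ∀ e ∈ M, ρ e < ρ z := fun e he => hlast e ((hMB e).1 he).1 ((hMB e).1 he).2.1
  have hneM : ∀ e ∈ B, ρ e < ρ z → ¬ G.Adj e z → e ∈ M := fun e he hez hh =>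
    (hMB e).2 ⟨he, by rintro rfl; omega, hh⟩
  -- If `c` precedes `x`, then `x` misses the neighbour `c` of `z`, so `x` wins against `z` at an
  -- earlier vertex, which is not adjacent to `z`. If `x` precedes `c`, then `c` wins against `z` in
  -- this way at some `d` before `x`. Either `d` sees `x`, or `x` wins against `c` at a still
  -- earlier vertex; this vertex misses `c`, hence also `z`, which agrees with `c` before `d`.
  have step1 : ∀ x ∈ B, G.Adj z x → (∃ c ∈ B, G.Adj z c ∧ c ≠ x ∧ ¬ G.Adj c x) →
      ∃ d ∈ M, G.Adj d x := by
    rintro x hx hzx ⟨c, hc, hzc, hcx, hcx'⟩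
    have hxz := hlast x hx hzx.ne'
    have hcz := hlast c hc hzc.ne'
    rcases lt_trichotomy (ρ c) (ρ x) with hlt | heq | hlt
    · obtain ⟨e, he, hec, h1, h2, -⟩ := h.exists_first hx hz hxz hc hlt
        (fun hh => hcx' (hh.2 hzc.symm))
      exact ⟨e, hneM e he (by omega) h2, h1⟩
    · exact absurd (hinj c hc x hx heq) hcx
    · obtain ⟨d, hd, hdx, h1, h2, h3⟩ := h.exists_first hc hz hcz hx hlt
        (fun hh => hcx' (hh.2 hzx.symm).symm)
      have hdx' : ρ d < ρ x := by
        rcases hdx.lt_or_eq with hh | hh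
        · exact hh
        · obtain rfl := hinj d hd x hx hh
          exact absurd h1.symm hcx'
      by_cases hda : G.Adj d x
      · exact ⟨d, hneM d hd (by omega) h2, hda⟩
      · obtain ⟨e, he, hed, h4, h5, -⟩ := h.exists_first hx hc hlt hd hdx'
          (fun hh => hda (hh.2 h1))
        have hed' : ρ e < ρ d := by
          rcases hed.lt_or_eq with hh | hh
          · exact hh
          · obtain rfl := hinj e he d hd hh
            exact absurd h1 h5
        exact ⟨e, hneM e he (by omega) fun hh => h5 ((h3 e he hed').2 hh), h4⟩
  have hMne : M.Nonempty := by
    obtain ⟨d, hd, -⟩ := step1 p hp hzp ⟨q, hq, hzq, hpq.symm, fun hh => hpq' hh.symm⟩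
    exact ⟨d, hd⟩
  -- Take the last non-neighbour `c` of `z` that has the same neighbours as `z` among the vertices
  -- before `c`. The first vertex of `M` is a candidate, since at a first difference from `z` it
  -- would have a neighbour in `M` before it.
  obtain ⟨c, hc, hmax⟩ : ∃ c ∈ M.filter fun c => ∀ e ∈ B, ρ e < ρ c → (G.Adj e c ↔ G.Adj e z),
      ∀ c' ∈ M.filter fun c => ∀ e ∈ B, ρ e < ρ c → (G.Adj e c ↔ G.Adj e z), ρ c' ≤ ρ c := by
    apply Finset.exists_max_image
    obtain ⟨c, hc, hmin⟩ := Finset.exists_min_image M ρ hMne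
    refine ⟨c, Finset.mem_filter.2 ⟨hc, fun e he hec => ?_⟩⟩
    by_contra hcon
    obtain ⟨d, hd, hde, -, h2, -⟩ := h.exists_first ((hMB c).1 hc).1 hz (hMlt c hc) he hec hcon
    have := hmin d (hneM d hd (by have := hMlt c hc; omega) h2)
    omega
  rw [Finset.mem_filter] at hc
  obtain ⟨hcM, htwin⟩ := hc
  have hcB := ((hMB c).1 hcM).1
  have hcz := hMlt c hcM
  -- a later vertex cannot beat `z` before `c`
  have hbeat : ∀ x ∈ B, ρ c < ρ x → ∀ d ∈ B, ρ d < ρ c → G.Adj d x → ¬ G.Adj d z →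
      ¬ ∀ f ∈ B, ρ f < ρ d → (G.Adj f x ↔ G.Adj f z) := by
    intro x hx hcx d hd hdc hdx hdz hall
    refine h c hcB x hx hcx d hd hdc hdx (fun hh => hdz ((htwin d hd hdc).1 hh)) ?_
    intro f hf hfd
    rw [htwin f hf (by omega), hall f hf hfd]
  -- By the choice of `c` a later `y` in `M` differs from `z` before `y`, and first at a neighbour
  -- of `y` in `M`. By `hbeat` this neighbour does not precede `c`. Descending in this way connects
  -- every vertex of `C` to `c`.
  have hdown : ∀ y ∈ M, ρ c < ρ y → ∃ y' ∈ M, ρ c ≤ ρ y' ∧ ρ y' < ρ y ∧ G.Adj y' y := by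
    intro y hy hcy
    have hyB := ((hMB y).1 hy).1
    have : ¬ ∀ e ∈ B, ρ e < ρ y → (G.Adj e y ↔ G.Adj e z) := by
      intro hall
      have := hmax y (Finset.mem_filter.2 ⟨hy, hall⟩)
      omega
    push Not at this
    obtain ⟨e, he, hey, hne⟩ := this
    obtain ⟨d, hd, hde, h1, h2, h3⟩ := h.exists_first hyB hz (hMlt y hy) he hey (by tauto)
    have := hMlt y hy
    refine ⟨d, hneM d hd (by omega) h2, ?_, by omega, h1⟩
    by_contra hdc
    exact hbeat y hyB hcy d hd (by omega) h1 h2 h3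
  set C := M.filter fun y => ρ c ≤ ρ y with hC
  have hmemC : ∀ y, y ∈ C ↔ y ∈ M ∧ ρ c ≤ ρ y := fun y => by simp [hC]
  have hcC : c ∈ C := (hmemC c).2 ⟨hcM, le_rfl⟩
  have hdown' : ∀ y ∈ C, y ≠ c → ∃ y' ∈ C, ρ y' < ρ y ∧ G.Adj y' y := by
    intro y hy hyc
    obtain ⟨h1, h2⟩ := (hmemC y).1 hy
    have h3 : ρ c ≠ ρ y := fun hh => hyc (hinj c hcB y ((hMB y).1 h1).1 hh).symm
    obtain ⟨y', a1, a2, a3, a4⟩ := hdown y h1 (by omega)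
    exact ⟨y', (hmemC y').2 ⟨a1, a2⟩, a3, a4⟩
  refine ⟨C, fun y hy => ((hMB y).1 ((hmemC y).1 hy).1).1, ⟨⟨c, hcC⟩, ?_⟩, ?_, ?_⟩
  · intro D hD hDne hDC
    by_cases hcD : c ∈ D
    · obtain ⟨y, hy, hmin⟩ := Finset.exists_min_image (C \ D) ρ
        (Finset.sdiff_nonempty.2 fun hh => hDC (Finset.Subset.antisymm hD hh))
      rw [Finset.mem_sdiff] at hy
      obtain ⟨y', h1, h2, h3⟩ := hdown' y hy.1 (by rintro rfl; exact hy.2 hcD)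
      refine ⟨y', ?_, y, hy.1, hy.2, h3⟩
      by_contra hy'
      have := hmin y' (Finset.mem_sdiff.2 ⟨h1, hy'⟩)
      omega
    · obtain ⟨y, hy, hmin⟩ := Finset.exists_min_image D ρ hDne
      obtain ⟨y', h1, h2, h3⟩ := hdown' y (hD hy) (by rintro rfl; exact hcD hy)
      refine ⟨y, hy, y', h1, fun hy' => ?_, h3.symm⟩
      have := hmin y' hy'
      omega
  · intro u hu
    obtain ⟨-, h1, h2⟩ := (hMB u).1 ((hmemC u).1 hu).1
    exact ⟨h1, fun hh => h2 hh.symm⟩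
  · intro x hx hzx hxc
    have hxz := hlast x hx hzx.ne'
    obtain ⟨d, hd, hdx⟩ := step1 x hx hzx hxc
    -- If `x` precedes `c`, it is adjacent to `c`, which agrees with `z` there. If `x` comes later,
    -- a neighbour in `M` before `c` would make `x` win against `z` before `c`, contrary to `hbeat`.
    rcases lt_trichotomy (ρ x) (ρ c) with hlt | heq | hlt
    · exact ⟨c, hcC, ((htwin x hx hlt).2 hzx.symm).symm⟩
    · obtain rfl := hinj x hx c hcB heq
      exact absurd hzx.symm ((hMB x).1 hcM).2.2
    · by_cases hdc : ρ c ≤ ρ d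
      · exact ⟨d, (hmemC d).2 ⟨hd, hdc⟩, hdx⟩
      · obtain ⟨hdB, -, hdz⟩ := (hMB d).1 hd
        obtain ⟨e, he, hed, h1, h2, h3⟩ := h.exists_first hx hz hxz hdB (by omega)
          (fun hh => hdz (hh.1 hdx))
        exact absurd h3 (hbeat x hx hlt e he (by omega) h1 h2)

/-- The rule compares labels made of earlier vertices only, so it passes to initial segments of the
ordering. -/
theorem LexRule.subset {B B' : Finset V} {ρ : V → ℕ} (h : LexRule G B ρ) (hB : B' ⊆ B)
    (hdown : ∀ x ∈ B', ∀ e ∈ B, ρ e < ρ x → e ∈ B') : LexRule G B' ρ := by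
  intro x hx y hy hxy d hd hdx h1 h2 h3
  refine h x (hB hx) y (hB hy) hxy d (hB hd) hdx h1 h2 fun e he hed => ?_
  exact h3 e (hdown d hd e he hed) hed

end LexBFS

/-! ### Comparison of labels, and what a certificate proves. -/

section LexLabels

/-- Two sublists of a decreasing list compare according to the first element that is in only one of
them. -/
theorem List.filter_lt_filter_iff {α : Type*} (f : α → ℕ) (P Q : α → Prop) [DecidablePred P]
    [DecidablePred Q] : ∀ l : List α, l.Pairwise (fun a b => f b < f a) →
    ((l.filter P).map f < (l.filter Q).map f ↔
      ∃ d ∈ l, Q d ∧ ¬ P d ∧ ∀ e ∈ l, f d < f e → (P e ↔ Q e))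
  | [], _ => by simp
  | a :: l, h => by
    rw [List.pairwise_cons] at h
    have ih := List.filter_lt_filter_iff f P Q l h.2
    by_cases hP : P a <;> by_cases hQ : Q a
    · rw [List.filter_cons_of_pos (by simpa using hP), List.filter_cons_of_pos (by simpa using hQ),
        List.map_cons, List.map_cons, List.cons_lt_cons_self, ih]
      constructor
      · rintro ⟨d, hd, h1, h2, h3⟩
        refine ⟨d, by simp [hd], h1, h2, fun e he hde => ?_⟩
        rcases List.mem_cons.1 he with rfl | he
        · tauto
        · exact h3 e he hde
      · rintro ⟨d, hd, h1, h2, h3⟩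
        rcases List.mem_cons.1 hd with rfl | hd
        · exact absurd hP h2
        · exact ⟨d, hd, h1, h2, fun e he => h3 e (by simp [he])⟩
    · rw [List.filter_cons_of_pos (by simpa using hP), List.filter_cons_of_neg (by simpa using hQ),
        List.map_cons]
      refine iff_of_false ?_ ?_
      · cases hl : (l.filter Q).map f with
        | nil => simp
        | cons x t =>
          rw [List.cons_lt_cons_iff]
          have hx : x ∈ (l.filter Q).map f := by rw [hl]; simp
          obtain ⟨y, hy, rfl⟩ := List.mem_map.1 hx
          have := h.1 y (List.mem_filter.1 hy).1
          omega
      · rintro ⟨d, hd, h1, h2, h3⟩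
        rcases List.mem_cons.1 hd with rfl | hd
        · exact hQ h1
        · have := h3 a (by simp) (h.1 d hd)
          tauto
    · rw [List.filter_cons_of_neg (by simpa using hP), List.filter_cons_of_pos (by simpa using hQ),
        List.map_cons]
      refine iff_of_true ?_ ⟨a, by simp, hQ, hP, fun e he hae => ?_⟩
      · cases hl : (l.filter P).map f with
        | nil => simp
        | cons x t =>
          rw [List.cons_lt_cons_iff]
          have hx : x ∈ (l.filter P).map f := by rw [hl]; simp
          obtain ⟨y, hy, rfl⟩ := List.mem_map.1 hx
          have := h.1 y (List.mem_filter.1 hy).1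
          omega
      · rcases List.mem_cons.1 he with rfl | he
        · omega
        · have := h.1 e he; omega
    · rw [List.filter_cons_of_neg (by simpa using hP), List.filter_cons_of_neg (by simpa using hQ),
        ih]
      constructor
      · rintro ⟨d, hd, h1, h2, h3⟩
        refine ⟨d, by simp [hd], h1, h2, fun e he hde => ?_⟩
        rcases List.mem_cons.1 he with rfl | he
        · tauto
        · exact h3 e he hde
      · rintro ⟨d, hd, h1, h2, h3⟩
        rcases List.mem_cons.1 hd with rfl | hd
        · exact absurd h1 hQ
        · exact ⟨d, hd, h1, h2, fun e he => h3 e (by simp [he])⟩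

/-- A LexBFS ordering, in terms of the first difference between two labels. -/
theorem isLexBFSOrdering_iff {n : ℕ} (G : SimpleGraph (Fin n)) (order : Equiv.Perm (Fin n)) :
    IsLexBFSOrdering G order ↔ ∀ i j, i ≤ j → ∀ d < i, G.Adj (order d) (order j) →
      ¬ G.Adj (order d) (order i) →
      ¬ ∀ e < d, (G.Adj (order e) (order i) ↔ G.Adj (order e) (order j)) := by
  classical
  have key : ∀ i j, lexLabel G order i (order j) ≤ lexLabel G order i (order i) ↔
      ∀ d < i, G.Adj (order d) (order j) → ¬ G.Adj (order d) (order i) →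
      ¬ ∀ e < d, (G.Adj (order e) (order i) ↔ G.Adj (order e) (order j)) := by
    intro i j
    rw [← not_lt]
    unfold lexLabel
    have h := List.filter_lt_filter_iff (fun k : Fin n => n - k.val)
      (fun k => k < i ∧ G.Adj (order k) (order i)) (fun k => k < i ∧ G.Adj (order k) (order j))
      (List.finRange n) (by
        refine (List.pairwise_lt_finRange n).imp fun {a b} hab => ?_
        have := b.2
        have : a.val < b.val := hab
        omega)
    have h' := not_congr h
    refine Iff.trans ?_ (h'.trans ?_)
    · exact Iff.rfl
    · have e : ∀ d e : Fin n, n - d.val < n - e.val ↔ e < d := by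
        intro d e
        have := d.2; have := e.2
        rw [Fin.lt_def]; omega
      simp only [List.mem_finRange, true_and, e, not_exists]
      constructor
      · intro hh d hd h1 h2 h3
        refine hh d ⟨⟨hd, h1⟩, fun h4 => h2 h4.2, fun e _ he => ?_⟩
        have := h3 e he
        tauto
      · rintro hh d ⟨⟨hd, h1⟩, h2, h3⟩
        refine hh d hd h1 (fun h4 => h2 ⟨hd, h4⟩) fun e he => ?_
        have := h3 e trivial he
        have h5 : e < i := he.trans hd
        tauto
  simp only [IsLexBFSOrdering, key]

theorem IsLexBFSOrdering.lexRule {n : ℕ} {G : SimpleGraph (Fin n)} {order : Equiv.Perm (Fin n)}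
    (h : IsLexBFSOrdering G order) :
    LexRule G Finset.univ (fun x => (order.symm x).val) := by
  rw [isLexBFSOrdering_iff] at h
  intro x _ y _ hxy d _ hdx h1 h2 h3
  refine h (order.symm x) (order.symm y) (le_of_lt hxy) (order.symm d) hdx (by simpa using h1)
    (by simpa using h2) fun e he => ?_
  simpa using h3 (order e) (Finset.mem_univ _) (by simpa using he)

/-- Apply `LexRule.exists_conn` to the vertices up to `z`, the centre of the certificate. It
attaches the whole hole to one connected set outside the closed neighbourhood of `z`, against
`Wheel.exists_not_attached`. -/
theorem Certificate.Valid.not_fourHoleFree_and_oddSignable {n : ℕ} {G : SimpleGraph (Fin n)}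
    {c : Certificate n} (hc : c.Valid G) : ¬ (FourHoleFree G ∧ OddSignable G) := by
  rintro ⟨h4, hodd⟩
  obtain ⟨s, hs⟩ := hodd.exists_oddWeights
  obtain ⟨horder, k, hk, f, -, hf⟩ := hc
  obtain ⟨m, rfl⟩ : ∃ m, k = m + 1 := ⟨k - 1, by omega⟩
  set z := c.order c.pos with hz
  -- `ZMod (m + 1)` unfolds to `Fin (m + 1)`, so the embedding itself serves as the cyclic
  -- enumeration.
  let h : ZMod (m + 1) → Fin n := fun i => f i
  have h1 : ((1 : ZMod (m + 1)) : Fin (m + 1)).val = 1 := by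
    change (1 : Fin (m + 1)).val = 1
    change 1 % (m + 1) = 1
    rw [Nat.mod_eq_of_lt]; omega
  have W : Wheel G s z (m + 1) h := by
    refine ⟨hs, ?_, hk, ?_, fun i j hij => f.injective hij, fun i => (hf i).1⟩
    · intro c P hP hlen
      obtain ⟨g, -⟩ := hP.exists_embedding
      rw [hlen] at g
      exact h4.false g
    · intro i j
      have e : G.Adj (h i) (h j) ↔ (SimpleGraph.cycleGraph (m + 1)).Adj i j := f.map_rel_iff
      refine e.trans ((SimpleGraph.cycleGraph_adj' (u := i) (v := j)).trans ?_)
      have e2 : ∀ a b : ZMod (m + 1), ((a - b : Fin (m + 1))).val = 1 ↔ a = b + 1 := by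
        intro a b
        have e3 : a - b = 1 ↔ a = b + 1 := sub_eq_iff_eq_add'
        rw [← e3]
        exact ⟨fun hh => Fin.ext (hh.trans h1.symm), fun hh => (congrArg ZMod.val hh).trans h1⟩
      exact or_congr (e2 i j) (e2 j i)
  set ρ : Fin n → ℕ := fun x => (c.order.symm x).val with hρ
  set B : Finset (Fin n) := Finset.univ.filter fun x => ρ x ≤ ρ z with hB
  have hrule : LexRule G B ρ := horder.lexRule.subset (Finset.subset_univ _) (by
    intro x hx e _ hex
    simp only [hB, Finset.mem_filter, Finset.mem_univ, true_and] at hx ⊢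
    change ρ e < ρ x at hex
    omega)
  have hinj : ∀ x y, ρ x = ρ y → x = y := fun x y hxy =>
    c.order.symm.injective (Fin.ext hxy)
  have hmem : ∀ i, h i ∈ B := by
    intro i
    have := (hf i).2
    simp only [hB, Finset.mem_filter, Finset.mem_univ, true_and, hρ, hz,
      Equiv.symm_apply_apply]
    exact le_of_lt this
  have one_ne : ∀ t : ℕ, 0 < t → t ≤ 3 → (t : ZMod (m + 1)) ≠ 0 := by
    intro t ht ht3 h0
    have := ZMod.natCast_eq_zero_of_lt h0 (by omega)
    omega
  -- The vertex two steps further on the hole is the missed neighbour of `z` that the attachment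
  -- clause of `LexRule.exists_conn` asks for.
  have hfar : ∀ i, i ≠ i + 2 ∧ ¬ G.Adj (h i) (h (i + 2)) := by
    intro i
    have a1 := one_ne 1 (by omega) (by omega)
    have a2 := one_ne 2 (by omega) (by omega)
    have a3 := one_ne 3 (by omega) (by omega)
    push_cast at a1 a2 a3
    refine ⟨fun hh => a2 (by linear_combination -hh), ?_⟩
    rw [W.adj]
    rintro (hh | hh)
    · exact a3 (by linear_combination -hh)
    · exact a1 (by linear_combination hh)
  obtain ⟨C, -, hC, hCz, hatt⟩ := hrule.exists_conn (fun x _ y _ => hinj x y) (z := z)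
    (by simp [hB]) (fun x hx hxz => lt_of_le_of_ne (by simpa [hB] using hx)
      fun hh => hxz (hinj x z hh)) (hmem 0) (hmem (0 + 2)) (W.adj_center _) (W.adj_center _)
    (fun hh => (hfar 0).1 (W.inj hh)) (hfar 0).2
  obtain ⟨i, hi⟩ := W.exists_not_attached hC hCz
  exact hi (hatt (h i) (hmem i) (W.adj_center i) ⟨h (i + 2), hmem _, W.adj_center _,
    fun hh => (hfar i).1 (W.inj hh).symm, fun hh => (hfar i).2 hh.symm⟩)

end LexLabels

/-! ### Reasoning about programs -/

namespace RAM

/-- The register or array changed by an instruction. -/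
def Instr.loc : Instr → ℕ × ℕ
  | .const r _ => (0, r)
  | .copy r _ => (0, r)
  | .inc r => (0, r)
  | .dec r => (0, r)
  | .load r _ _ => (0, r)
  | .store a _ _ => (1, a)
  | .wzero x => (2, x)
  | .wcopy x _ => (2, x)
  | .wadd x _ => (2, x)
  | .wload x _ _ => (2, x)
  | .wstore a _ _ => (3, a)
  | .emit _ => (4, 0)

/-- The registers and arrays that a program may change. -/
def Program.locs : Program → List (ℕ × ℕ)
  | .skip => []
  | .instr i => [i.loc]
  | .seq p q => p.locs ++ q.locs
  | .cond _ p q => p.locs ++ q.locs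
  | .loop _ p => p.locs

/-- The states `s` and `s'` agree outside the locations `l`. -/
structure SameOutside (l : List (ℕ × ℕ)) (s s' : State) : Prop where
  reg : ∀ r, (0, r) ∉ l → s'.reg r = s.reg r
  arr : ∀ a, (1, a) ∉ l → s'.arr a = s.arr a
  wreg : ∀ r, (2, r) ∉ l → s'.wreg r = s.wreg r
  warr : ∀ a, (3, a) ∉ l → s'.warr a = s.warr a
  out : (4, 0) ∉ l → s'.out = s.out

theorem SameOutside.refl (l : List (ℕ × ℕ)) (s : State) : SameOutside l s s :=
  ⟨fun _ _ => rfl, fun _ _ => rfl, fun _ _ => rfl, fun _ _ => rfl, fun _ => rfl⟩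

theorem SameOutside.trans {l : List (ℕ × ℕ)} {s s' s'' : State} (h : SameOutside l s s')
    (h' : SameOutside l s' s'') : SameOutside l s s'' :=
  ⟨fun r hr => (h'.reg r hr).trans (h.reg r hr), fun r hr => (h'.arr r hr).trans (h.arr r hr),
    fun r hr => (h'.wreg r hr).trans (h.wreg r hr), fun r hr => (h'.warr r hr).trans (h.warr r hr),
    fun hr => (h'.out hr).trans (h.out hr)⟩

theorem SameOutside.mono {l l' : List (ℕ × ℕ)} {s s' : State} (h : SameOutside l s s')
    (hl : ∀ x ∈ l, x ∈ l') : SameOutside l' s s' :=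
  ⟨fun r hr => h.reg r fun hh => hr (hl _ hh), fun r hr => h.arr r fun hh => hr (hl _ hh),
    fun r hr => h.wreg r fun hh => hr (hl _ hh), fun r hr => h.warr r fun hh => hr (hl _ hh),
    fun hr => h.out fun hh => hr (hl _ hh)⟩

theorem Instr.sameOutside (i : Instr) (s : State) : SameOutside [i.loc] s (i.run s) := by
  cases i <;> constructor <;> intros <;> simp_all [Instr.run, Instr.loc]

/-- This is the frame rule. What a program leaves untouched is read off its text, so the side
conditions are closed by `decide` or `simp`. -/
theorem Exec.sameOutside {p : Program} {s s' : State} {t : ℕ} (h : Exec p s s' t) :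
    SameOutside p.locs s s' := by
  induction h with
  | skip s => exact .refl _ _
  | instr i s => exact i.sameOutside s
  | seq _ _ h1 h2 =>
    exact (h1.mono fun x hx => List.mem_append_left _ hx).trans
      (h2.mono fun x hx => List.mem_append_right _ hx)
  | condTrue _ _ h1 => exact h1.mono fun x hx => List.mem_append_left _ hx
  | condFalse _ _ h1 => exact h1.mono fun x hx => List.mem_append_right _ hx
  | loopDone _ => exact .refl _ _
  | loopStep _ _ _ h1 h2 => exact h1.trans h2

/-- Started in `s`, the program halts within `T` steps in a state that satisfies `Q`. -/
def Runs (p : Program) (s : State) (T : ℕ) (Q : State → Prop) : Prop :=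
  ∃ s' t, Exec p s s' t ∧ t ≤ T ∧ Q s'

theorem Runs.mono {p : Program} {s : State} {T T' : ℕ} {Q Q' : State → Prop}
    (h : Runs p s T Q) (hT : T ≤ T') (hQ : ∀ s', SameOutside p.locs s s' → Q s' → Q' s') :
    Runs p s T' Q' := by
  obtain ⟨s', t, h1, h2, h3⟩ := h
  exact ⟨s', t, h1, h2.trans hT, hQ s' h1.sameOutside h3⟩

theorem Runs.skip {s : State} {T : ℕ} {Q : State → Prop} (hQ : Q s) (hT : 1 ≤ T) :
    Runs .skip s T Q :=
  ⟨s, 1, .skip s, hT, hQ⟩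

/-- The continuation may use the frame of the first program. Specifications therefore state only
what a program computes. -/
theorem Runs.seq {p q : Program} {s : State} {T T₁ T₂ : ℕ} {Q : State → Prop}
    (h : Runs p s T₁ fun s' => SameOutside p.locs s s' → Runs q s' T₂ Q) (hT : T₁ + T₂ ≤ T) :
    Runs (.seq p q) s T Q := by
  obtain ⟨s', t, h1, h2, h3⟩ := h
  obtain ⟨s'', t', h4, h5, h6⟩ := h3 h1.sameOutside
  exact ⟨s'', t + t', .seq h1 h4, by omega, h6⟩

theorem Runs.cond {b : Test} {p q : Program} {s : State} {T T' : ℕ} {Q : State → Prop}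
    (hp : b.Holds s → Runs p s T Q) (hq : ¬ b.Holds s → Runs q s T Q) (hT : T + 1 ≤ T') :
    Runs (.cond b p q) s T' Q := by
  by_cases hb : b.Holds s
  · obtain ⟨s', t, h1, h2, h3⟩ := hp hb
    exact ⟨s', t + 1, .condTrue hb h1, by omega, h3⟩
  · obtain ⟨s', t, h1, h2, h3⟩ := hq hb
    exact ⟨s', t + 1, .condFalse hb h1, by omega, h3⟩

/-- A sequence of elementary instructions. -/
def block : List Instr → Program
  | [] => .skip
  | i :: l => .seq (.instr i) (block l)

theorem Runs.block {l : List Instr} {s : State} {T : ℕ} {Q : State → Prop}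
    (hQ : Q (l.foldl (fun s i => i.run s) s)) (hT : l.length + 1 ≤ T) : Runs (block l) s T Q := by
  induction l generalizing s T with
  | nil => exact Runs.skip hQ hT
  | cons i l ih =>
    obtain ⟨s', t, h1, h2, h3⟩ := ih (s := i.run s) (T := T - 1) hQ (by simp at hT; omega)
    exact ⟨s', 1 + t, .seq (.instr i s) h1, by simp at hT; omega, h3⟩

/-- The loop `while b do p`, with a bound `k` on the number of remaining rounds. -/
theorem Runs.loop {b : Test} {p : Program} {c : ℕ} (I : ℕ → State → Prop)
    (h0 : ∀ s, I 0 s → ¬ b.Holds s)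
    (hstep : ∀ k s, I (k + 1) s → b.Holds s → Runs p s c (I k)) :
    ∀ k s, I k s → Runs (.loop b p) s (k * (c + 1) + 1) fun s' => ¬ b.Holds s' ∧ ∃ k, I k s' := by
  intro k
  induction k with
  | zero => exact fun s hI => ⟨s, 1, .loopDone (h0 s hI), by omega, h0 s hI, 0, hI⟩
  | succ k ih =>
    intro s hI
    by_cases hb : b.Holds s
    · obtain ⟨s₁, t₁, h1, h2, h3⟩ := hstep k s hI hb
      obtain ⟨s₂, t₂, h4, h5, h6⟩ := ih s₁ h3
      refine ⟨s₂, t₁ + t₂ + 1, .loopStep hb h1 h4, ?_, h6⟩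
      rw [Nat.add_mul]
      omega
    · exact ⟨s, 1, .loopDone hb, by omega, hb, k + 1, hI⟩

/-- `for (; x < y; x++) p` -/
def forRange (x y : ℕ) (p : Program) : Program :=
  .loop (.lt x y) (.seq p (.instr (.inc x)))

/-- The counter changes after the body has established `I (j + 1)`, so the invariant must not depend
on it (`hstable`). The extra `2` steps per round are the test and the increment. -/
theorem Runs.forRange {x y : ℕ} {p : Program} {s : State} {T a b : ℕ} {Q : State → Prop}
    (I : ℕ → State → Prop) (c : ℕ → ℕ) (hp : (0, x) ∉ p.locs ∧ (0, y) ∉ p.locs ∧ x ≠ y)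
    (hx : s.reg x = a) (hy : s.reg y = b) (hab : a ≤ b)
    (hstable : ∀ j s k, I j s → I j { s with reg := Function.update s.reg x k })
    (hI : I a s)
    (hstep : ∀ j s', a ≤ j → j < b → SameOutside ((0, x) :: p.locs) s s' → s'.reg x = j →
      I j s' → Runs p s' (c j) (I (j + 1)))
    (hT : ∑ j ∈ Finset.Ico a b, (c j + 2) + 1 ≤ T)
    (hQ : ∀ s', SameOutside ((0, x) :: p.locs) s s' → s'.reg x = b → I b s' → Q s') :
    Runs (forRange x y p) s T Q := by
  obtain ⟨hpx, hpy, hxy⟩ := hp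
  have hy' : ∀ s', SameOutside ((0, x) :: p.locs) s s' → s'.reg y = b := fun s' hs' => by
    rw [hs'.reg y (by simp [hpy, hxy.symm]), hy]
  have main : ∀ d j s', j + d = b → a ≤ j → SameOutside ((0, x) :: p.locs) s s' →
      s'.reg x = j → I j s' →
      Runs (RAM.forRange x y p) s' (∑ j ∈ Finset.Ico j b, (c j + 2) + 1)
        fun s'' => SameOutside ((0, x) :: p.locs) s s'' ∧ s''.reg x = b ∧ I b s'' := by
    intro d
    induction d with
    | zero =>
      intro j s' hj hja hs' hxj hIj
      obtain rfl : j = b := by omega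
      refine ⟨s', 1, .loopDone ?_, by simp, hs', hxj, hIj⟩
      simp [Test.Holds, hxj, hy' s' hs']
    | succ d ih =>
      intro j s' hj hja hs' hxj hIj
      obtain ⟨s₁, t₁, h1, h2, h3⟩ := hstep j s' hja (by omega) hs' hxj hIj
      have hs₁ : SameOutside ((0, x) :: p.locs) s s₁ :=
        hs'.trans (h1.sameOutside.mono fun z hz => List.mem_cons_of_mem _ hz)
      have hxj₁ : s₁.reg x = j := by rw [h1.sameOutside.reg x hpx, hxj]
      obtain ⟨s₂, t₂, h4, h5, h6⟩ := ih (j + 1) ((Instr.inc x).run s₁) (by omega) (by omega)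
        (hs₁.trans (((Instr.inc x).sameOutside s₁).mono (by simp [Instr.loc])))
        (by simp [Instr.run, hxj₁]) (hstable _ _ _ h3)
      refine ⟨s₂, (t₁ + 1) + t₂ + 1, .loopStep ?_ (.seq h1 (.instr _ _)) h4, ?_, h6⟩
      · simp [Test.Holds, hxj, hy' s' hs']; omega
      · rw [Finset.sum_eq_sum_Ico_succ_bot (by omega)]
        omega
  obtain ⟨s', t, h1, h2, h3, h4, h5⟩ := main (b - a) a s (by omega) le_rfl (.refl _ _) hx hI
  exact ⟨s', t, h1, h2.trans hT, hQ s' h3 h4 h5⟩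

/-- `for (; x < y; x++) { z = A[x]; p }` -/
def forEach (x y z A : ℕ) (p : Program) : Program :=
  .loop (.lt x y) (.seq (.instr (.load z A x)) (.seq p (.instr (.inc x))))

/-- The array `f` contains the list `l` from position `i` on. -/
def Holds (f : ℕ → ℕ) (i : ℕ) (l : List ℕ) : Prop :=
  ∀ j (h : j < l.length), f (i + j) = l[j]

/-- The invariant is indexed by the part of the list already treated. The cost of a round may depend
on the element, so that sums over degrees can be formed; the extra `3` steps are the test, the load
and the increment. -/
theorem Runs.forEach {x y z A : ℕ} {p : Program} {s : State} {T i : ℕ} {Q : State → Prop}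
    (l : List ℕ) (I : List ℕ → State → Prop) (c : ℕ → ℕ)
    (hp : (0, x) ∉ p.locs ∧ (0, y) ∉ p.locs ∧ (1, A) ∉ p.locs ∧ x ≠ y ∧ x ≠ z ∧ y ≠ z)
    (hx : s.reg x = i) (hy : s.reg y = i + l.length) (hA : Holds (s.arr A) i l)
    (hstable : ∀ l s k, I l s → I l { s with reg := Function.update s.reg x k } ∧
      I l { s with reg := Function.update s.reg z k })
    (hI : I [] s)
    (hstep : ∀ l₁ v l₂ s', l = l₁ ++ v :: l₂ → SameOutside ((0, x) :: (0, z) :: p.locs) s s' →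
      s'.reg x = i + l₁.length → s'.reg z = v → I l₁ s' → Runs p s' (c v) (I (l₁ ++ [v])))
    (hT : (l.map fun v => c v + 3).sum + 1 ≤ T)
    (hQ : ∀ s', SameOutside ((0, x) :: (0, z) :: p.locs) s s' → I l s' → Q s') :
    Runs (forEach x y z A p) s T Q := by
  obtain ⟨hpx, hpy, hpA, hxy, hxz, hyz⟩ := hp
  have main : ∀ l₂ l₁ s', l = l₁ ++ l₂ → SameOutside ((0, x) :: (0, z) :: p.locs) s s' →
      s'.reg x = i + l₁.length → I l₁ s' →
      Runs (RAM.forEach x y z A p) s' ((l₂.map fun v => c v + 3).sum + 1)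
        fun s'' => SameOutside ((0, x) :: (0, z) :: p.locs) s s'' ∧ I l s'' := by
    intro l₂
    induction l₂ with
    | nil =>
      intro l₁ s' hl hs' hxj hIj
      rw [List.append_nil] at hl
      subst hl
      refine ⟨s', 1, .loopDone ?_, by simp, hs', hIj⟩
      simp [Test.Holds, hxj, hs'.reg y (by simp [hpy, hxy.symm, hyz]), hy]
    | cons v l₂ ih =>
      intro l₁ s' hl hs' hxj hIj
      have hyj : s'.reg y = i + l.length := by
        rw [hs'.reg y (by simp [hpy, hxy.symm, hyz]), hy]
      have hv : s'.arr A (s'.reg x) = v := by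
        rw [hs'.arr A (by simp [hpA]), hxj, hA l₁.length (by simp [hl])]
        simp [hl]
      set s₀ := (Instr.load z A x).run s' with hs₀
      have hs₀' : SameOutside ((0, x) :: (0, z) :: p.locs) s s₀ :=
        hs'.trans (((Instr.load z A x).sameOutside s').mono (by simp [Instr.loc]))
      obtain ⟨s₁, t₁, h1, h2, h3⟩ := hstep l₁ v l₂ s₀ hl hs₀'
        (by simp [hs₀, Instr.run, hxz, hxj]) (by simp [hs₀, Instr.run, hv])
        (hstable _ _ _ hIj).2
      have hs₁ : SameOutside ((0, x) :: (0, z) :: p.locs) s s₁ :=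
        hs₀'.trans (h1.sameOutside.mono fun w hw => by simp [hw])
      have hxj₁ : s₁.reg x = i + l₁.length := by
        rw [h1.sameOutside.reg x hpx]
        simp [hs₀, Instr.run, hxz, hxj]
      obtain ⟨s₂, t₂, h4, h5, h6⟩ := ih (l₁ ++ [v]) ((Instr.inc x).run s₁) (by simp [hl])
        (hs₁.trans (((Instr.inc x).sameOutside s₁).mono (by simp [Instr.loc])))
        (by simp [Instr.run, hxj₁]; omega) (hstable _ _ _ h3).1
      refine ⟨s₂, (1 + (t₁ + 1)) + t₂ + 1,
        .loopStep ?_ (.seq (.instr _ _) (.seq h1 (.instr _ _))) h4, ?_, h6⟩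
      · simp [Test.Holds, hxj, hyj, hl]
      · simp only [List.map_cons, List.sum_cons]
        omega
  obtain ⟨s', t, h1, h2, h3, h4⟩ := main l [] s rfl (.refl _ _) (by simpa using hx) hI
  exact ⟨s', t, h1, h2.trans hT, hQ s' h3 h4⟩

theorem Holds.snoc {f : ℕ → ℕ} {l : List ℕ} {v : ℕ} (h : Holds f 0 l) :
    Holds (Function.update f l.length v) 0 (l ++ [v]) := by
  intro j hj
  rw [List.length_append, List.length_singleton] at hj
  by_cases hjl : j = l.length
  · subst hjl; simp
  · rw [zero_add, Function.update_of_ne hjl, List.getElem_append_left (by omega)]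
    simpa using h j (by omega)

/-- The lists of neighbours of a graph with vertices `0, …, n-1`. -/
structure IsNbrs (n : ℕ) (N : ℕ → List ℕ) : Prop where
  lt : ∀ {u v}, u ∈ N v → u < n
  symm : ∀ {u v}, u ∈ N v → v ∈ N u
  irrefl : ∀ v, v ∉ N v
  nodup : ∀ v, (N v).Nodup

theorem IsNbrs.length_le {n : ℕ} {N : ℕ → List ℕ} (hN : IsNbrs n N) (v : ℕ) :
    (N v).length ≤ n := by
  have : (N v).toFinset ⊆ Finset.range n := fun u hu => by
    simpa using hN.lt (List.mem_toFinset.1 hu)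
  simpa [List.toFinset_card_of_nodup (hN.nodup v)] using Finset.card_le_card this

/-- The state contains the input graph. -/
structure Input (n : ℕ) (N : ℕ → List ℕ) (w : ℕ → ℝ≥0) (s : State) : Prop where
  size : s.reg 0 = n
  zero : s.reg 3 = 0
  off : ∀ v < n, s.arr 0 (v + 1) = s.arr 0 v + (N v).length
  adj : ∀ v < n, Holds (s.arr 1) (s.arr 0 v) (N v)
  wt : ∀ v < n, s.warr 0 v = w v

theorem Input.same {n : ℕ} {N : ℕ → List ℕ} {w : ℕ → ℝ≥0} {s s' : State} {l : List (ℕ × ℕ)}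
    (h : Input n N w s) (hs : SameOutside l s s')
    (hl : ∀ x ∈ [(0, 0), (0, 3), (1, 0), (1, 1), (3, 0)], x ∉ l) : Input n N w s' := by
  have h0 := hs.arr 0 (hl _ (by simp))
  have h1 := hs.arr 1 (hl _ (by simp))
  exact ⟨by rw [hs.reg 0 (hl _ (by simp)), h.size], by rw [hs.reg 3 (hl _ (by simp)), h.zero],
    fun v hv => by rw [h0, h.off v hv], fun v hv => by rw [h0, h1]; exact h.adj v hv,
    fun v hv => by rw [hs.warr 0 (hl _ (by simp)), h.wt v hv]⟩

/-- A loop over the neighbours of the vertex in register `u`. -/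
def nbrLoop (x y z u : ℕ) (p : Program) : Program :=
  .seq (block [.load x 0 u, .copy y u, .inc y, .load y 0 y]) (forEach x y z 1 p)

theorem Runs.nbrLoop {x y z u n v : ℕ} {N : ℕ → List ℕ} {w : ℕ → ℝ≥0} {p : Program} {s : State}
    {T : ℕ} {Q : State → Prop} (I : List ℕ → State → Prop) (c : ℕ)
    (hs : Input n N w s) (hu : s.reg u = v) (hv : v < n) (hux : x ≠ u)
    (hp : (0, x) ∉ p.locs ∧ (0, y) ∉ p.locs ∧ (1, 1) ∉ p.locs ∧ x ≠ y ∧ x ≠ z ∧ y ≠ z)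
    (hstable : ∀ l s k, I l s → I l { s with reg := Function.update s.reg x k } ∧
      I l { s with reg := Function.update s.reg y k } ∧
      I l { s with reg := Function.update s.reg z k })
    (hI : I [] s)
    (hstep : ∀ l₁ a l₂ s', N v = l₁ ++ a :: l₂ →
      SameOutside ((0, x) :: (0, y) :: (0, z) :: p.locs) s s' →
      s'.reg z = a → I l₁ s' → Runs p s' c (I (l₁ ++ [a])))
    (hT : (N v).length * (c + 3) + 6 ≤ T)
    (hQ : ∀ s', SameOutside ((0, x) :: (0, y) :: (0, z) :: p.locs) s s' → I (N v) s' → Q s') :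
    Runs (nbrLoop x y z u p) s T Q := by
  obtain ⟨hpx, hpy, hpA, hxy, hxz, hyz⟩ := hp
  refine Runs.seq (T₁ := 5) (T₂ := (N v).length * (c + 3) + 1) (Runs.block ?_ (by simp)) (by omega)
  intro hsame
  have e1 : ∀ s' : State, s' = [Instr.load x 0 u, .copy y u, .inc y, .load y 0 y].foldl
      (fun s i => i.run s) s → s'.reg x = s.arr 0 v ∧ s'.reg y = s.arr 0 (v + 1) ∧
      s'.arr = s.arr := by
    rintro s' rfl
    simp [Instr.run, hu, hxy, hux.symm]
  generalize hs' : [Instr.load x 0 u, .copy y u, .inc y, .load y 0 y].foldl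
      (fun s i => i.run s) s = s₁ at hsame ⊢
  obtain ⟨h1, h2, h3⟩ := e1 s₁ hs'.symm
  have hsame' : SameOutside ((0, x) :: (0, y) :: (0, z) :: p.locs) s s₁ :=
    hsame.mono (by simp [RAM.block, Program.locs, Instr.loc])
  refine Runs.forEach (N v) I (fun _ => c) ⟨hpx, hpy, hpA, hxy, hxz, hyz⟩ h1
    (by rw [h2, hs.off v hv]) (by rw [h3]; exact hs.adj v hv)
    (fun l s k h => ⟨(hstable l s k h).1, (hstable l s k h).2.2⟩) ?_ ?_ (by simp) ?_
  · rw [← hs']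
    simp only [List.foldl_cons, List.foldl_nil, Instr.run]
    exact (hstable _ _ _ (hstable _ _ _ (hstable _ _ _ (hstable _ _ _ hI).1).2.1).2.1).2.1
  · intro l₁ a l₂ s' hl hs₁ _ hz hIl
    exact hstep l₁ a l₂ s' hl (hsame'.trans (hs₁.mono (by simp; tauto))) hz hIl
  · intro s' hs₁ hIl
    exact hQ s' (hsame'.trans (hs₁.mono (by simp; tauto))) hIl

end RAM

/-! ### Ranks for lexicographic breadth-first search -/

section Ranks

variable {N : ℕ → List ℕ}

/-- At the first vertex of `o` that distinguishes `u` from `w`, `u` is a neighbour. -/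
def Beats (N : ℕ → List ℕ) (o : List ℕ) (u w : ℕ) : Prop :=
  ∃ p d q, o = p ++ d :: q ∧ (∀ e ∈ p, u ∈ N e ↔ w ∈ N e) ∧ u ∈ N d ∧ w ∉ N d

theorem Beats.append {o : List ℕ} {u w : ℕ} (h : Beats N o u w) (o' : List ℕ) :
    Beats N (o ++ o') u w := by
  obtain ⟨p, d, q, rfl, h⟩ := h
  exact ⟨p, d, q ++ o', by simp, h⟩

theorem Beats.of_twins {o : List ℕ} {u w v : ℕ} (h : ∀ e ∈ o, u ∈ N e ↔ w ∈ N e) (hu : u ∈ N v)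
    (hw : w ∉ N v) : Beats N (o ++ [v]) u w :=
  ⟨o, v, [], rfl, h, hu, hw⟩

theorem Beats.not_twins {o : List ℕ} {u w : ℕ} (h : Beats N o u w) :
    ¬ ∀ e ∈ o, u ∈ N e ↔ w ∈ N e := by
  obtain ⟨p, d, q, rfl, -, h1, h2⟩ := h
  exact fun hh => h2 ((hh d (by simp)).1 h1)

theorem Beats.asymm {o : List ℕ} {u w : ℕ} (h : Beats N o u w) : ¬ Beats N o w u := by
  obtain ⟨p, d, q, rfl, h0, h1, h2⟩ := h
  rintro ⟨p', d', q', h, h0', h1', h2'⟩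
  rcases List.append_eq_append_iff.1 h with ⟨a, rfl, ha⟩ | ⟨a, rfl, ha⟩
  · cases a with
    | nil => simp at ha; obtain ⟨rfl, -⟩ := ha; exact h2 h1'
    | cons b a => simp at ha; obtain ⟨rfl, -⟩ := ha; exact h2 ((h0' d (by simp)).2 h1)
  · cases a with
    | nil => simp at ha; obtain ⟨rfl, -⟩ := ha; exact h2 h1'
    | cons b a => simp at ha; obtain ⟨rfl, -⟩ := ha; exact h2' ((h0 d' (by simp)).2 h1')

/-- The list `o` starts a lexicographic breadth-first search of `K`. -/
def LexPrefix (N : ℕ → List ℕ) (K o : List ℕ) : Prop :=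
  ∀ p x q, o = p ++ x :: q → ∀ y ∈ K, y ∉ p → ¬ Beats N p y x

theorem LexPrefix.snoc {K o : List ℕ} (h : LexPrefix N K o) {v : ℕ}
    (hv : ∀ y ∈ K, y ∉ o → ¬ Beats N o y v) : LexPrefix N K (o ++ [v]) := by
  intro p x q hpq
  rcases List.eq_nil_or_concat q with rfl | ⟨q', y, rfl⟩
  · obtain ⟨rfl, h2⟩ := List.append_inj' hpq rfl
    simp at h2
    subst h2
    exact hv
  · have h1 : o ++ [v] = (p ++ x :: q') ++ [y] := by rw [hpq]; simp
    obtain ⟨rfl, -⟩ := List.append_inj' h1 rfl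
    exact h p x q' rfl

/-- The list `o` is a lexicographic breadth-first search ordering. -/
def LexList (N : ℕ → List ℕ) (o : List ℕ) : Prop :=
  ∀ p x q, o = p ++ x :: q → ∀ y ∈ q, ¬ Beats N p y x

theorem LexPrefix.lexList {K o : List ℕ} (h : LexPrefix N K o) (hK : ∀ x ∈ o, x ∈ K)
    (ho : o.Nodup) : LexList N o := by
  rintro p x q rfl y hy
  refine h p x q rfl y (hK y (by simp [hy])) fun hyp => ?_
  rw [List.nodup_append] at ho
  exact ho.2.2 y hyp y (by simp [hy]) rfl

/-- The ranks `r` of the unvisited vertices of `K` order them by their labels, with enough space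
between the ranks. -/
structure RankInv (N : ℕ → List ℕ) (K o : List ℕ) (r : ℕ → ℕ) : Prop where
  zero : ∀ a, a ∉ K.toFinset \ o.toFinset → r a = 0
  twins : ∀ u ∈ K.toFinset \ o.toFinset, ∀ w ∈ K.toFinset \ o.toFinset, r u = r w →
    ∀ e ∈ o, u ∈ N e ↔ w ∈ N e
  beats : ∀ u ∈ K.toFinset \ o.toFinset, ∀ w ∈ K.toFinset \ o.toFinset, r w < r u → Beats N o u w
  gap : ∀ u ∈ K.toFinset \ o.toFinset, ∀ w ∈ K.toFinset \ o.toFinset, r w < r u →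
    r w + ((K.toFinset \ o.toFinset).filter fun x => r x = r u).card ≤ r u
  pos : ∀ u ∈ K.toFinset \ o.toFinset,
    ((K.toFinset \ o.toFinset).filter fun x => r x = r u).card ≤ r u

theorem RankInv.one_le {K o : List ℕ} {r : ℕ → ℕ} (h : RankInv N K o r) {u : ℕ}
    (hu : u ∈ K.toFinset \ o.toFinset) : 1 ≤ r u :=
  le_trans (Finset.card_pos.2 ⟨u, by simpa using hu⟩) (h.pos u hu)

/-- With a single class every comparison of ranks is void, and the rank `K.length` leaves room for
all members. -/
theorem RankInv.init {K : List ℕ} {r : ℕ → ℕ} (h0 : ∀ a, a ∉ K → r a = 0)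
    (h1 : ∀ a ∈ K, r a = K.length) : RankInv N K [] r := by
  have hmem : ∀ u, u ∈ K.toFinset \ ([] : List ℕ).toFinset → u ∈ K := fun u hu => by simpa using hu
  refine ⟨fun a ha => h0 a (by simpa using ha), fun _ _ _ _ _ e he => by simp at he, ?_, ?_, ?_⟩
  · intro u hu w hw h
    rw [h1 u (hmem u hu), h1 w (hmem w hw)] at h
    omega
  · intro u hu w hw h
    rw [h1 u (hmem u hu), h1 w (hmem w hw)] at h
    omega
  · intro u hu
    rw [h1 u (hmem u hu)]
    refine (Finset.card_filter_le _ _).trans ?_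
    simpa using K.toFinset_card_le

theorem RankInv.not_beats {K o : List ℕ} {r : ℕ → ℕ} (h : RankInv N K o r) {u v : ℕ}
    (hu : u ∈ K.toFinset \ o.toFinset) (hv : v ∈ K.toFinset \ o.toFinset) (huv : r u ≤ r v) :
    ¬ Beats N o u v := by
  rcases huv.lt_or_eq with h1 | h1
  · exact (h.beats v hv u hu h1).asymm
  · exact fun hb => hb.not_twins (h.twins u hu v hv h1)

/-- A class of `k` unvisited vertices with rank `t` has the ranks from `t - k + 1` to `t` to itself.
When `v` is visited, the neighbours of `v` in the class, `a` in number, keep the rank `t` and the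
others move to `t - a`. So each class is split with the neighbours on top, both parts have room
again, and no renumbering is needed. -/
theorem RankInv.step {K o : List ℕ} {r r' : ℕ → ℕ} (h : RankInv N K o r) {v : ℕ}
    (h0 : ∀ a, a ∉ K.toFinset \ (o ++ [v]).toFinset → r' a = 0)
    (h1 : ∀ a ∈ K.toFinset \ (o ++ [v]).toFinset, a ∈ N v → r' a = r a)
    (h2 : ∀ a ∈ K.toFinset \ (o ++ [v]).toFinset, a ∉ N v → r' a = r a -
      ((K.toFinset \ (o ++ [v]).toFinset).filter fun x => x ∈ N v ∧ r x = r a).card) :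
    RankInv N K (o ++ [v]) r' := by
  set U := K.toFinset \ o.toFinset with hU
  set U' := K.toFinset \ (o ++ [v]).toFinset with hU'
  have hsub : U' ⊆ U := by
    intro x hx
    simp only [hU, hU', Finset.mem_sdiff, List.mem_toFinset, List.mem_append] at hx ⊢
    tauto
  set cls : ℕ → ℕ := fun t => (U.filter fun x => r x = t).card with hcls
  set adj : ℕ → ℕ := fun t => (U'.filter fun x => x ∈ N v ∧ r x = t).card with hadj
  set non : ℕ → ℕ := fun t => (U'.filter fun x => x ∉ N v ∧ r x = t).card with hnon
  have hsum : ∀ t, adj t + non t ≤ cls t := by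
    intro t
    simp only [hadj, hnon, hcls]
    rw [← Finset.card_union_of_disjoint]
    · apply Finset.card_le_card
      intro x hx
      simp only [Finset.mem_union, Finset.mem_filter] at hx ⊢
      rcases hx with hx | hx <;> exact ⟨hsub hx.1, hx.2.2⟩
    · rw [Finset.disjoint_left]
      intro x hx hx'
      simp only [Finset.mem_filter] at hx hx'
      exact hx'.2.1 hx.2.1
  have hadjpos : ∀ a ∈ U', a ∈ N v → 1 ≤ adj (r a) := fun a ha hav =>
    Finset.card_pos.2 ⟨a, by simp [ha, hav]⟩
  have hnonpos : ∀ a ∈ U', a ∉ N v → 1 ≤ non (r a) := fun a ha hav =>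
    Finset.card_pos.2 ⟨a, by simp [ha, hav]⟩
  have hpos : ∀ a ∈ U', cls (r a) ≤ r a := fun a ha => h.pos a (hsub ha)
  have hgap : ∀ u ∈ U', ∀ w ∈ U', r w < r u → r w + cls (r u) ≤ r u := fun u hu w hw =>
    h.gap u (hsub hu) w (hsub hw)
  replace h2 : ∀ a ∈ U', a ∉ N v → r' a = r a - adj (r a) := h2
  have hle : ∀ a ∈ U', r' a ≤ r a := by
    intro a ha
    by_cases hav : a ∈ N v
    · rw [h1 a ha hav]
    · rw [h2 a ha hav]; omega
  -- comparison of the new ranks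
  have hlow : ∀ a ∈ U', r a < r' a + cls (r a) := by
    intro a ha
    have := hpos a ha
    have := hsum (r a)
    by_cases hav : a ∈ N v
    · rw [h1 a ha hav]
      have := hadjpos a ha hav
      omega
    · rw [h2 a ha hav]
      have := hnonpos a ha hav
      omega
  have hmono : ∀ u ∈ U', ∀ w ∈ U', r w < r u → r' w < r' u := by
    intro u hu w hw hwu
    have := hle w hw
    have := hgap u hu w hw hwu
    have := hlow u hu
    omega
  have hcase : ∀ u ∈ U', ∀ w ∈ U', r' u = r' w → r u = r w ∧ (u ∈ N v ↔ w ∈ N v) := by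
    intro u hu w hw huw
    have e : r u = r w := by
      by_contra hne
      rcases Nat.lt_or_gt_of_ne hne with hlt | hlt
      · have := hmono w hw u hu hlt; omega
      · have := hmono u hu w hw hlt; omega
    refine ⟨e, ?_⟩
    have b1 := hpos u hu
    have b2 := hsum (r u)
    by_cases hu1 : u ∈ N v <;> by_cases hw1 : w ∈ N v
    · simp [hu1, hw1]
    · have := hadjpos u hu hu1
      rw [h1 u hu hu1, h2 w hw hw1, ← e] at huw
      omega
    · have := hadjpos w hw hw1
      rw [h1 w hw hw1, h2 u hu hu1, ← e] at huw
      rw [← e] at this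
      omega
    · simp [hu1, hw1]
  have hcls' : ∀ u ∈ U', (u ∈ N v → (U'.filter fun x => r' x = r' u).card ≤ adj (r u)) ∧
      (u ∉ N v → (U'.filter fun x => r' x = r' u).card ≤ non (r u)) := by
    intro u hu
    constructor <;>
    · intro huv
      apply Finset.card_le_card
      intro x hx
      simp only [Finset.mem_filter] at hx ⊢
      obtain ⟨hx1, hx2⟩ := hcase x hx.1 u hu hx.2
      tauto
  refine ⟨h0, ?_, ?_, ?_, ?_⟩
  · intro u hu w hw huw e he
    obtain ⟨e1, e2⟩ := hcase u hu w hw huw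
    rcases List.mem_append.1 he with he | he
    · exact h.twins u (hsub hu) w (hsub hw) e1 e he
    · rw [List.mem_singleton] at he
      rw [he]; exact e2
  · intro u hu w hw hwu
    rcases lt_trichotomy (r w) (r u) with hlt | heq | hlt
    · exact (h.beats u (hsub hu) w (hsub hw) hlt).append [v]
    · have htw := h.twins u (hsub hu) w (hsub hw) heq.symm
      by_cases hu1 : u ∈ N v <;> by_cases hw1 : w ∈ N v
      · rw [h1 u hu hu1, h1 w hw hw1] at hwu; omega
      · exact Beats.of_twins htw hu1 hw1
      · rw [h2 u hu hu1, h1 w hw hw1] at hwu; omega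
      · rw [h2 u hu hu1, h2 w hw hw1, heq] at hwu; omega
    · have := hmono w hw u hu hlt; omega
  · intro u hu w hw hwu
    change r' w + (U'.filter fun x => r' x = r' u).card ≤ r' u
    have b1 := hpos u hu
    have b2 := hsum (r u)
    have b3 := hle w hw
    have b4 := hcls' u hu
    rcases lt_trichotomy (r w) (r u) with hlt | heq | hlt
    · have b5 := hgap u hu w hw hlt
      by_cases hu1 : u ∈ N v
      · have := b4.1 hu1
        rw [h1 u hu hu1] at this ⊢
        omega
      · have := b4.2 hu1
        rw [h2 u hu hu1] at this ⊢
        omega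
    · by_cases hu1 : u ∈ N v <;> by_cases hw1 : w ∈ N v
      · rw [h1 u hu hu1, h1 w hw hw1] at hwu; omega
      · have := b4.1 hu1
        rw [h1 u hu hu1] at this ⊢
        rw [h2 w hw hw1, heq]
        omega
      · rw [h2 u hu hu1, h1 w hw hw1] at hwu; omega
      · rw [h2 u hu hu1, h2 w hw hw1, heq] at hwu; omega
    · have := hmono w hw u hu hlt; omega
  · intro u hu
    change (U'.filter fun x => r' x = r' u).card ≤ r' u
    have b1 := hpos u hu
    have b2 := hsum (r u)
    have b4 := hcls' u hu
    by_cases hu1 : u ∈ N v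
    · have := b4.1 hu1
      rw [h1 u hu hu1] at this ⊢
      omega
    · have := b4.2 hu1
      rw [h2 u hu hu1] at this ⊢
      omega

end Ranks

namespace RAM

theorem Runs.block' {l : List Instr} {s : State} {T : ℕ} {Q : State → Prop}
    (hQ : ∀ s', s' = l.foldl (fun s i => i.run s) s → Q s') (hT : l.length + 1 ≤ T) :
    Runs (RAM.block l) s T Q :=
  Runs.block (hQ _ rfl) hT

theorem Runs.block_seq {l : List Instr} {q : Program} {s : State} {T₂ T : ℕ} {Q : State → Prop}
    (h : ∀ s', SameOutside (RAM.block l).locs s s' → s' = l.foldl (fun s i => i.run s) s →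
      Runs q s' T₂ Q) (hT : l.length + 1 + T₂ ≤ T) : Runs (.seq (RAM.block l) q) s T Q :=
  Runs.seq (T₁ := l.length + 1) (T₂ := T₂)
    (Runs.block' (fun s' hs' hsame => h s' hsame hs') le_rfl) hT

/-! ### Lexicographic breadth-first search

The vertices to be searched are in array `2`, their number in register `1`. Array `3` holds the
ranks, array `6` the marks of the neighbours of the current vertex, array `7` the ordering and array
`8` the positions in it, counted from `1`. -/

/-- Register `14` becomes an unvisited vertex of maximum rank. -/
def selectMax : Program :=
  forEach 11 1 12 2 (.seq (block [.load 15 3 12])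
    (.cond (.lt 13 15) (block [.copy 14 12, .copy 13 15]) .skip))

/-- Register `3` is constantly `0`, so the visited vertex gets rank `0` and drops out of the
competition. Incrementing register `2` opens a new stamp for array `6`, which makes all old marks
invalid without clearing them. -/
def visit : Program :=
  block [.store 3 14 3, .store 7 10 14, .copy 15 10, .inc 15, .store 8 14 15, .inc 2, .const 11 0]

/-- Each rank in use becomes its own count. After `countNbrs` has subtracted the neighbours found at
a rank, its count is the new rank of the non-neighbours. -/
def resetCounts : Program := forEach 11 1 12 2 (block [.load 15 3 12, .store 5 15 15])

/-- Mark the neighbours of the vertex in register `14` and count them at their ranks. -/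
def countNbrs : Program :=
  nbrLoop 11 17 12 14
    (block [.store 6 12 2, .load 15 3 12, .load 16 5 15, .dec 16, .store 5 15 16])

def updateRanks : Program :=
  forEach 11 1 12 2 (.seq (block [.load 15 6 12, .load 16 3 12, .load 16 5 16])
    (.cond (.eq 15 2) .skip (block [.store 3 12 16])))

def lexStep : Program :=
  .seq (block [.const 11 0, .const 13 0]) (.seq selectMax (.seq visit (.seq resetCounts
    (.seq countNbrs (.seq (block [.const 11 0]) updateRanks)))))

def lexBFS : Program :=
  .seq (block [.const 11 0]) (.seq (forEach 11 1 12 2 (block [.store 3 12 1]))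
    (.seq (block [.const 10 0]) (forRange 10 1 lexStep)))

theorem selectMax_runs {K : List ℕ} {s : State} (h11 : s.reg 11 = 0) (h1 : s.reg 1 = K.length)
    (hK : Holds (s.arr 2) 0 K) (h13 : s.reg 13 = 0) :
    Runs selectMax s (K.length * 9 + 1) fun s' => (∀ a ∈ K, s.arr 3 a ≤ s'.reg 13) ∧
      (s'.reg 13 = 0 ∨ s'.reg 14 ∈ K ∧ s.arr 3 (s'.reg 14) = s'.reg 13) := by
  refine Runs.forEach K (fun l s' => (∀ a ∈ l, s.arr 3 a ≤ s'.reg 13) ∧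
      (s'.reg 13 = 0 ∨ s'.reg 14 ∈ l ∧ s.arr 3 (s'.reg 14) = s'.reg 13)) (fun _ => 6)
    (by decide) h11 (by simpa using h1) hK ?_ ?_ ?_ (by simp) (fun s' _ h => h)
  · intro l s' k h; simpa [Function.update_apply] using h
  · simp [h13]
  · intro l₁ v l₂ s₁ _ hs _ h12 hI
    refine Runs.block_seq (T₂ := 4) ?_ (by simp)
    intro s₂ _ e
    have e3 : s₂.reg 15 = s.arr 3 v := by
      simp [e, Instr.run, h12, hs.arr 3 (by decide)]
    have e12 : s₂.reg 12 = v := by simp [e, Instr.run, h12]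
    have e13 : s₂.reg 13 = s₁.reg 13 := by simp [e, Instr.run]
    have e14 : s₂.reg 14 = s₁.reg 14 := by simp [e, Instr.run]
    refine Runs.cond (T := 3) (fun hb => Runs.block' ?_ (by simp))
      (fun hb => Runs.skip ?_ (by omega)) (by omega)
    · rintro s₃ rfl
      simp only [Test.Holds, e13, e3] at hb
      simp only [List.foldl_cons, List.foldl_nil, Instr.run, Function.update_apply]
      simp only [e12, e3]
      refine ⟨?_, Or.inr ⟨by simp, by simp⟩⟩
      intro a ha
      rcases List.mem_append.1 ha with ha | ha
      · have := hI.1 a ha; simp; omega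
      · simp at ha; simp [ha]
    · simp only [Test.Holds, e13, e3] at hb
      rw [e13, e14]
      refine ⟨?_, hI.2.imp_right fun h => ⟨by simp [h.1], h.2⟩⟩
      intro a ha
      rcases List.mem_append.1 ha with ha | ha
      · exact hI.1 a ha
      · simp at ha; rw [ha]; omega

theorem resetCounts_runs {K : List ℕ} {s : State} (h11 : s.reg 11 = 0) (h1 : s.reg 1 = K.length)
    (hK : Holds (s.arr 2) 0 K) (h0 : s.arr 5 0 = 0) :
    Runs resetCounts s (K.length * 6 + 1) fun s' =>
      (∀ a ∈ K, s'.arr 5 (s.arr 3 a) = s.arr 3 a) ∧ s'.arr 5 0 = 0 := by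
  refine Runs.forEach K (fun l s' => (∀ a ∈ l, s'.arr 5 (s.arr 3 a) = s.arr 3 a) ∧ s'.arr 5 0 = 0)
    (fun _ => 3) (by decide) h11 (by simpa using h1) hK ?_ ?_ ?_ (by simp) (fun s' _ h => h)
  · intro l s' k h; exact ⟨h, h⟩
  · simp [h0]
  · intro l₁ v l₂ s₁ _ hs _ h12 hI
    refine Runs.block' ?_ (by simp)
    intro s₂ e
    have e5 : s₂.arr 5 = Function.update (s₁.arr 5) (s.arr 3 v) (s.arr 3 v) := by
      simp [e, Instr.run, h12, hs.arr 3 (by decide)]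
    rw [e5]
    refine ⟨fun a ha => ?_, ?_⟩
    · rw [Function.update_apply]
      split_ifs with h
      · exact h.symm
      · rcases List.mem_append.1 ha with ha | ha
        · exact hI.1 a ha
        · simp at ha; rw [ha] at h; exact absurd rfl h
    · rw [Function.update_apply]
      split_ifs with h
      · exact h.symm
      · exact hI.2

theorem countNbrs_runs {n v : ℕ} {N : ℕ → List ℕ} {w : ℕ → ℝ≥0} {s : State} (hs : Input n N w s)
    (hv : s.reg 14 = v) (hvn : v < n) :
    Runs countNbrs s ((N v).length * 9 + 6) fun s' =>
      (∀ t, s'.arr 5 t = s.arr 5 t - (N v).countP fun x => s.arr 3 x = t) ∧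
      ∀ a, s'.arr 6 a = if a ∈ N v then s.reg 2 else s.arr 6 a := by
  refine Runs.nbrLoop (fun l s' => (∀ t, s'.arr 5 t = s.arr 5 t - l.countP fun x => s.arr 3 x = t) ∧
      ∀ a, s'.arr 6 a = if a ∈ l then s.reg 2 else s.arr 6 a) 6 hs hv hvn (by decide) (by decide)
    ?_ ?_ ?_ (by simp) (fun s' _ h => h)
  · intro l s' k h; exact ⟨h, h, h⟩
  · simp
  · intro l₁ a l₂ s₁ _ hs₁ h12 hI
    refine Runs.block' ?_ (by simp)
    intro s₂ e
    have e5 : s₂.arr 5 = Function.update (s₁.arr 5) (s.arr 3 a) (s₁.arr 5 (s.arr 3 a) - 1) := by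
      simp [e, Instr.run, h12, hs₁.arr 3 (by decide)]
    have e6 : s₂.arr 6 = Function.update (s₁.arr 6) a (s.reg 2) := by
      simp [e, Instr.run, h12, hs₁.reg 2 (by decide)]
    rw [e5, e6]
    refine ⟨fun t => ?_, fun b => ?_⟩
    · rw [Function.update_apply, List.countP_append, List.countP_singleton]
      split_ifs with h h' h'
      · rw [h, hI.1]; omega
      · simp [h] at h'
      · simp at h'; exact absurd h'.symm h
      · rw [hI.1]; omega
    · rw [Function.update_apply]
      by_cases hb : b = a
      · simp [hb]
      · rw [if_neg hb, hI.2 b]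
        simp [hb]

theorem updateRanks_runs {K : List ℕ} {s : State} (h11 : s.reg 11 = 0) (h1 : s.reg 1 = K.length)
    (hK : Holds (s.arr 2) 0 K) (hKn : K.Nodup) :
    Runs updateRanks s (K.length * 10 + 1) fun s' =>
      ∀ a, s'.arr 3 a = if a ∈ K ∧ s.arr 6 a ≠ s.reg 2 then s.arr 5 (s.arr 3 a) else s.arr 3 a := by
  refine Runs.forEach K (fun l s' => ∀ a, s'.arr 3 a =
      if a ∈ l ∧ s.arr 6 a ≠ s.reg 2 then s.arr 5 (s.arr 3 a) else s.arr 3 a)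
    (fun _ => 7) (by decide) h11 (by simpa using h1) hK ?_ ?_ ?_ (by simp) (fun s' _ h => h)
  · intro l s' k h; exact ⟨h, h⟩
  · simp
  · intro l₁ v l₂ s₁ hl hs _ h12 hI
    -- No vertex is treated twice, so the rank read here is still the old one.
    have hvl : v ∉ l₁ := by
      rw [hl, List.nodup_append] at hKn
      exact fun hv => hKn.2.2 v hv v (by simp) rfl
    have hv3 : s₁.arr 3 v = s.arr 3 v := by rw [hI, if_neg (by simp [hvl])]
    refine Runs.block_seq (T₂ := 3) ?_ (by simp)
    intro s₂ _ e
    have e15 : s₂.reg 15 = s.arr 6 v := by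
      simp [e, Instr.run, h12, hs.arr 6 (by decide)]
    have e16 : s₂.reg 16 = s.arr 5 (s.arr 3 v) := by
      simp [e, Instr.run, h12, hs.arr 5 (by decide), hv3]
    have e12 : s₂.reg 12 = v := by simp [e, Instr.run, h12]
    have e2 : s₂.reg 2 = s.reg 2 := by simp [e, Instr.run, hs.reg 2 (by decide)]
    have e3 : s₂.arr 3 = s₁.arr 3 := by simp [e, Instr.run]
    refine Runs.cond (T := 2) (fun hb => Runs.skip ?_ (by omega))
      (fun hb => Runs.block' ?_ (by simp)) (by omega)
    · simp only [Test.Holds, e15, e2] at hb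
      intro a
      rw [e3, hI a]
      by_cases ha : a = v
      · subst ha; simp [hb]
      · simp [ha]
    · rintro s₃ rfl
      simp only [Test.Holds, e15, e2] at hb
      intro a
      simp only [List.foldl_cons, List.foldl_nil, Instr.run, Function.update_self]
      rw [Function.update_apply, e12, e16, e3]
      by_cases ha : a = v
      · subst ha; simp [hb]
      · rw [if_neg ha, hI a]; simp [ha]

/-- What `lexBFS` needs, and what holds again afterwards. -/
structure LexReady (s : State) : Prop where
  rank : ∀ a, s.arr 3 a = 0
  count : s.arr 5 0 = 0
  mark : ∀ a, s.arr 6 a ≤ s.reg 2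

/-- The result of `lexBFS`. -/
structure LexDone (N : ℕ → List ℕ) (K O : List ℕ) (s : State) : Prop where
  ready : LexReady s
  perm : O.Perm K
  lex : LexList N O
  order : Holds (s.arr 7) 0 O
  num : ∀ a, s.arr 8 a = if a ∈ O then O.idxOf a + 1 else 0

/-- The state after the visit of the vertices `o`. -/
structure LexState (N : ℕ → List ℕ) (K o : List ℕ) (s : State) : Prop where
  nodup : o.Nodup
  sub : ∀ a ∈ o, a ∈ K
  rank : RankInv N K o (s.arr 3)
  lex : LexPrefix N K o
  order : Holds (s.arr 7) 0 o
  num : ∀ a, s.arr 8 a = if a ∈ o then o.idxOf a + 1 else 0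
  count : s.arr 5 0 = 0
  mark : ∀ a, s.arr 6 a ≤ s.reg 2

/-- A vertex of maximum rank is beaten by no unvisited vertex (`RankInv.not_beats`), so it may be
visited. The four passes run over `K` and over the neighbours of this vertex, which takes time
linear in `n`. -/
theorem lexStep_runs {n : ℕ} {N : ℕ → List ℕ} {w : ℕ → ℝ≥0} (hN : IsNbrs n N) {K o : List ℕ}
    {s : State} (hs : Input n N w s) (hKn : K.Nodup) (hK : ∀ a ∈ K, a < n)
    (h1 : s.reg 1 = K.length) (hKarr : Holds (s.arr 2) 0 K) (ho : LexState N K o s)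
    (h10 : s.reg 10 = o.length) (hlt : o.length < K.length) :
    Runs lexStep s (100 * n) fun s' => ∃ v, LexState N K (o ++ [v]) s' := by
  have hKlen : K.length ≤ n := by
    have : K.toFinset ⊆ Finset.range n := fun u hu => by
      simpa using hK u (List.mem_toFinset.1 hu)
    simpa [List.toFinset_card_of_nodup hKn] using Finset.card_le_card this
  refine Runs.block_seq (T₂ := 100 * n - 3) ?_ (by simp; omega)
  intro s₁ f₁ e₁
  have f₁' := f₁
  refine Runs.seq (T₁ := K.length * 9 + 1) (T₂ := 100 * n - 3 - (K.length * 9 + 1))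
    (Runs.mono (selectMax_runs (K := K) (by simp [e₁, Instr.run])
      (by rw [f₁.reg 1 (by decide), h1]) (by rw [f₁.arr 2 (by decide)]; exact hKarr)
      (by simp [e₁, Instr.run])) le_rfl ?_) (by omega)
  rintro s₂ f₂ ⟨hmax, hbest⟩ -
  have g₂ := (f₁.mono (l' := lexStep.locs) (by decide)).trans (f₂.mono (by decide))
  have r₁ : s₁.arr 3 = s.arr 3 := f₁.arr 3 (by decide)
  rw [r₁] at hmax hbest
  set U := K.toFinset \ o.toFinset with hU
  have hUne : U.Nonempty := by
    rw [hU, Finset.sdiff_nonempty]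
    intro hsub
    have := Finset.card_le_card hsub
    rw [List.toFinset_card_of_nodup hKn, List.toFinset_card_of_nodup ho.nodup] at this
    omega
  obtain ⟨v, hv14⟩ : ∃ v, s₂.reg 14 = v := ⟨_, rfl⟩
  -- Unvisited vertices of `K` have positive rank and all others rank `0`, so the maximum is
  -- attained at an unvisited vertex.
  have hvU : v ∈ U ∧ ∀ u ∈ U, s.arr 3 u ≤ s.arr 3 v := by
    obtain ⟨u, hu⟩ := hUne
    have h1 := ho.rank.one_le hu
    have h2 := hmax u (by simp [hU] at hu; exact hu.1)
    rcases hbest with hb | ⟨hb1, hb2⟩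
    · omega
    rw [hv14] at hb1 hb2
    refine ⟨?_, fun u hu => ?_⟩
    · by_contra hvU
      have := ho.rank.zero v hvU
      omega
    · rw [hb2]; exact hmax u (by simp [hU] at hu; exact hu.1)
  obtain ⟨hvU, hvmax⟩ := hvU
  have hvK : v ∈ K ∧ v ∉ o := by simpa [hU] using hvU
  have hvn := hK v hvK.1
  refine Runs.block_seq (T₂ := 100 * n - 3 - (K.length * 9 + 1) - 8) ?_ (by simp; omega)
  intro s₃ f₃ e₃
  have g₃ := g₂.trans (f₃.mono (l' := lexStep.locs) (by decide))
  have a3 : s₃.arr 3 = Function.update (s.arr 3) v 0 := by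
    have : s₂.arr 3 = s.arr 3 := by rw [f₂.arr 3 (by decide), r₁]
    have z : s₂.reg 3 = 0 := by rw [g₂.reg 3 (by decide), hs.zero]
    simp [e₃, Instr.run, hv14, this, z]
  have a7 : s₃.arr 7 = Function.update (s.arr 7) o.length v := by
    simp [e₃, Instr.run, hv14, f₂.arr 7 (by decide), f₁.arr 7 (by decide),
      f₂.reg 10 (by decide), f₁.reg 10 (by decide), h10]
  have a8 : s₃.arr 8 = Function.update (s.arr 8) v (o.length + 1) := by
    simp [e₃, Instr.run, hv14, f₂.arr 8 (by decide), f₁.arr 8 (by decide),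
      f₂.reg 10 (by decide), f₁.reg 10 (by decide), h10]
  have a2 : s₃.reg 2 = s.reg 2 + 1 := by
    simp [e₃, Instr.run, f₂.reg 2 (by decide), f₁.reg 2 (by decide)]
  have a5 : s₃.arr 5 = s.arr 5 := by
    simp [e₃, Instr.run, f₂.arr 5 (by decide), f₁.arr 5 (by decide)]
  have a6 : s₃.arr 6 = s.arr 6 := by
    simp [e₃, Instr.run, f₂.arr 6 (by decide), f₁.arr 6 (by decide)]
  have a14 : s₃.reg 14 = v := by simp [e₃, Instr.run, hv14]
  refine Runs.seq (T₁ := K.length * 6 + 1)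
    (T₂ := 100 * n - 3 - (K.length * 9 + 1) - 8 - (K.length * 6 + 1))
    (Runs.mono (resetCounts_runs (K := K) (by simp [e₃, Instr.run])
      (by rw [g₃.reg 1 (by decide), h1]) (by rw [g₃.arr 2 (by decide)]; exact hKarr)
      (by rw [a5, ho.count])) le_rfl ?_) (by omega)
  rintro s₄ f₄ ⟨hcnt, hcnt0⟩ -
  have g₄ := g₃.trans (f₄.mono (l' := lexStep.locs) (by decide))
  have hlen := hN.length_le v
  refine Runs.seq (T₁ := (N v).length * 9 + 6)
    (T₂ := 100 * n - 3 - (K.length * 9 + 1) - 8 - (K.length * 6 + 1) - ((N v).length * 9 + 6))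
    (Runs.mono (countNbrs_runs (hs.same g₄ (by decide)) (by rw [f₄.reg 14 (by decide), a14]) hvn)
      le_rfl ?_) (by omega)
  rintro s₅ f₅ ⟨hacc, hmark⟩ -
  have g₅ := g₄.trans (f₅.mono (l' := lexStep.locs) (by decide))
  refine Runs.block_seq (T₂ := K.length * 10 + 1) ?_ (by simp; omega)
  intro s₆ f₆ e₆
  have g₆ := g₅.trans (f₆.mono (l' := lexStep.locs) (by decide))
  refine Runs.mono (updateRanks_runs (K := K) (by simp [e₆, Instr.run])
      (by rw [g₆.reg 1 (by decide), h1]) (by rw [g₆.arr 2 (by decide)]; exact hKarr) hKn)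
      le_rfl ?_
  intro s₇ f₇ hr
  -- the contents of the arrays in terms of the first state
  have b3 : s₆.arr 3 = Function.update (s.arr 3) v 0 := by
    rw [f₆.arr 3 (by decide), f₅.arr 3 (by decide), f₄.arr 3 (by decide), a3]
  have b2 : s₆.reg 2 = s.reg 2 + 1 := by
    rw [f₆.reg 2 (by decide), f₅.reg 2 (by decide), f₄.reg 2 (by decide), a2]
  have b6 : ∀ a, s₆.arr 6 a = if a ∈ N v then s.reg 2 + 1 else s.arr 6 a := by
    intro a
    rw [f₆.arr 6 (by decide), hmark, f₄.reg 2 (by decide), a2, f₄.arr 6 (by decide), a6]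
  have b6' : ∀ a, s₆.arr 6 a ≠ s₆.reg 2 ↔ a ∉ N v := by
    intro a
    have := ho.mark a
    rw [b6, b2]
    by_cases ha : a ∈ N v
    · simp [ha]
    · simp [ha]; omega
  have b5 : ∀ t, s₆.arr 5 t = s₄.arr 5 t - (N v).countP fun x => Function.update (s.arr 3) v 0 x = t := by
    intro t
    rw [f₆.arr 5 (by decide), hacc, f₄.arr 3 (by decide), a3]
  have hmemU' : ∀ a, a ∈ K.toFinset \ (o ++ [v]).toFinset ↔ a ∈ U ∧ a ≠ v := by
    intro a; simp [hU]; tauto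
  simp only [b6', b3] at hr
  refine ⟨v, ?_, ?_, ?_, ?_, ?_, ?_, ?_, ?_⟩
  · rw [List.nodup_append]
    refine ⟨ho.nodup, by simp, fun a ha b hb => ?_⟩
    rw [List.mem_singleton] at hb
    rintro rfl
    exact hvK.2 (hb ▸ ha)
  · intro a ha
    rcases List.mem_append.1 ha with ha | ha
    · exact ho.sub a ha
    · rw [List.mem_singleton] at ha; rw [ha]; exact hvK.1
  · apply ho.rank.step
    · intro a ha
      rw [hmemU'] at ha
      have hz : Function.update (s.arr 3) v 0 a = 0 := by
        by_cases hav : a = v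
        · simp [hav]
        · rw [Function.update_of_ne hav]
          exact ho.rank.zero a (fun hh => ha ⟨hh, hav⟩)
      rw [hr, hz, b5, hcnt0]
      simp
    · intro a ha hav
      rw [hmemU'] at ha
      rw [hr, if_neg (by simp [hav]), Function.update_of_ne ha.2]
    · intro a ha hav
      have ha' := (hmemU' a).1 ha
      have haK : a ∈ K := by have := ha'.1; simp [hU] at this; exact this.1
      have hra : Function.update (s.arr 3) v 0 a = s.arr 3 a := Function.update_of_ne ha'.2 _ _
      have hc := hcnt a haK
      rw [a3, hra] at hc
      rw [hr, if_pos ⟨haK, hav⟩, hra, b5, hc]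
      congr 1
      -- The machine counts all neighbours of `v` at the rank of `a`. Those that are visited or
      -- outside `K` have rank `0` and do not contribute, because the rank of `a` is positive.
      rw [List.countP_eq_length_filter, ← List.toFinset_card_of_nodup ((hN.nodup v).filter _)]
      congr 1
      ext x
      simp only [List.mem_toFinset, List.mem_filter, decide_eq_true_eq, Finset.mem_filter, hmemU']
      have h1 := ho.rank.one_le ha'.1
      constructor
      · rintro ⟨hx, hx'⟩
        by_cases hxv : x = v
        · rw [hxv, Function.update_self] at hx'; omega
        · rw [Function.update_of_ne hxv] at hx'
          refine ⟨⟨?_, hxv⟩, hx, hx'⟩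
          by_contra hxU
          have := ho.rank.zero x hxU
          omega
      · rintro ⟨⟨hxU, hxv⟩, hx, hx'⟩
        exact ⟨hx, by rw [Function.update_of_ne hxv, hx']⟩
  · apply ho.lex.snoc
    intro y hy hyo
    have hyU : y ∈ U := by simp [hU, hy, hyo]
    exact ho.rank.not_beats hyU hvU (hvmax y hyU)
  · rw [f₇.arr 7 (by decide), f₆.arr 7 (by decide), f₅.arr 7 (by decide), f₄.arr 7 (by decide), a7]
    exact ho.order.snoc
  · intro a
    rw [f₇.arr 8 (by decide), f₆.arr 8 (by decide), f₅.arr 8 (by decide), f₄.arr 8 (by decide), a8]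
    by_cases hav : a = v
    · subst hav
      rw [Function.update_self, if_pos (by simp), List.idxOf_append_of_notMem hvK.2]
      simp
    · rw [Function.update_of_ne hav, ho.num a]
      by_cases hao : a ∈ o
      · rw [if_pos hao, if_pos (by simp [hao]), List.idxOf_append_of_mem hao]
      · rw [if_neg hao, if_neg (by simp [hao, hav])]
  -- Neighbours of rank `0` decrement the count at `0`, which stays `0` by truncation.
  · rw [f₇.arr 5 (by decide), b5, hcnt0]; simp
  · intro a
    rw [f₇.arr 6 (by decide), f₇.reg 2 (by decide), b6, b2]
    have := ho.mark a
    split_ifs <;> omega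

theorem lexBFS_runs {n : ℕ} {N : ℕ → List ℕ} {w : ℕ → ℝ≥0} (hN : IsNbrs n N) {K : List ℕ}
    {s : State} (hs : Input n N w s) (hKn : K.Nodup) (hK : ∀ a ∈ K, a < n)
    (h1 : s.reg 1 = K.length) (hKarr : Holds (s.arr 2) 0 K) (hready : LexReady s)
    (hnum : ∀ a, s.arr 8 a = 0) :
    Runs lexBFS s (120 * (K.length * n) + 10) fun s' => ∃ O, LexDone N K O s' := by
  have hKlen : K.length ≤ K.length * n := by
    cases K with
    | nil => simp
    | cons a K => exact Nat.le_mul_of_pos_right _ (by have := hK a (by simp); omega)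
  refine Runs.block_seq (T₂ := 120 * (K.length * n) + 8) ?_ (by simp; omega)
  intro s₁ f₁ e₁
  refine Runs.seq (T₁ := K.length * 5 + 1) (T₂ := 102 * (K.length * n) + 5)
    (Runs.forEach K (fun l s' => ∀ a, s'.arr 3 a = if a ∈ l then K.length else 0) (fun _ => 2)
      (by decide) (by simp [e₁, Instr.run] : s₁.reg 11 = 0)
      (by rw [f₁.reg 1 (by decide), h1, zero_add]) (by rw [f₁.arr 2 (by decide)]; exact hKarr)
      (fun l s' k h => ⟨h, h⟩) (fun a => by simp [f₁.arr 3 (by decide), hready.rank]) ?_ (by simp)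
      ?_) (by omega)
  · intro l₁ v l₂ s₂ _ f₂ _ h12 hI
    refine Runs.block' ?_ (by simp)
    rintro s₃ rfl a
    have : s₂.reg 1 = K.length := by rw [f₂.reg 1 (by decide), f₁.reg 1 (by decide), h1]
    simp only [List.foldl_cons, List.foldl_nil, Instr.run, Function.update_self, h12, this]
    by_cases hav : a = v
    · simp [hav]
    · rw [Function.update_of_ne hav, hI]; simp [hav]
  · intro s₂ f₂ hr f₂'
    have g₂ := (f₁.mono (l' := lexBFS.locs) (by decide)).trans (f₂.mono (by decide))
    refine Runs.block_seq (T₂ := 102 * (K.length * n) + 3) ?_ (by simp; omega)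
    intro s₃ f₃ e₃
    have g₃ := g₂.trans (f₃.mono (l' := lexBFS.locs) (by decide))
    refine Runs.forRange (fun t s' => ∃ o, o.length = t ∧ LexState N K o s')
      (fun _ => 100 * n) (by decide) (by simp [e₃, Instr.run] : s₃.reg 10 = 0)
      (by rw [g₃.reg 1 (by decide), h1] : s₃.reg 1 = K.length) (by omega) ?_ ?_ ?_ ?_ ?_
    · rintro t s' k ⟨o, ho, h⟩
      exact ⟨o, ho, ⟨h.nodup, h.sub, h.rank, h.lex, h.order, h.num, h.count, by
        simpa [Function.update_apply] using h.mark⟩⟩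
    · refine ⟨[], rfl, ⟨by simp, by simp, ?_, ?_, ?_, ?_, ?_, ?_⟩⟩
      · rw [f₃.arr 3 (by decide)]
        exact RankInv.init (fun a ha => by rw [hr, if_neg ha]) (fun a ha => by rw [hr, if_pos ha])
      · intro p x q hpq; simp at hpq
      · intro j hj; simp at hj
      · intro a
        rw [f₃.arr 8 (by decide), f₂.arr 8 (by decide), f₁.arr 8 (by decide), hnum]
        simp
      · rw [f₃.arr 5 (by decide), f₂.arr 5 (by decide), f₁.arr 5 (by decide), hready.count]
      · intro a
        rw [f₃.arr 6 (by decide), f₂.arr 6 (by decide), f₁.arr 6 (by decide),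
          f₃.reg 2 (by decide), f₂.reg 2 (by decide), f₁.reg 2 (by decide)]
        exact hready.mark a
    · rintro t s' - ht f₄ h10 ⟨o, ho, hst⟩
      have g₄ := g₃.trans (f₄.mono (l' := lexBFS.locs) (by decide))
      refine Runs.mono (lexStep_runs hN (hs.same g₄ (by decide)) hKn hK
        (by rw [g₄.reg 1 (by decide), h1]) (by rw [g₄.arr 2 (by decide)]; exact hKarr) hst
        (by rw [h10, ho]) (by omega)) le_rfl ?_
      rintro s'' - ⟨v, hv⟩
      exact ⟨o ++ [v], by simp [ho], hv⟩
    · rw [Finset.sum_const, Nat.card_Ico, smul_eq_mul, Nat.sub_zero]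
      have : K.length * (100 * n + 2) = 100 * (K.length * n) + 2 * K.length := by ring
      omega
    · rintro s' - - ⟨o, ho, hst⟩
      have hsub : o.toFinset ⊆ K.toFinset := fun a ha => by
        simpa using hst.sub a (List.mem_toFinset.1 ha)
      have heq : o.toFinset = K.toFinset := Finset.eq_of_subset_of_card_le hsub (by
        rw [List.toFinset_card_of_nodup hKn, List.toFinset_card_of_nodup hst.nodup, ho])
      refine ⟨o, ⟨⟨fun a => ?_, hst.count, hst.mark⟩, ?_, ?_, hst.order, hst.num⟩⟩
      -- Everything has been visited, so the array of ranks is zero again and ready for the next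
      -- search.
      · exact hst.rank.zero a (by rw [heq]; simp)
      · rw [List.perm_ext_iff_of_nodup hst.nodup hKn]
        intro a
        rw [← List.mem_toFinset, heq, List.mem_toFinset]
      · exact hst.lex.lexList hst.sub hst.nodup

end RAM

/-! ### Isolated vertices and initial segments in a lexicographic search. -/

theorem Beats.mem {N : ℕ → List ℕ} {o : List ℕ} {u w : ℕ} (h : Beats N o u w) :
    ∃ d ∈ o, u ∈ N d := by
  obtain ⟨p, d, q, rfl, -, h, -⟩ := h
  exact ⟨d, by simp, h⟩

theorem Beats.of_append {N : ℕ → List ℕ} {i o : List ℕ} (hi : ∀ d ∈ i, N d = []) {u w : ℕ}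
    (h : Beats N (i ++ o) u w) : Beats N o u w := by
  obtain ⟨p, d, q, h, h0, h1, h2⟩ := h
  rcases List.append_eq_append_iff.1 h with ⟨a, rfl, rfl⟩ | ⟨a, rfl, ha⟩
  · exact ⟨a, d, q, rfl, fun e he => h0 e (by simp [he]), h1, h2⟩
  · cases a with
    | nil => exact ⟨[], d, q, ha.symm, by simp, h1, h2⟩
    | cons b a =>
      simp at ha
      rw [ha.1, hi b (by simp)] at h1
      simp at h1

/-- Isolated vertices contribute to no label. In front of the ordering they change no comparison,
and nothing can beat them while all labels are empty. -/
theorem LexList.append_isolated {N : ℕ → List ℕ} {i o : List ℕ} (hi : ∀ d ∈ i, N d = [])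
    (ho : LexList N o) : LexList N (i ++ o) := by
  intro p x q h y hy hb
  rcases List.append_eq_append_iff.1 h with ⟨a, rfl, rfl⟩ | ⟨a, rfl, ha⟩
  · exact ho a x q rfl y hy (Beats.of_append hi hb)
  · obtain ⟨d, hd, hyd⟩ := hb.mem
    rw [hi d (by simp [hd])] at hyd
    simp at hyd

theorem LexList.of_append {N : ℕ → List ℕ} {o o' : List ℕ} (h : LexList N (o ++ o')) :
    LexList N o := by
  rintro p x q rfl y hy
  exact h p x (q ++ o') (by simp) y (by simp [hy])

namespace RAM

/-! ### The ordering of the vertices -/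

theorem sameOutside_update (s : State) (x k : ℕ) :
    SameOutside [(0, x)] s { s with reg := Function.update s.reg x k } := by
  constructor <;> intros <;> simp_all

/-- The list `o` is stored in array `12`, with its length in register `7` and the positions, counted
from `1`, in array `13`. -/
structure OrderIs (o : List ℕ) (s : State) : Prop where
  len : s.reg 7 = o.length
  list : Holds (s.arr 12) 0 o
  pos : ∀ a ∈ o, s.arr 13 a = o.idxOf a + 1

theorem OrderIs.same {o : List ℕ} {s s' : State} {l : List (ℕ × ℕ)} (h : OrderIs o s)
    (hs : SameOutside l s s') (hl : ∀ x ∈ [(0, 7), (1, 12), (1, 13)], x ∉ l) : OrderIs o s' := by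
  refine ⟨?_, ?_, ?_⟩
  · rw [hs.reg 7 (hl _ (by simp))]; exact h.len
  · rw [hs.arr 12 (hl _ (by simp))]; exact h.list
  · rw [hs.arr 13 (hl _ (by simp))]; exact h.pos

theorem OrderIs.snoc {o : List ℕ} {s s' : State} (h : OrderIs o s) {v : ℕ} (hv : v ∉ o)
    (h7 : s'.reg 7 = s.reg 7 + 1) (h12 : s'.arr 12 = Function.update (s.arr 12) (s.reg 7) v)
    (h13 : s'.arr 13 = Function.update (s.arr 13) v (s.reg 7 + 1)) : OrderIs (o ++ [v]) s' := by
  refine ⟨by simp [h7, h.len], ?_, ?_⟩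
  · rw [h12, h.len]; exact h.list.snoc
  · intro a ha
    rw [h13]
    by_cases hav : a = v
    · subst hav
      rw [Function.update_self, List.idxOf_append_of_notMem hv, h.len]; simp
    · have hao : a ∈ o := by simpa [hav] using ha
      rw [Function.update_of_ne hav, h.pos a hao, List.idxOf_append_of_mem hao]

/-- Put the isolated vertices into the ordering and the other ones into array `2`. -/
def splitIsolated : Program :=
  forRange 20 0 (.seq (block [.load 24 0 20, .copy 25 20, .inc 25, .load 25 0 25])
    (.cond (.eq 24 25) (block [.store 12 7 20, .inc 7, .store 13 20 7])
      (block [.store 2 1 20, .inc 1])))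

/-- The cells of array `8` are cleared along the way, as the main loop expects them to be `0`. -/
def appendOrder : Program :=
  forEach 20 1 21 7 (block [.store 12 7 21, .inc 7, .store 13 21 7, .store 8 21 3])

/-- Searching all `n` vertices at `O(n)` per round would exceed `O(nm)` in sparse graphs. Only the
non-isolated vertices are searched, and there are at most `2m` of them. -/
def lexOrder : Program :=
  .seq (block [.const 1 0, .const 7 0, .const 20 0]) (.seq splitIsolated (.seq lexBFS
    (.seq (block [.const 20 0]) appendOrder)))

/-- The vertices below `j` are distributed to the lists `i` and `K`. -/
structure SplitState (N : ℕ → List ℕ) (j : ℕ) (i K : List ℕ) (s : State) : Prop where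
  perm : (i ++ K).Perm (List.range j)
  isolated : ∀ a ∈ i, N a = []
  nonempty : ∀ a ∈ K, N a ≠ []
  order : OrderIs i s
  len : s.reg 1 = K.length
  list : Holds (s.arr 2) 0 K

theorem SplitState.same {N : ℕ → List ℕ} {j : ℕ} {i K : List ℕ} {s s' : State}
    {l : List (ℕ × ℕ)} (h : SplitState N j i K s) (hs : SameOutside l s s')
    (hl : ∀ x ∈ [(0, 1), (1, 2), (0, 7), (1, 12), (1, 13)], x ∉ l) : SplitState N j i K s' := by
  refine ⟨h.perm, h.isolated, h.nonempty, h.order.same hs fun x hx => hl x ?_, ?_, ?_⟩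
  · simp at hx ⊢; tauto
  · rw [hs.reg 1 (hl _ (by simp))]; exact h.len
  · rw [hs.arr 2 (hl _ (by simp))]; exact h.list

theorem splitIsolated_runs {n : ℕ} {N : ℕ → List ℕ} {w : ℕ → ℝ≥0} {s : State}
    (hs : Input n N w s) (h1 : s.reg 1 = 0) (h7 : s.reg 7 = 0) (h20 : s.reg 20 = 0) :
    Runs splitIsolated s (20 * n + 1) fun s' => ∃ i K, SplitState N n i K s' := by
  refine Runs.forRange (fun j s' => ∃ i K, SplitState N j i K s') (fun _ => 10) (by decide) h20
    hs.size (by omega) ?_ ?_ ?_ (by simp; omega) (fun s' _ _ h => h)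
  · rintro j s' k ⟨i, K, h⟩
    exact ⟨i, K, h.same (sameOutside_update _ _ _) (by decide)⟩
  · exact ⟨[], [], by simp, by simp, by simp, ⟨h7, fun j hj => by simp at hj, by simp⟩, h1,
      fun j hj => by simp at hj⟩
  · rintro j s₁ - hj f₁ h20 ⟨i, K, h⟩
    have hs₁ := hs.same f₁ (by decide)
    have hmem : ∀ a ∈ i ++ K, a < j := fun a ha => by simpa using h.perm.mem_iff.1 ha
    refine Runs.block_seq (T₂ := 5) ?_ (by simp)
    intro s₂ f₂ e₂
    have hb : (Test.eq 24 25).Holds s₂ ↔ N j = [] := by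
      simp [e₂, Instr.run, Test.Holds, h20, hs₁.off j hj]
    have hh := h.same f₂ (by decide)
    have h20' : s₂.reg 20 = j := by rw [f₂.reg 20 (by decide), h20]
    refine Runs.cond (T := 4) (fun hc => Runs.block' ?_ (by simp))
      (fun hc => Runs.block' ?_ (by simp)) (by omega)
    · intro s₃ e₃
      rw [hb] at hc
      refine ⟨i ++ [j], K, ?_, ?_, hh.nonempty, ?_, ?_, ?_⟩
      · rw [List.range_succ, List.append_assoc]
        exact (List.perm_append_comm.append_left i).trans
          (by rw [← List.append_assoc]; exact h.perm.append_right [j])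
      · intro a ha
        rcases List.mem_append.1 ha with ha | ha
        · exact h.isolated a ha
        · rw [List.mem_singleton.1 ha]; exact hc
      · refine hh.order.snoc (fun hj' => ?_) ?_ ?_ ?_
        · exact absurd (hmem j (by simp [hj'])) (by omega)
        · simp [e₃, Instr.run]
        · simp [e₃, Instr.run, h20']
        · simp [e₃, Instr.run, h20']
      · simp [e₃, Instr.run, hh.len]
      · have := hh.list
        simpa [e₃, Instr.run] using this
    · intro s₃ e₃
      rw [hb] at hc
      refine ⟨i, K ++ [j], ?_, hh.isolated, ?_, ⟨?_, ?_, ?_⟩, ?_, ?_⟩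
      · rw [List.range_succ, ← List.append_assoc]
        exact h.perm.append_right [j]
      · intro a ha
        rcases List.mem_append.1 ha with ha | ha
        · exact h.nonempty a ha
        · rw [List.mem_singleton.1 ha]; exact hc
      · simp [e₃, Instr.run, hh.order.len]
      · have := hh.order.list
        simpa [e₃, Instr.run] using this
      · have := hh.order.pos
        simpa [e₃, Instr.run] using this
      · simp [e₃, Instr.run, hh.len]
      · have : s₃.arr 2 = Function.update (s₂.arr 2) K.length j := by
          simp [e₃, Instr.run, hh.len, h20']
        rw [this]
        exact hh.list.snoc

/-- What the main loop needs. -/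
structure Ready (s : State) : Prop where
  lex : LexReady s
  num : ∀ a, s.arr 8 a = 0

theorem length_le_sum {n : ℕ} {N : ℕ → List ℕ} {K : List ℕ} (hn : K.Nodup) (hK : ∀ a ∈ K, a < n)
    (hne : ∀ a ∈ K, N a ≠ []) : K.length ≤ ∑ v ∈ Finset.range n, (N v).length := by
  rw [← List.toFinset_card_of_nodup hn, Finset.card_eq_sum_ones]
  refine (Finset.sum_le_sum (g := fun v => (N v).length) fun a ha => ?_).trans
    (Finset.sum_le_sum_of_subset fun a ha => by simpa using hK a (List.mem_toFinset.1 ha))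
  exact List.length_pos_iff.2 (hne a (List.mem_toFinset.1 ha))

theorem lexOrder_runs {n : ℕ} {N : ℕ → List ℕ} {w : ℕ → ℝ≥0} (hN : IsNbrs n N) {s : State}
    (hs : Input n N w s) (hr : Ready s) :
    Runs lexOrder s (130 * (n * ∑ v ∈ Finset.range n, (N v).length) + 40 * n + 20) fun s' =>
      ∃ o, o.Perm (List.range n) ∧ LexList N o ∧ OrderIs o s' ∧ Ready s' := by
  set M := ∑ v ∈ Finset.range n, (N v).length with hM
  refine Runs.block_seq (T₂ := 130 * (n * M) + 40 * n + 16) ?_ (by simp; omega)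
  intro s₁ f₁ e₁
  have g₁ := f₁.mono (l' := lexOrder.locs) (by decide)
  refine Runs.seq (T₁ := 20 * n + 1) (T₂ := 130 * (n * M) + 20 * n + 15)
    (Runs.mono (splitIsolated_runs (hs.same f₁ (by decide)) (by simp [e₁, Instr.run])
      (by simp [e₁, Instr.run]) (by simp [e₁, Instr.run])) le_rfl ?_) (by omega)
  rintro s₂ f₂ ⟨i, K, h⟩ -
  have g₂ := g₁.trans (f₂.mono (l' := lexOrder.locs) (by decide))
  have hnd : (i ++ K).Nodup := h.perm.nodup_iff.2 List.nodup_range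
  have hKn : K.Nodup := (List.nodup_append.1 hnd).2.1
  have hlt : ∀ a ∈ K, a < n := fun a ha => by
    simpa using h.perm.mem_iff.1 (List.mem_append_right i ha)
  have hKM : K.length * n ≤ n * M := by
    rw [mul_comm]; exact Nat.mul_le_mul_left _ (length_le_sum hKn hlt h.nonempty)
  have hKlen : K.length ≤ n := by
    have := h.perm.length_eq
    simp at this
    omega
  have hready : LexReady s₂ := by
    refine ⟨?_, ?_, ?_⟩
    · rw [f₂.arr 3 (by decide), f₁.arr 3 (by decide)]; exact hr.lex.rank
    · rw [f₂.arr 5 (by decide), f₁.arr 5 (by decide)]; exact hr.lex.count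
    · rw [f₂.arr 6 (by decide), f₁.arr 6 (by decide), f₂.reg 2 (by decide), f₁.reg 2 (by decide)]
      exact hr.lex.mark
  refine Runs.seq (T₁ := 120 * (K.length * n) + 10) (T₂ := 10 * n + 5)
    (Runs.mono (lexBFS_runs hN (hs.same g₂ (by decide)) hKn hlt h.len h.list hready
      (by rw [f₂.arr 8 (by decide), f₁.arr 8 (by decide)]; exact hr.num)) le_rfl ?_) (by omega)
  rintro s₃ f₃ ⟨O, hO⟩ -
  have hlen := hO.perm.length_eq
  have hnd' : (i ++ O).Nodup := (List.Perm.append_left i hO.perm).nodup_iff.2 hnd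
  refine Runs.block_seq (T₂ := 10 * n + 3) ?_ (by simp; omega)
  intro s₄ f₄ e₄
  have hs₄ : Input n N w s₄ :=
    hs.same (g₂.trans ((f₃.mono (l' := lexOrder.locs) (by decide)).trans
      (f₄.mono (l' := lexOrder.locs) (by decide)))) (by decide)
  refine Runs.forEach O (fun l s' => OrderIs (i ++ l) s' ∧
      ∀ a, s'.arr 8 a = if a ∈ O ∧ a ∉ l then O.idxOf a + 1 else 0) (fun _ => 5) (by decide)
    (by simp [e₄, Instr.run] : s₄.reg 20 = 0)
    (by rw [f₄.reg 1 (by decide), f₃.reg 1 (by decide), h.len, hlen]; simp)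
    (by rw [f₄.arr 7 (by decide)]; exact hO.order) ?_ ?_ ?_ (by simp; omega) ?_
  · exact fun l s' k h => ⟨⟨h.1.same (sameOutside_update _ _ _) (by decide), h.2⟩,
      h.1.same (sameOutside_update _ _ _) (by decide), h.2⟩
  · refine ⟨by simpa using (h.order.same f₃ (by decide)).same f₄ (by decide), fun a => ?_⟩
    rw [f₄.arr 8 (by decide), hO.num a]
    simp
  · rintro l₁ v l₂ s₅ hl f₅ - h21 ⟨ho, hn8⟩
    refine Runs.block' ?_ (by simp)
    intro s₆ e₆
    have hz : s₅.reg 3 = 0 := (hs₄.same f₅ (by decide)).zero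
    refine ⟨?_, ?_⟩
    · rw [← List.append_assoc]
      refine ho.snoc ?_ (by simp [e₆, Instr.run]) (by simp [e₆, Instr.run, h21])
        (by simp [e₆, Instr.run, h21])
      rw [hl, ← List.append_assoc, List.nodup_append] at hnd'
      exact fun hv => hnd'.2.2 v hv v (by simp) rfl
    · intro a
      have : s₆.arr 8 = Function.update (s₅.arr 8) v 0 := by simp [e₆, Instr.run, h21, hz]
      rw [this, Function.update_apply]
      by_cases hav : a = v
      · simp [hav]
      · rw [if_neg hav, hn8]; simp [hav]
  · rintro s₅ f₅ ⟨ho, hn8⟩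
    refine ⟨i ++ O, (List.Perm.append_left i hO.perm).trans h.perm,
      hO.lex.append_isolated h.isolated, ho, ⟨⟨?_, ?_, ?_⟩, fun a => ?_⟩⟩
    · rw [f₅.arr 3 (by decide), f₄.arr 3 (by decide)]; exact hO.ready.rank
    · rw [f₅.arr 5 (by decide), f₄.arr 5 (by decide)]; exact hO.ready.count
    · rw [f₅.arr 6 (by decide), f₄.arr 6 (by decide), f₅.reg 2 (by decide), f₄.reg 2 (by decide)]
      exact hO.ready.mark
    · rw [hn8]; simp

end RAM

/-! ### Earlier neighbours and cliques -/

section Cliques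

variable {N : ℕ → List ℕ} {n : ℕ}

theorem List.mem_iff_idxOf_lt {p q : List ℕ} {x : ℕ} (hx : x ∉ p) (a : ℕ) :
    a ∈ p ↔ (p ++ x :: q).idxOf a < (p ++ x :: q).idxOf x := by
  rw [List.idxOf_append_of_notMem hx, List.idxOf_cons_self]
  by_cases ha : a ∈ p
  · rw [List.idxOf_append_of_mem ha]
    have := List.idxOf_lt_length_iff.2 ha
    simp [ha]
    omega
  · rw [List.idxOf_append_of_notMem ha]
    simp [ha]

/-- The graph given by lists of neighbours. -/
def RAM.IsNbrs.graph (hN : RAM.IsNbrs n N) : SimpleGraph ℕ where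
  Adj u v := u ∈ N v
  symm := ⟨fun _ _ h => hN.symm h⟩
  loopless := ⟨hN.irrefl⟩

/-- This makes `LexRule.exists_conn` available for the orderings computed by the machine. -/
theorem LexList.lexRule (hN : RAM.IsNbrs n N) {o : List ℕ} (h : LexList N o) (hn : o.Nodup) :
    LexRule hN.graph o.toFinset fun x => o.idxOf x := by
  intro x hx y hy hxy d hd hdx h1 h2 h3
  beta_reduce at hxy hdx
  rw [List.mem_toFinset] at hx hy hd
  obtain ⟨p, q, rfl⟩ := List.append_of_mem hx
  have hxp : x ∉ p := fun hh => (List.nodup_append.1 hn).2.2 x hh x (by simp) rfl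
  have hdp : d ∈ p := (List.mem_iff_idxOf_lt hxp d).2 hdx
  have hyq : y ∈ q := by
    have hyp : y ∉ p := fun hh => by have := (List.mem_iff_idxOf_lt (q := q) hxp y).1 hh; omega
    rcases List.mem_append.1 hy with hh | hh
    · exact absurd hh hyp
    · rcases List.mem_cons.1 hh with rfl | hh
      · omega
      · exact hh
  obtain ⟨p₁, p₂, rfl⟩ := List.append_of_mem hdp
  have hdp₁ : d ∉ p₁ := fun hh =>
    (List.nodup_append.1 (List.nodup_append.1 hn).1).2.2 d hh d (by simp) rfl
  refine h _ x q rfl y hyq ⟨p₁, d, p₂, rfl, fun e he => ?_, hN.symm h1, fun hh => h2 (hN.symm hh)⟩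
  have h4 := h3 e (by simp [he]) (by
    have := (List.mem_iff_idxOf_lt (q := p₂ ++ x :: q) hdp₁ e).1 he
    simpa using this)
  have h5 : ∀ a, e ∈ N a ↔ a ∈ N e := fun a => ⟨hN.symm, hN.symm⟩
  rw [← h5, ← h5]
  exact h4.symm

/-- The elements are pairwise adjacent. -/
def Cliq (N : ℕ → List ℕ) (P : ℕ → Prop) : Prop :=
  ∀ a, P a → ∀ b, P b → a ≠ b → a ∈ N b

/-- `a` is a neighbour of `u` with a smaller number. -/
def Earlier (N : ℕ → List ℕ) (f : ℕ → ℕ) (u a : ℕ) : Prop :=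
  a ∈ N u ∧ 0 < f a ∧ f a < f u

/-- Let `p` be the last of the earlier neighbours of `u`. The others are then earlier neighbours of
`p` and form a clique by induction along the ordering. So adjacency has to be tested with `p` only,
not for all pairs. -/
theorem Earlier.cliq {f : ℕ → ℕ} (hN : RAM.IsNbrs n N)
    (hf : ∀ a b, 0 < f a → f a = f b → a = b) {u p : ℕ}
    (hp : Earlier N f u p) (hmax : ∀ a, Earlier N f u a → f a ≤ f p)
    (hall : ∀ a, Earlier N f u a → a = p ∨ a ∈ N p) (hpc : Cliq N (Earlier N f p)) :
    Cliq N (Earlier N f u) := by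
  have key : ∀ a, Earlier N f u a → a ≠ p → Earlier N f p a := fun a ha hap => by
    refine ⟨(hall a ha).resolve_left hap, ha.2.1, lt_of_le_of_ne (hmax a ha) fun hh => ?_⟩
    exact hap (hf a p ha.2.1 hh)
  intro a ha b hb hab
  by_cases hap : a = p
  · subst hap
    exact hN.symm ((hall b hb).resolve_left hab.symm)
  · by_cases hbp : b = p
    · subst hbp
      exact (hall a ha).resolve_left hab
    · exact hpc a (key a ha hap) b (key b hb hbp) hab

end Cliques

namespace RAM

variable {n : ℕ} {N : ℕ → List ℕ} {w : ℕ → ℝ≥0}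

/-! ### Elementary parts of the main loop -/

/-- Put the earlier neighbours of the vertex in register `21` into array `2`. -/
def earlierNbrs : Program :=
  .seq (block [.const 1 0, .load 35 13 21]) (nbrLoop 24 25 26 21 (.seq (block [.load 28 13 26])
    (.cond (.lt 28 35) (block [.store 2 1 26, .inc 1]) .skip)))

theorem earlierNbrs_runs {s : State} (hs : Input n N w s) {v : ℕ} (hv : s.reg 21 = v)
    (hvn : v < n) : Runs earlierNbrs s (10 * (N v).length + 10) fun s' =>
      s'.reg 1 = ((N v).filter fun a => s.arr 13 a < s.arr 13 v).length ∧
      Holds (s'.arr 2) 0 ((N v).filter fun a => s.arr 13 a < s.arr 13 v) := by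
  refine Runs.block_seq (T₂ := 10 * (N v).length + 7) ?_ (by simp; omega)
  intro s₁ f₁ e₁
  have h35 : s₁.reg 35 = s.arr 13 v := by simp [e₁, Instr.run, hv]
  refine Runs.nbrLoop (fun l s' => s'.reg 1 = (l.filter fun a => s.arr 13 a < s.arr 13 v).length ∧
      Holds (s'.arr 2) 0 (l.filter fun a => s.arr 13 a < s.arr 13 v)) 6 (hs.same f₁ (by decide))
    (by rw [f₁.reg 21 (by decide), hv]) hvn (by decide) (by decide) ?_ ?_ ?_ (by omega)
    (fun s' _ h => h)
  · intro l s k h; simpa [Function.update_apply] using h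
  · exact ⟨by simp [e₁, Instr.run], fun j hj => by simp at hj⟩
  · rintro l₁ a l₂ s₂ - f₂ h26 ⟨hI1, hI2⟩
    refine Runs.block_seq (T₂ := 4) ?_ (by simp)
    intro s₃ f₃ e₃
    have hb : (Test.lt 28 35).Holds s₃ ↔ s.arr 13 a < s.arr 13 v := by
      simp [e₃, Instr.run, Test.Holds, h26, f₂.arr 13 (by decide), f₁.arr 13 (by decide),
        f₂.reg 35 (by decide), h35]
    have h2 : s₃.arr 2 = s₂.arr 2 := f₃.arr 2 (by decide)
    have h1 : s₃.reg 1 = s₂.reg 1 := f₃.reg 1 (by decide)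
    refine Runs.cond (T := 3) (fun hc => Runs.block' ?_ (by simp))
      (fun hc => Runs.skip ?_ (by simp)) (by omega)
    · rintro s₄ e₄
      rw [hb] at hc
      rw [List.filter_append, List.filter_cons_of_pos (by simpa using hc), List.filter_nil]
      refine ⟨by simp [e₄, Instr.run, h1, hI1], ?_⟩
      have : s₄.arr 2 = Function.update (s₂.arr 2)
          (l₁.filter fun a => s.arr 13 a < s.arr 13 v).length a := by
        simp [e₄, Instr.run, h1, hI1, h2, f₃.reg 26 (by decide), h26]
      rw [this]
      exact hI2.snoc
    · rw [hb] at hc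
      rw [List.filter_append, List.filter_cons_of_neg (by simpa using hc), List.filter_nil,
        List.append_nil, h1, h2]
      exact ⟨hI1, hI2⟩

/-- Put the earlier neighbours of the vertex in register `23` into array `9`, add up their weights
and put the last one into register `30`. -/
def scanNbrs : Program :=
  .seq (block [.load 27 8 23, .const 29 0, .const 31 0, .wload 1 0 21, .wload 2 0 23, .wadd 1 2])
    (nbrLoop 24 25 26 23 (.seq (block [.load 28 8 26]) (.cond (.lt 3 28) (.cond (.lt 28 27)
      (.seq (block [.store 9 29 26, .inc 29, .wload 2 0 26, .wadd 1 2])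
        (.cond (.lt 31 28) (block [.copy 31 28, .copy 30 26]) .skip)) .skip) .skip)))

/-- The list `S` is stored in array `9`, its length in register `29`, its weight plus `W` in weight
register `1`, its element with the largest number `f` in register `30`. -/
structure Scanned (w : ℕ → ℝ≥0) (f : ℕ → ℕ) (W : ℝ≥0) (S : List ℕ) (s : State) : Prop where
  len : s.reg 29 = S.length
  list : Holds (s.arr 9) 0 S
  weight : s.wreg 1 = W + (S.map w).sum
  le : ∀ a ∈ S, f a ≤ s.reg 31
  nil : S = [] → s.reg 31 = 0
  last : S ≠ [] → s.reg 30 ∈ S ∧ f (s.reg 30) = s.reg 31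

theorem Scanned.same {f : ℕ → ℕ} {W : ℝ≥0} {S : List ℕ} {s s' : State} {l : List (ℕ × ℕ)}
    (h : Scanned w f W S s) (hs : SameOutside l s s')
    (hl : ∀ x ∈ [(0, 29), (1, 9), (2, 1), (0, 31), (0, 30)], x ∉ l) : Scanned w f W S s' := by
  have h29 := hs.reg 29 (hl _ (by simp))
  have h30 := hs.reg 30 (hl _ (by simp))
  have h31 := hs.reg 31 (hl _ (by simp))
  refine ⟨by rw [h29, h.len], ?_, ?_, by rw [h31]; exact h.le, by rw [h31]; exact h.nil,
    by rw [h31, h30]; exact h.last⟩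
  · rw [hs.arr 9 (hl _ (by simp))]; exact h.list
  · rw [hs.wreg 1 (hl _ (by simp))]; exact h.weight

theorem scanNbrs_runs (hN : IsNbrs n N) {s : State} (hs : Input n N w s) {u v : ℕ} (hu : s.reg 23 = u)
    (hun : u < n) (hv : s.reg 21 = v) (hvn : v < n) :
    Runs scanNbrs s (20 * (N u).length + 20) fun s' => s'.reg 27 = s.arr 8 u ∧
      Scanned w (s.arr 8) (w v + w u) ((N u).filter fun a => 0 < s.arr 8 a ∧ s.arr 8 a < s.arr 8 u)
        s' := by
  refine Runs.block_seq (T₂ := 20 * (N u).length + 10) ?_ (by simp; omega)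
  intro s₁ f₁ e₁
  have h27 : s₁.reg 27 = s.arr 8 u := by simp [e₁, Instr.run, hu]
  refine Runs.nbrLoop (fun l s' => Scanned w (s.arr 8) (w v + w u)
      (l.filter fun a => 0 < s.arr 8 a ∧ s.arr 8 a < s.arr 8 u) s') 14 (hs.same f₁ (by decide))
    (by rw [f₁.reg 23 (by decide), hu]) hun (by decide) (by decide) ?_ ?_ ?_ (by omega)
    (fun s' f₂ h => ⟨by rw [f₂.reg 27 (by decide), h27], h⟩)
  · exact fun l s k h => ⟨h.same (sameOutside_update _ _ _) (by decide),
      h.same (sameOutside_update _ _ _) (by decide), h.same (sameOutside_update _ _ _) (by decide)⟩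
  · refine ⟨by simp [e₁, Instr.run], fun j hj => by simp at hj, ?_, by simp,
      fun _ => by simp [e₁, Instr.run], by simp⟩
    simp [e₁, Instr.run, hu, hv, hs.wt u hun, hs.wt v hvn]
  · intro l₁ a l₂ s₂ hl f₂ h26 hI
    have han : a < n := hN.lt (v := u) (by rw [hl]; simp)
    have hs₂ := (hs.same f₁ (by decide)).same f₂ (by decide)
    refine Runs.block_seq (T₂ := 12) ?_ (by simp)
    intro s₃ f₃ e₃
    have hs₃ := hs₂.same f₃ (by decide)
    have hI₃ := hI.same f₃ (by decide)
    have h28 : s₃.reg 28 = s.arr 8 a := by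
      simp [e₃, Instr.run, h26, f₂.arr 8 (by decide), f₁.arr 8 (by decide)]
    have h26₃ : s₃.reg 26 = a := by rw [f₃.reg 26 (by decide), h26]
    have h27₃ : s₃.reg 27 = s.arr 8 u := by rw [f₃.reg 27 (by decide), f₂.reg 27 (by decide), h27]
    have hneg : ¬ (0 < s.arr 8 a ∧ s.arr 8 a < s.arr 8 u) → Scanned w (s.arr 8) (w v + w u)
        ((l₁ ++ [a]).filter fun a => 0 < s.arr 8 a ∧ s.arr 8 a < s.arr 8 u) s₃ := by
      intro hc
      rw [List.filter_append, List.filter_cons_of_neg (by simpa using hc), List.filter_nil,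
        List.append_nil]
      exact hI₃
    refine Runs.cond (T := 11) (fun hc => Runs.cond (T := 10) (fun hc' => ?_)
      (fun hc' => Runs.skip (hneg ?_) (by simp)) (by omega))
      (fun hc => Runs.skip (hneg ?_) (by simp)) (by omega)
    · simp only [Test.Holds, hs₃.zero, h28, h27₃] at hc hc'
      rw [List.filter_append, List.filter_cons_of_pos (by simp [hc, hc']), List.filter_nil]
      set S := l₁.filter fun a => 0 < s.arr 8 a ∧ s.arr 8 a < s.arr 8 u with hS
      refine Runs.block_seq (T₂ := 5) ?_ (by simp)
      intro s₄ f₄ e₄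
      have k29 : s₄.reg 29 = (S ++ [a]).length := by simp [e₄, Instr.run, hI₃.len]
      have k9 : Holds (s₄.arr 9) 0 (S ++ [a]) := by
        have : s₄.arr 9 = Function.update (s₃.arr 9) S.length a := by
          simp [e₄, Instr.run, hI₃.len, h26₃]
        rw [this]
        exact hI₃.list.snoc
      have k1 : s₄.wreg 1 = w v + w u + ((S ++ [a]).map w).sum := by
        have haw : s₃.warr 0 a = w a := hs₃.wt a han
        simp [e₄, Instr.run, h26₃, hI₃.weight, haw, add_assoc]
      have k31 : s₄.reg 31 = s₃.reg 31 := f₄.reg 31 (by decide)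
      have k30 : s₄.reg 30 = s₃.reg 30 := f₄.reg 30 (by decide)
      have k28 : s₄.reg 28 = s.arr 8 a := by rw [f₄.reg 28 (by decide), h28]
      refine Runs.cond (T := 3) (fun hc'' => Runs.block' ?_ (by simp))
        (fun hc'' => Runs.skip ?_ (by simp)) (by omega)
      · intro s₅ e₅
        simp only [Test.Holds, k31, k28] at hc''
        have m31 : s₅.reg 31 = s.arr 8 a := by simp [e₅, Instr.run, k28]
        have m30 : s₅.reg 30 = a := by simp [e₅, Instr.run, f₄.reg 26 (by decide), h26₃]
        refine ⟨by rw [← k29]; simp [e₅, Instr.run], by simpa [e₅, Instr.run] using k9,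
          by rw [← k1]; simp [e₅, Instr.run], ?_, by simp, fun _ => ⟨by simp [m30], by
            rw [m30, m31]⟩⟩
        intro b hb
        rw [m31]
        rcases List.mem_append.1 hb with hb | hb
        · have := hI₃.le b hb; omega
        · rw [List.mem_singleton.1 hb]
      · simp only [Test.Holds, k31, k28] at hc''
        -- The position of `a` is positive, so if it does not exceed the current maximum, the list
        -- cannot be empty.
        have hne : S ≠ [] := fun hh => by have := hI₃.nil hh; omega
        refine ⟨k29, k9, k1, ?_, by simp, fun _ => ?_⟩
        · intro b hb
          rw [k31]
          rcases List.mem_append.1 hb with hb | hb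
          · exact hI₃.le b hb
          · rw [List.mem_singleton.1 hb]; omega
        · rw [k30, k31]
          exact ⟨List.mem_append_left _ (hI₃.last hne).1, (hI₃.last hne).2⟩
    · simp only [Test.Holds, h28, h27₃] at hc'
      exact fun hh => hc' hh.2
    · simp only [Test.Holds, hs₃.zero, h28] at hc
      exact fun hh => hc hh.1

/-- Compare the vertices in array `9` with the neighbours of the vertex in register `30`. -/
def checkNbrs : Program :=
  .cond (.lt 3 29) (.seq (block [.inc 2, .store 6 30 2])
    (.seq (nbrLoop 24 25 26 30 (block [.store 6 26 2])) (.seq (block [.const 24 0])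
      (forEach 24 29 26 9 (.seq (block [.load 28 6 26])
        (.cond (.eq 28 2) .skip (block [.const 4 1, .copy 32 26]))))))) .skip

theorem checkNbrs_runs {s : State} (hs : Input n N w s) {S : List ℕ} {p : ℕ}
    (h29 : s.reg 29 = S.length) (hS : Holds (s.arr 9) 0 S) (hp : s.reg 30 = p)
    (hpn : S ≠ [] → p < n) (hmark : ∀ a, s.arr 6 a ≤ s.reg 2) (h4 : s.reg 4 = 0) :
    Runs checkNbrs s (10 * S.length + 10 * (N p).length + 20) fun s' =>
      (∀ a, s'.arr 6 a ≤ s'.reg 2) ∧ (s'.reg 4 = 0 ∧ (∀ a ∈ S, a = p ∨ a ∈ N p) ∨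
        s'.reg 4 = 1 ∧ s'.reg 32 ∈ S ∧ s'.reg 32 ≠ p ∧ s'.reg 32 ∉ N p) := by
  refine Runs.cond (T := 10 * S.length + 10 * (N p).length + 19) (fun hc => ?_)
    (fun hc => Runs.skip ?_ (by omega)) (by omega)
  swap
  · simp only [Test.Holds, hs.zero, h29] at hc
    have : S = [] := List.eq_nil_of_length_eq_zero (by omega)
    subst this
    exact ⟨hmark, Or.inl ⟨h4, by simp⟩⟩
  simp only [Test.Holds, hs.zero, h29] at hc
  have hpn := hpn (by rintro rfl; simp at hc)
  refine Runs.block_seq (T₂ := 10 * S.length + 10 * (N p).length + 16) ?_ (by simp; omega)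
  intro s₁ f₁ e₁
  have g2 : s₁.reg 2 = s.reg 2 + 1 := by simp [e₁, Instr.run]
  refine Runs.seq (T₁ := 10 * (N p).length + 6) (T₂ := 10 * S.length + 10)
    (Runs.nbrLoop (fun l s' => ∀ a, s'.arr 6 a = if a = p ∨ a ∈ l then s.reg 2 + 1 else s.arr 6 a)
      2 (hs.same f₁ (by decide)) (by rw [f₁.reg 30 (by decide), hp]) hpn (by decide) (by decide)
      (fun l s' k h => ⟨h, h, h⟩) ?_ ?_ (by omega) ?_) (by omega)
  · intro a
    have : s₁.arr 6 = Function.update (s.arr 6) p (s.reg 2 + 1) := by simp [e₁, Instr.run, hp]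
    rw [this, Function.update_apply]; simp
  · intro l₁ a l₂ s₂ _ f₂ h26 hI
    refine Runs.block' ?_ (by simp)
    intro s₃ e₃ b
    have : s₃.arr 6 = Function.update (s₂.arr 6) a (s.reg 2 + 1) := by
      simp [e₃, Instr.run, h26, f₂.reg 2 (by decide), g2]
    rw [this, Function.update_apply]
    by_cases hb : b = a
    · simp [hb]
    · rw [if_neg hb, hI b]; simp [hb]
  · intro s₂ f₂ h6 _
    have hs6 : ∀ a, s₂.arr 6 a = s.reg 2 + 1 ↔ a = p ∨ a ∈ N p := by
      intro a
      rw [h6]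
      have := hmark a
      split_ifs with h
      · simp [h]
      · simp [h]; omega
    have g2' : s₂.reg 2 = s.reg 2 + 1 := by rw [f₂.reg 2 (by decide), g2]
    refine Runs.block_seq (T₂ := 10 * S.length + 8) ?_ (by simp; omega)
    intro s₃ f₃ e₃
    refine Runs.forEach S (fun l s' => s'.reg 4 = 0 ∧ (∀ a ∈ l, a = p ∨ a ∈ N p) ∨
        s'.reg 4 = 1 ∧ s'.reg 32 ∈ S ∧ s'.reg 32 ≠ p ∧ s'.reg 32 ∉ N p) (fun _ => 6) (by decide)
      (by simp [e₃, Instr.run] : s₃.reg 24 = 0)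
      (by rw [f₃.reg 29 (by decide), f₂.reg 29 (by decide), f₁.reg 29 (by decide), h29]; simp)
      (by rw [f₃.arr 9 (by decide), f₂.arr 9 (by decide), f₁.arr 9 (by decide)]; exact hS)
      ?_ ?_ ?_ (by simp; omega) ?_
    · intro l s k h; simpa [Function.update_apply] using h
    · left
      simp [f₃.reg 4 (by decide), f₂.reg 4 (by decide), f₁.reg 4 (by decide), h4]
    · intro l₁ a l₂ s₄ hl f₄ _ h26 hI
      refine Runs.block_seq (T₂ := 4) ?_ (by simp)
      intro s₅ f₅ e₅
      have hb : (Test.eq 28 2).Holds s₅ ↔ a = p ∨ a ∈ N p := by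
        rw [← hs6]
        simp [e₅, Instr.run, Test.Holds, h26, f₄.arr 6 (by decide), f₃.arr 6 (by decide),
          f₄.reg 2 (by decide), f₃.reg 2 (by decide), g2']
      refine Runs.cond (T := 3) (fun hc => Runs.skip ?_ (by simp))
        (fun hc => Runs.block' ?_ (by simp)) (by omega)
      · rw [hb] at hc
        rw [f₅.reg 4 (by decide), f₅.reg 32 (by decide)]
        refine hI.imp (fun h => ⟨h.1, fun b hb => ?_⟩) id
        rcases List.mem_append.1 hb with hb | hb
        · exact h.2 b hb
        · rw [List.mem_singleton.1 hb]; exact hc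
      · rintro s₆ e₆
        rw [hb, not_or] at hc
        right
        have : s₆.reg 32 = a := by simp [e₆, Instr.run, f₅.reg 26 (by decide), h26]
        rw [this]
        exact ⟨by simp [e₆, Instr.run], by rw [hl]; simp, hc.1, hc.2⟩
    · intro s₄ f₄ h
      refine ⟨fun a => ?_, h⟩
      rw [f₄.arr 6 (by decide), f₃.arr 6 (by decide), f₄.reg 2 (by decide), f₃.reg 2 (by decide),
        g2', h6]
      have := hmark a
      split_ifs <;> omega

/-- Array `10` contains a clique that is at least as heavy as all cliques with the property `P`. -/
structure Best (n : ℕ) (N : ℕ → List ℕ) (w : ℕ → ℝ≥0) (P : Finset ℕ → Prop) (s : State) :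
    Prop where
  clique : ∃ B : List ℕ, B.Nodup ∧ (∀ a ∈ B, a < n) ∧ Cliq N (· ∈ B) ∧ s.reg 5 = B.length ∧
    Holds (s.arr 10) 0 B ∧ s.wreg 0 = (B.map w).sum
  le : ∀ T : Finset ℕ, P T → Cliq N (· ∈ T) → ∑ a ∈ T, w a ≤ s.wreg 0

theorem Best.same {P : Finset ℕ → Prop} {s s' : State} {l : List (ℕ × ℕ)} (h : Best n N w P s)
    (hs : SameOutside l s s') (hl : ∀ x ∈ [(0, 5), (1, 10), (2, 0)], x ∉ l) : Best n N w P s' := by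
  have h0 := hs.wreg 0 (hl _ (by simp))
  refine ⟨?_, by rw [h0]; exact h.le⟩
  rw [h0, hs.reg 5 (hl _ (by simp)), hs.arr 10 (hl _ (by simp))]
  exact h.clique

theorem Best.mono {P Q : Finset ℕ → Prop} {s : State} (h : Best n N w P s)
    (hQ : ∀ T, Q T → Cliq N (· ∈ T) → P T) : Best n N w Q s :=
  ⟨h.clique, fun T hT hc => h.le T (hQ T hT hc) hc⟩

/-- Compare the best clique with the vertex in register `21`. -/
def recordVertex : Program :=
  .seq (block [.wload 1 0 21])
    (.cond (.wlt 0 1) (block [.wcopy 0 1, .const 5 1, .store 10 3 21]) .skip)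

theorem recordVertex_runs {P : Finset ℕ → Prop} {s : State} (hs : Input n N w s) {v : ℕ}
    (hv : s.reg 21 = v) (hvn : v < n) (hb : Best n N w P s) :
    Runs recordVertex s 10 fun s' => Best n N w (fun T => P T ∨ T = {v}) s' := by
  refine Runs.block_seq (T₂ := 6) ?_ (by simp)
  intro s₁ f₁ e₁
  have h1 : s₁.wreg 1 = w v := by simp [e₁, Instr.run, hv, hs.wt v hvn]
  have hb₁ := hb.same f₁ (by decide)
  have hs₁ := hs.same f₁ (by decide)
  have hv₁ : s₁.reg 21 = v := by rw [f₁.reg 21 (by decide), hv]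
  refine Runs.cond (T := 5) (fun hc => Runs.block' ?_ (by simp))
      (fun hc => Runs.skip ?_ (by simp)) (by omega)
  · intro s₂ e₂
    simp only [Test.Holds, h1] at hc
    have h0 : s₂.wreg 0 = w v := by simp [e₂, Instr.run, h1]
    refine ⟨⟨[v], by simp, by simpa using hvn, ?_, by simp [e₂, Instr.run], ?_, by simp [h0]⟩, ?_⟩
    · intro a ha b hb hab
      simp at ha hb
      omega
    · intro j hj
      simp at hj
      subst hj
      simp [e₂, Instr.run, hs₁.zero, hv₁]
    · rintro T (hT | rfl) hc'
      · rw [h0]; exact (hb₁.le T hT hc').trans hc.le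
      · simp [h0]
  · simp only [Test.Holds, h1, not_lt] at hc
    refine ⟨hb₁.clique, ?_⟩
    rintro T (hT | rfl) hc'
    · exact hb₁.le T hT hc'
    · simpa using hc

/-- Compare the best clique with the vertices in the registers `21`, `23` and in array `9`. -/
def recordClique : Program :=
  .cond (.wlt 0 1) (.seq (block [.wcopy 0 1, .store 10 3 21, .const 5 1, .store 10 5 23, .inc 5,
    .const 24 0]) (forEach 24 29 26 9 (block [.store 10 5 26, .inc 5]))) .skip

/-- By `hQ` every clique newly admitted to the comparison is at most as heavy as the clique on
offer. One comparison of weights therefore extends the optimality from `P` to `Q`. -/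
theorem recordClique_runs {P Q : Finset ℕ → Prop} {s : State} (hs : Input n N w s) {u v : ℕ}
    {S : List ℕ} (hv : s.reg 21 = v) (hu : s.reg 23 = u) (h29 : s.reg 29 = S.length)
    (hS : Holds (s.arr 9) 0 S) (hw : s.wreg 1 = w v + w u + (S.map w).sum) (hb : Best n N w P s)
    (hn : (v :: u :: S).Nodup) (hlt : ∀ a ∈ v :: u :: S, a < n)
    (hcl : Cliq N (· ∈ v :: u :: S))
    (hQ : ∀ T, Q T → Cliq N (· ∈ T) → P T ∨ ∑ a ∈ T, w a ≤ w v + w u + (S.map w).sum) :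
    Runs recordClique s (10 * S.length + 20) fun s' => Best n N w Q s' := by
  refine Runs.cond (T := 10 * S.length + 19) (fun hc => ?_) (fun hc => Runs.skip ?_ (by omega))
    (by omega)
  · simp only [Test.Holds, hw] at hc
    refine Runs.block_seq (T₂ := 10 * S.length + 10) ?_ (by simp; omega)
    intro s₁ f₁ e₁
    refine Runs.forEach S (fun l s' => s'.reg 5 = (v :: u :: l).length ∧
      Holds (s'.arr 10) 0 (v :: u :: l)) (fun _ => 3) (by decide)
      (by simp [e₁, Instr.run] : s₁.reg 24 = 0)
      (by rw [f₁.reg 29 (by decide), h29]; simp)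
      (by rw [f₁.arr 9 (by decide)]; exact hS) ?_ ?_ ?_ (by simp; omega) ?_
    · intro l s k h; simpa [Function.update_apply] using h
    · refine ⟨by simp [e₁, Instr.run], ?_⟩
      have e : s₁.arr 10 = Function.update (Function.update (s.arr 10) 0 v) 1 u := by
        simp [e₁, Instr.run, hs.zero, hv, hu]
      rw [e]
      intro j hj
      simp at hj
      interval_cases j <;> simp
    · rintro l₁ a l₂ s₂ - f₂ - h26 ⟨hI1, hI2⟩
      refine Runs.block' ?_ (by simp)
      intro s₃ e₃
      refine ⟨by simp [e₃, Instr.run, hI1], ?_⟩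
      have e : s₃.arr 10 = Function.update (s₂.arr 10) (v :: u :: l₁).length a := by
        simp [e₃, Instr.run, hI1, h26]
      rw [e]
      exact hI2.snoc
    · rintro s₂ f₂ ⟨hI1, hI2⟩
      have h0 : s₂.wreg 0 = w v + w u + (S.map w).sum := by
        rw [f₂.wreg 0 (by decide)]; simp [e₁, Instr.run, hw]
      refine ⟨⟨v :: u :: S, hn, hlt, hcl, hI1, hI2, by simp [h0, add_assoc]⟩, fun T hT hT' => ?_⟩
      rw [h0]
      rcases hQ T hT hT' with h | h
      · exact (hb.le T h hT').trans hc.le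
      · exact h
  · simp only [Test.Holds, hw, not_lt] at hc
    refine ⟨hb.clique, fun T hT hT' => ?_⟩
    rcases hQ T hT hT' with h | h
    · exact hb.le T h hT'
    · exact h.trans hc

end RAM

namespace RAM

variable {n : ℕ} {N : ℕ → List ℕ} {w : ℕ → ℝ≥0}

/-! ### The main loop -/

/-- The positions in the list `O`, counted from `1`. -/
def numOf (O : List ℕ) (a : ℕ) : ℕ := if a ∈ O then O.idxOf a + 1 else 0

theorem numOf_pos {O : List ℕ} {a : ℕ} : 0 < numOf O a ↔ a ∈ O := by
  unfold numOf
  split_ifs with h <;> simp [h]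

theorem numOf_inj {O : List ℕ} (a b : ℕ) (ha : 0 < numOf O a) (h : numOf O a = numOf O b) :
    a = b := by
  have hb : 0 < numOf O b := h ▸ ha
  rw [numOf_pos] at ha hb
  rw [numOf, numOf, if_pos ha, if_pos hb] at h
  exact (List.idxOf_inj ha).1 (by omega)

theorem numOf_eq {o₁ o₂ : List ℕ} {u : ℕ} (hu : u ∉ o₁) :
    numOf (o₁ ++ u :: o₂) u = o₁.length + 1 := by
  rw [numOf, if_pos (by simp), List.idxOf_append_of_notMem hu]
  simp

theorem numOf_lt_iff {o₁ o₂ : List ℕ} {u : ℕ} (hu : u ∉ o₁) (a : ℕ) :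
    0 < numOf (o₁ ++ u :: o₂) a ∧ numOf (o₁ ++ u :: o₂) a < numOf (o₁ ++ u :: o₂) u ↔ a ∈ o₁ := by
  rw [numOf_pos, List.mem_iff_idxOf_lt (q := o₂) hu a]
  constructor
  · rintro ⟨ha, h⟩
    rw [numOf, numOf, if_pos ha, if_pos (by simp)] at h
    omega
  · intro h
    have ha := (List.mem_iff_idxOf_lt (q := o₂) hu a).2 h
    refine ⟨by simp [ha], ?_⟩
    rw [numOf, numOf, if_pos (by simp [ha]), if_pos (by simp)]
    omega

/-- The search of `O` found the vertex `u` after the vertices `o₁`, whose neighbours `p` and `q` in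
`o₁` are not adjacent. The list `O` contains the neighbours of `v` in `p₀`. -/
structure Conflict (N : ℕ → List ℕ) (p₀ : List ℕ) (v : ℕ) (O o₁ : List ℕ) (u : ℕ) (o₂ : List ℕ)
    (p q : ℕ) (s : State) : Prop where
  split : O = o₁ ++ u :: o₂
  mem : ∀ a, a ∈ O ↔ a ∈ N v ∧ a ∈ p₀
  nodup : O.Nodup
  lex : LexList N O
  len : s.reg 1 = O.length
  order : Holds (s.arr 7) 0 O
  num : s.arr 8 = numOf O
  reg40 : s.reg 40 = p₀.length
  reg41 : s.reg 41 = u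
  reg27 : s.reg 27 = o₁.length + 1
  reg30 : s.reg 30 = p
  reg32 : s.reg 32 = q
  hp : p ∈ o₁ ∧ p ∈ N u
  hq : q ∈ o₁ ∧ q ∈ N u
  hpq : p ≠ q ∧ q ∉ N p

theorem Conflict.same {p₀ O o₁ o₂ : List ℕ} {v u p q : ℕ} {s s' : State} {l : List (ℕ × ℕ)}
    (h : Conflict N p₀ v O o₁ u o₂ p q s) (hs : SameOutside l s s')
    (hl : ∀ x ∈ [(0, 1), (1, 7), (1, 8), (0, 40), (0, 41), (0, 27), (0, 30), (0, 32)], x ∉ l) :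
    Conflict N p₀ v O o₁ u o₂ p q s' := by
  refine ⟨h.split, h.mem, h.nodup, h.lex, ?_, ?_, ?_, ?_, ?_, ?_, ?_, ?_, h.hp, h.hq, h.hpq⟩
  · rw [hs.reg 1 (hl _ (by simp)), h.len]
  · rw [hs.arr 7 (hl _ (by simp))]; exact h.order
  · rw [hs.arr 8 (hl _ (by simp)), h.num]
  · rw [hs.reg 40 (hl _ (by simp)), h.reg40]
  · rw [hs.reg 41 (hl _ (by simp)), h.reg41]
  · rw [hs.reg 27 (hl _ (by simp)), h.reg27]
  · rw [hs.reg 30 (hl _ (by simp)), h.reg30]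
  · rw [hs.reg 32 (hl _ (by simp)), h.reg32]

theorem LexReady.same {s s' : State} {l : List (ℕ × ℕ)} (h : LexReady s) (hs : SameOutside l s s')
    (hl : ∀ x ∈ [(1, 3), (1, 5), (1, 6), (0, 2)], x ∉ l) : LexReady s' := by
  have h2 := hs.reg 2 (hl _ (by simp))
  have h3 := hs.arr 3 (hl _ (by simp))
  have h5 := hs.arr 5 (hl _ (by simp))
  have h6 := hs.arr 6 (hl _ (by simp))
  exact ⟨by rw [h3]; exact h.rank, by rw [h5]; exact h.count, by rw [h2, h6]; exact h.mark⟩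

theorem Ready.same {s s' : State} {l : List (ℕ × ℕ)} (h : Ready s) (hs : SameOutside l s s')
    (hl : ∀ x ∈ [(1, 3), (1, 5), (1, 6), (0, 2), (1, 8)], x ∉ l) : Ready s' := by
  refine ⟨h.lex.same hs fun x hx => hl x ?_, ?_⟩
  · simp at hx ⊢; tauto
  · rw [hs.arr 8 (hl _ (by simp))]; exact h.num

/-- Process the vertex in register `23` of the list of earlier neighbours of the vertex in
register `21`. -/
def scanVertex : Program :=
  .cond (.eq 4 3) (.seq scanNbrs (.seq checkNbrs (.cond (.eq 4 3) recordClique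
    (block [.load 40 13 21, .dec 40, .copy 41 23])))) .skip

/-- The vertices `o` of `O` have been processed. -/
def ScanState (n : ℕ) (N : ℕ → List ℕ) (w : ℕ → ℝ≥0) (p₀ : List ℕ) (v : ℕ) (O o : List ℕ)
    (s : State) : Prop :=
  s.reg 4 = 0 ∧ LexReady s ∧
      Best n N w (fun T => T ⊆ p₀.toFinset ∨ v ∈ T ∧ T ⊆ insert v o.toFinset) s ∧
      (∀ u ∈ o, Cliq N (Earlier N (numOf O) u)) ∨
    s.reg 4 = 1 ∧ ∃ o₁ u o₂ p q, Conflict N p₀ v O o₁ u o₂ p q s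

theorem ScanState.same {p₀ O o : List ℕ} {v : ℕ} {s s' : State} {l : List (ℕ × ℕ)}
    (h : ScanState n N w p₀ v O o s) (hs : SameOutside l s s')
    (hl : ∀ x ∈ [(0, 1), (1, 7), (1, 8), (0, 40), (0, 41), (0, 27), (0, 30), (0, 32), (1, 3),
      (1, 5), (1, 6), (0, 2), (0, 5), (1, 10), (2, 0), (0, 4)], x ∉ l) :
    ScanState n N w p₀ v O o s' := by
  have h4 := hs.reg 4 (hl _ (by simp))
  rcases h with ⟨h1, h2, h3, h5⟩ | ⟨h1, o₁, u, o₂, p, q, h2⟩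
  · refine Or.inl ⟨h4.trans h1, h2.same hs fun x hx => hl x ?_,
      h3.same hs fun x hx => hl x ?_, h5⟩ <;> simp at hx ⊢ <;> tauto
  · refine Or.inr ⟨h4.trans h1, o₁, u, o₂, p, q, h2.same hs fun x hx => hl x ?_⟩
    simp at hx ⊢; tauto

/-- If the earlier neighbours `S` of `u` pass the comparison with the last one, they form a clique,
and `v`, `u` and `S` form a heaviest clique among those that contain `v` and `u` and otherwise lie
in `o`. If not, the last element of `S` and the offending one are the nonadjacent pair of a
`Conflict`. Register `4` then stops all further processing. -/
theorem scanVertex_runs (hN : IsNbrs n N) {s : State} (hs : Input n N w s) {p₀ O o o₂ : List ℕ}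
    {u v : ℕ} (hO : O = o ++ u :: o₂) (hmem : ∀ a, a ∈ O ↔ a ∈ N v ∧ a ∈ p₀) (hnd : O.Nodup)
    (hlex : LexList N O) (hlen : s.reg 1 = O.length) (horder : Holds (s.arr 7) 0 O)
    (hnum : s.arr 8 = numOf O) (hu : s.reg 23 = u) (hv : s.reg 21 = v) (hvn : v < n)
    (hvpos : s.arr 13 v = p₀.length + 1) (h : ScanState n N w p₀ v O o s) :
    Runs scanVertex s (140 * n) fun s' => ScanState n N w p₀ v O (o ++ [u]) s' := by
  refine Runs.cond (T := 140 * n - 1) (fun hc => ?_) (fun hc => Runs.skip ?_ (by omega)) (by omega)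
  swap
  · rcases h with ⟨h1, -⟩ | h
    · exact absurd (show s.reg 4 = s.reg 3 by rw [h1, hs.zero]) hc
    · exact Or.inr h
  have h4 : s.reg 4 = 0 := by rw [show s.reg 4 = s.reg 3 from hc, hs.zero]
  rcases h with ⟨-, hready, hbest, hcl⟩ | ⟨h1, -⟩
  swap
  · omega
  have huO : u ∈ O := by rw [hO]; simp
  have huv := (hmem u).1 huO
  have hun : u < n := hN.lt huv.1
  have hlenu := hN.length_le u
  have huo : u ∉ o := fun hh => by
    rw [hO] at hnd
    exact (List.nodup_append.1 hnd).2.2 u hh u (by simp) rfl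
  refine Runs.seq (T₁ := 20 * (N u).length + 20) (T₂ := 90 * n)
    (Runs.mono (scanNbrs_runs hN hs hu hun hv hvn) le_rfl ?_) (by omega)
  rintro s₁ f₁ ⟨h27, hS⟩ -
  have hs₁ := hs.same f₁ (by decide)
  rw [hnum] at h27 hS
  set S := (N u).filter fun a => 0 < numOf O a ∧ numOf O a < numOf O u with hSdef
  have hmemS : ∀ a, a ∈ S ↔ Earlier N (numOf O) u a := fun a => by simp [hSdef, Earlier]
  have hEarlier : ∀ a, Earlier N (numOf O) u a ↔ a ∈ N u ∧ a ∈ o := fun a => by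
    rw [Earlier, hO, numOf_lt_iff huo]
  have hSnd : S.Nodup := (hN.nodup u).filter _
  have hSlen : S.length ≤ (N u).length := List.length_filter_le _ _
  obtain ⟨p, hp⟩ : ∃ p, s₁.reg 30 = p := ⟨_, rfl⟩
  have hpn : S ≠ [] → p < n := fun hne => by
    have := (hS.last hne).1
    rw [hp, hmemS] at this
    exact hN.lt this.1
  have hpl := hN.length_le p
  refine Runs.seq (T₁ := 10 * S.length + 10 * (N p).length + 20) (T₂ := 50 * n)
    (Runs.mono (checkNbrs_runs hs₁ hS.len hS.list hp hpn
      (by rw [f₁.arr 6 (by decide), f₁.reg 2 (by decide)]; exact hready.mark)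
      (by rw [f₁.reg 4 (by decide), h4])) le_rfl ?_) (by omega)
  rintro s₂ f₂ ⟨hmark, hres⟩ -
  have hs₂ := hs₁.same f₂ (by decide)
  have hS₂ := hS.same f₂ (by decide)
  have hu₂ : s₂.reg 23 = u := by rw [f₂.reg 23 (by decide), f₁.reg 23 (by decide), hu]
  have hv₂ : s₂.reg 21 = v := by rw [f₂.reg 21 (by decide), f₁.reg 21 (by decide), hv]
  refine Runs.cond (T := 40 * n) (fun hc' => ?_) (fun hc' => Runs.block' ?_ (by simp; omega))
    (by omega)
  · have h4' : s₂.reg 4 = 0 := by rw [show s₂.reg 4 = s₂.reg 3 from hc', hs₂.zero]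
    rcases hres with ⟨-, hall⟩ | ⟨h1, -⟩
    swap
    · omega
    have hcu : Cliq N (Earlier N (numOf O) u) := by
      by_cases hne : S = []
      · intro a ha
        rw [← hmemS, hne] at ha
        simp at ha
      · obtain ⟨hpS, hp31⟩ := hS.last hne
        rw [hp] at hpS hp31
        refine Earlier.cliq hN numOf_inj ((hmemS p).1 hpS) (fun a ha => ?_)
          (fun a ha => hall a ((hmemS a).2 ha)) (hcl p ((hEarlier p).1 ((hmemS p).1 hpS)).2)
        rw [hp31]
        exact hS.le a ((hmemS a).2 ha)
    have hmem' : ∀ a ∈ S, a ∈ N u ∧ a ∈ N v ∧ a ∈ o := fun a ha => by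
      have h1 := (hEarlier a).1 ((hmemS a).1 ha)
      exact ⟨h1.1, ((hmem a).1 (by rw [hO]; simp [h1.2])).1, h1.2⟩
    refine Runs.mono (recordClique_runs (Q := fun T => T ⊆ p₀.toFinset ∨
      v ∈ T ∧ T ⊆ insert v (o ++ [u]).toFinset) hs₂ hv₂ hu₂ hS₂.len hS₂.list hS₂.weight
      ((hbest.same f₁ (by decide)).same f₂ (by decide)) ?_ ?_ ?_ ?_) (by omega) ?_
    · simp only [List.nodup_cons, List.mem_cons, not_or]
      refine ⟨⟨?_, fun hvS => hN.irrefl v (hmem' v hvS).2.1⟩,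
        fun huS => hN.irrefl u (hmem' u huS).1, hSnd⟩
      rintro rfl
      exact hN.irrefl _ huv.1
    · intro a ha
      rcases List.mem_cons.1 ha with rfl | ha
      · exact hvn
      rcases List.mem_cons.1 ha with rfl | ha
      · exact hun
      · exact hN.lt (hmem' a ha).1
    · intro a ha b hb hab
      simp only [List.mem_cons] at ha hb
      rcases ha with rfl | rfl | ha <;> rcases hb with rfl | rfl | hb
      · exact absurd rfl hab
      · exact hN.symm huv.1
      · exact hN.symm (hmem' b hb).2.1
      · exact huv.1
      · exact absurd rfl hab
      · exact hN.symm (hmem' b hb).1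
      · exact (hmem' a ha).2.1
      · exact (hmem' a ha).1
      · exact hcu a ((hmemS a).1 ha) b ((hmemS b).1 hb) hab
    · rintro T (hT | ⟨hvT, hT⟩) hTc
      · exact Or.inl (Or.inl hT)
      -- A clique without `u` was already admitted before. A clique with `u` consists of `v`, `u`
      -- and earlier neighbours of `u`, so its weight is at most that of the candidate because
      -- weights are nonnegative.
      · by_cases huT : u ∈ T
        · right
          have hsub : T ⊆ (v :: u :: S).toFinset := by
            intro a ha
            by_cases hav : a = v
            · simp [hav]
            by_cases hau : a = u
            · simp [hau]
            have := hT ha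
            simp [hav, hau] at this
            simp [hav, hau]
            rw [hmemS, hEarlier]
            exact ⟨hTc a ha u huT hau, this⟩
          refine (Finset.sum_le_sum_of_subset hsub).trans ?_
          have hnd' : (v :: u :: S).Nodup := by
            simp only [List.nodup_cons, List.mem_cons, not_or]
            refine ⟨⟨?_, fun hvS => hN.irrefl v (hmem' v hvS).2.1⟩,
              fun huS => hN.irrefl u (hmem' u huS).1, hSnd⟩
            rintro rfl
            exact hN.irrefl _ huv.1
          rw [List.sum_toFinset w hnd']
          simp [add_assoc]
        · left; right
          refine ⟨hvT, fun a ha => ?_⟩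
          have := hT ha
          have hau : a ≠ u := fun hh => huT (hh ▸ ha)
          simpa [hau] using this
    · intro s₃ f₃ hb
      refine Or.inl ⟨by rw [f₃.reg 4 (by decide), h4'], ?_, hb, ?_⟩
      · have : LexReady s₂ := by
          refine ⟨?_, ?_, hmark⟩
          · rw [f₂.arr 3 (by decide), f₁.arr 3 (by decide)]; exact hready.rank
          · rw [f₂.arr 5 (by decide), f₁.arr 5 (by decide)]; exact hready.count
        exact this.same f₃ (by decide)
      · intro x hx
        rcases List.mem_append.1 hx with hx | hx
        · exact hcl x hx
        · rw [List.mem_singleton.1 hx]; exact hcu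
  · rcases hres with ⟨h1, -⟩ | ⟨h1, h2, h3, h5⟩
    · exact fun _ _ => absurd (show s₂.reg 4 = s₂.reg 3 by rw [h1, hs₂.zero]) hc'
    intro s₃ e₃
    have f₃ : SameOutside (block [.load 40 13 21, .dec 40, .copy 41 23]).locs s₂ s₃ := by
      obtain ⟨s', t, hex, -, hs'⟩ := Runs.block' (l := [.load 40 13 21, .dec 40, .copy 41 23])
        (s := s₂) (T := 4) (Q := fun s' => s' = s₃) (fun s' hs' => hs'.trans e₃.symm) (by simp)
      exact hs' ▸ hex.sameOutside
    have hne : S ≠ [] := List.ne_nil_of_mem h2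
    have hpS := (hS.last hne).1
    rw [hp] at hpS
    have g1 : s₃.reg 1 = s.reg 1 := by
      rw [f₃.reg 1 (by decide), f₂.reg 1 (by decide), f₁.reg 1 (by decide)]
    have g7 : s₃.arr 7 = s.arr 7 := by
      rw [f₃.arr 7 (by decide), f₂.arr 7 (by decide), f₁.arr 7 (by decide)]
    have g8 : s₃.arr 8 = s.arr 8 := by
      rw [f₃.arr 8 (by decide), f₂.arr 8 (by decide), f₁.arr 8 (by decide)]
    refine Or.inr ⟨by rw [f₃.reg 4 (by decide), h1], o, u, o₂, p, s₂.reg 32, hO, hmem, hnd, hlex,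
      by rw [g1, hlen], by rw [g7]; exact horder, by rw [g8, hnum], ?_, ?_, ?_, ?_, ?_, ?_, ?_, ?_⟩
    · simp [e₃, Instr.run, hv₂, f₂.arr 13 (by decide), f₁.arr 13 (by decide), hvpos]
    · simp [e₃, Instr.run, hu₂]
    · rw [f₃.reg 27 (by decide), f₂.reg 27 (by decide), h27, hO, numOf_eq huo]
    · rw [f₃.reg 30 (by decide), f₂.reg 30 (by decide), hp]
    · rw [f₃.reg 32 (by decide)]
    · exact ((hEarlier p).1 ((hmemS p).1 hpS)).symm
    · exact ((hEarlier _).1 ((hmemS _).1 h2)).symm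
    · exact ⟨fun hh => h3 hh.symm, h5⟩

/-- Array `8` is cleared along array `2` only, since sweeping all `n` cells for every vertex would
cost `n²`. After a conflict it is kept, because the search for the hole reads it. -/
def scanAll : Program :=
  .seq (block [.const 22 0]) (.seq (forEach 22 1 23 7 scanVertex)
    (.cond (.eq 4 3) (.seq (block [.const 22 0]) (forEach 22 1 26 2 (block [.store 8 26 3]))) .skip))

/-- Process the vertex in register `21`. -/
def processVertex : Program :=
  .cond (.eq 4 3) (.seq earlierNbrs (.seq recordVertex (.seq lexBFS scanAll))) .skip

def mainLoop : Program := .seq (block [.const 20 0]) (forEach 20 0 21 12 processVertex)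

/-- The vertices `o` of the ordering `ord` have been processed. -/
def MainState (n : ℕ) (N : ℕ → List ℕ) (w : ℕ → ℝ≥0) (ord o : List ℕ) (s : State) : Prop :=
  s.reg 4 = 0 ∧ Ready s ∧ Best n N w (fun T => T ⊆ o.toFinset) s ∨
    s.reg 4 = 1 ∧ ∃ p₀ v q₀ O o₁ u o₂ p q, ord = p₀ ++ v :: q₀ ∧ Conflict N p₀ v O o₁ u o₂ p q s

theorem MainState.same {ord o : List ℕ} {s s' : State} {l : List (ℕ × ℕ)}
    (h : MainState n N w ord o s) (hs : SameOutside l s s')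
    (hl : ∀ x ∈ [(0, 1), (1, 7), (1, 8), (0, 40), (0, 41), (0, 27), (0, 30), (0, 32), (1, 3),
      (1, 5), (1, 6), (0, 2), (0, 5), (1, 10), (2, 0), (0, 4)], x ∉ l) :
    MainState n N w ord o s' := by
  have h4 := hs.reg 4 (hl _ (by simp))
  rcases h with ⟨h1, h2, h3⟩ | ⟨h1, p₀, v, q₀, O, o₁, u, o₂, p, q, h2, h3⟩
  · refine Or.inl ⟨h4.trans h1, h2.same hs fun x hx => hl x ?_,
      h3.same hs fun x hx => hl x ?_⟩ <;> simp at hx ⊢ <;> tauto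
  · refine Or.inr ⟨h4.trans h1, p₀, v, q₀, O, o₁, u, o₂, p, q, h2,
      h3.same hs fun x hx => hl x ?_⟩
    simp at hx ⊢; tauto

theorem scanAll_runs (hN : IsNbrs n N) {s : State} (hs : Input n N w s) {ord p₀ q₀ K O : List ℕ}
    {v : ℕ} (hord : ord = p₀ ++ v :: q₀) (hK : ∀ a, a ∈ K ↔ a ∈ N v ∧ a ∈ p₀) (hKn : K.Nodup)
    (h1 : s.reg 1 = K.length) (h2 : Holds (s.arr 2) 0 K) (hO : LexDone N K O s)
    (hv : s.reg 21 = v) (hvn : v < n) (hvpos : s.arr 13 v = p₀.length + 1) (h4 : s.reg 4 = 0)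
    (hb : Best n N w (fun T => T ⊆ p₀.toFinset ∨ T = {v}) s) :
    Runs scanAll s (150 * (K.length * n) + 10) fun s' => MainState n N w ord (p₀ ++ [v]) s' := by
  have hmem : ∀ a, a ∈ O ↔ a ∈ N v ∧ a ∈ p₀ := fun a => by rw [hO.perm.mem_iff, hK]
  have hnd : O.Nodup := hO.perm.nodup_iff.2 hKn
  have hlen := hO.perm.length_eq
  have hKlen : K.length ≤ K.length * n := Nat.le_mul_of_pos_right _ (by omega)
  refine Runs.block_seq (T₂ := 150 * (K.length * n) + 8) ?_ (by simp; omega)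
  intro s₁ f₁ e₁
  refine Runs.seq (T₁ := 143 * (K.length * n) + 1) (T₂ := 7 * (K.length * n) + 7)
    (Runs.forEach O (fun o s' => ScanState n N w p₀ v O o s') (fun _ => 140 * n) (by decide)
      (by simp [e₁, Instr.run] : s₁.reg 22 = 0) (by rw [f₁.reg 1 (by decide), h1, hlen, zero_add])
      (by rw [f₁.arr 7 (by decide)]; exact hO.order) ?_ ?_ ?_ ?_ ?_) (by omega)
  · exact fun l s k h => ⟨h.same (sameOutside_update _ _ _) (by decide),
      h.same (sameOutside_update _ _ _) (by decide)⟩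
  · refine Or.inl ⟨by rw [f₁.reg 4 (by decide), h4], hO.ready.same f₁ (by decide),
      (hb.same f₁ (by decide)).mono ?_, by simp⟩
    -- As long as no vertex of `O` has been processed, the only admitted clique containing `v` is
    -- `{v}`, which `recordVertex` has treated.
    rintro T (hT | ⟨hvT, hT⟩) -
    · exact Or.inl hT
    · right
      refine Finset.Subset.antisymm (by simpa using hT) (by simpa using hvT)
  · intro o u o₂ s₂ hl f₂ _ h23 hst
    have g₂ := (f₁.mono (l' := (0, 22) :: (0, 23) :: scanVertex.locs) (by decide)).trans f₂
    exact scanVertex_runs hN (hs.same g₂ (by decide)) hl hmem hnd hO.lex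
      (by rw [g₂.reg 1 (by decide), h1, hlen]) (by rw [g₂.arr 7 (by decide)]; exact hO.order)
      (by rw [g₂.arr 8 (by decide)]; exact funext hO.num) h23
      (by rw [g₂.reg 21 (by decide), hv]) hvn (by rw [g₂.arr 13 (by decide), hvpos]) hst
  · rw [List.map_const', List.sum_replicate, hlen, smul_eq_mul]
    have : K.length * (140 * n + 3) = 140 * (K.length * n) + 3 * K.length := by ring
    omega
  · intro s₂ f₂ hst _
    have g₂ := (f₁.mono (l' := (0, 22) :: (0, 23) :: scanVertex.locs) (by decide)).trans f₂
    have hs₂ := hs.same g₂ (by decide)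
    refine Runs.cond (T := 7 * (K.length * n) + 6) (fun hc => ?_) (fun hc => Runs.skip ?_ (by omega))
      (by omega)
    · have h4' : s₂.reg 4 = 0 := by rw [show s₂.reg 4 = s₂.reg 3 from hc, hs₂.zero]
      rcases hst with ⟨-, hready, hbest, -⟩ | ⟨h, -⟩
      swap
      · omega
      refine Runs.block_seq (T₂ := 7 * (K.length * n) + 4) ?_ (by simp; omega)
      intro s₃ f₃ e₃
      have g₃ := g₂.trans (f₃.mono (by decide))
      refine Runs.forEach K (fun l s' => ∀ a, s'.arr 8 a = if a ∈ O ∧ a ∉ l then numOf O a else 0)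
        (fun _ => 2) (by decide) (by simp [e₃, Instr.run] : s₃.reg 22 = 0)
        (by rw [g₃.reg 1 (by decide), h1, zero_add]) (by rw [g₃.arr 2 (by decide)]; exact h2)
        (fun l s k h => ⟨h, h⟩) ?_ ?_ (by simp; omega) ?_
      · intro a
        rw [g₃.arr 8 (by decide), hO.num]
        simp [numOf]
      · intro l₁ a l₂ s₄ hl f₄ _ h26 hI
        refine Runs.block' ?_ (by simp)
        intro s₅ e₅ b
        have hz : s₄.reg 3 = 0 := by rw [f₄.reg 3 (by decide), f₃.reg 3 (by decide), hs₂.zero]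
        have : s₅.arr 8 = Function.update (s₄.arr 8) a 0 := by simp [e₅, Instr.run, h26, hz]
        rw [this, Function.update_apply]
        by_cases hba : b = a
        · simp [hba]
        · rw [if_neg hba, hI]; simp [hba]
      · intro s₄ f₄ h8
        refine Or.inl ⟨by rw [f₄.reg 4 (by decide), f₃.reg 4 (by decide), h4'],
          ⟨(hready.same f₃ (by decide)).same f₄ (by decide), fun a => ?_⟩,
          ((hbest.same f₃ (by decide)).same f₄ (by decide)).mono ?_⟩
        · rw [h8, if_neg]
          rw [hO.perm.mem_iff]; tauto
        · intro T hT hTc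
          -- All other vertices of a clique through `v` are neighbours of `v` in `p₀`, hence in `O`.
          -- So the cliques treated are all cliques in `p₀` and `v`.
          by_cases hvT : v ∈ T
          · refine Or.inr ⟨hvT, fun a ha => ?_⟩
            by_cases hav : a = v
            · simp [hav]
            · have := hT ha
              simp [hav] at this
              simp only [Finset.mem_insert, List.mem_toFinset]
              exact Or.inr ((hmem a).2 ⟨hTc a ha v hvT hav, this⟩)
          · left
            intro a ha
            have hav : a ≠ v := fun hh => hvT (hh ▸ ha)
            have := hT ha
            simpa [hav] using this
    · rcases hst with ⟨h, -⟩ | ⟨h, o₁, u, o₂, p, q, hcf⟩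
      · exact absurd (show s₂.reg 4 = s₂.reg 3 by rw [h, hs₂.zero]) hc
      · exact Or.inr ⟨h, p₀, v, q₀, O, o₁, u, o₂, p, q, hord, hcf⟩

/-- The work is charged to the degree of `v`, with a factor `n`. Its sum over all vertices is then
of order `nm`, apart from a constant for each vertex. -/
theorem processVertex_runs (hN : IsNbrs n N) {s : State} (hs : Input n N w s)
    {ord p₀ q₀ : List ℕ} {v : ℕ} (hperm : ord.Perm (List.range n)) (hord : ord = p₀ ++ v :: q₀)
    (hpos : ∀ a ∈ ord, s.arr 13 a = ord.idxOf a + 1) (hv : s.reg 21 = v)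
    (h : MainState n N w ord p₀ s) :
    Runs processVertex s (280 * ((N v).length * n) + 60) fun s' =>
      MainState n N w ord (p₀ ++ [v]) s' := by
  have hmemord : ∀ a, a ∈ ord ↔ a < n := fun a => by rw [hperm.mem_iff]; simp
  have hvord : v ∈ ord := by rw [hord]; simp
  have hvn : v < n := (hmemord v).1 hvord
  have hd : (N v).length ≤ (N v).length * n := Nat.le_mul_of_pos_right _ (by omega)
  refine Runs.cond (T := 280 * ((N v).length * n) + 59) (fun hc => ?_)
    (fun hc => Runs.skip ?_ (by omega)) (by omega)
  swap
  · rcases h with ⟨h1, -⟩ | h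
    · exact absurd (show s.reg 4 = s.reg 3 by rw [h1, hs.zero]) hc
    · exact Or.inr h
  have h4 : s.reg 4 = 0 := by rw [show s.reg 4 = s.reg 3 from hc, hs.zero]
  rcases h with ⟨-, hready, hbest⟩ | ⟨h1, -⟩
  swap
  · omega
  have hnd : ord.Nodup := hperm.nodup_iff.2 List.nodup_range
  have hvp : v ∉ p₀ := fun hh => by
    rw [hord] at hnd
    exact (List.nodup_append.1 hnd).2.2 v hh v (by simp) rfl
  have hvpos : s.arr 13 v = p₀.length + 1 := by
    rw [hpos v hvord, hord, List.idxOf_append_of_notMem hvp]; simp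
  refine Runs.seq (T₁ := 10 * (N v).length + 10) (T₂ := 270 * ((N v).length * n) + 49)
    (Runs.mono (earlierNbrs_runs hs hv hvn) le_rfl ?_) (by omega)
  rintro s₁ f₁ ⟨hlen, hlist⟩ -
  set K := (N v).filter fun a => s.arr 13 a < s.arr 13 v with hKdef
  have hK : ∀ a, a ∈ K ↔ a ∈ N v ∧ a ∈ p₀ := by
    intro a
    rw [hKdef, List.mem_filter, decide_eq_true_eq]
    refine and_congr_right fun ha => ?_
    have haord := (hmemord a).2 (hN.lt ha)
    rw [hpos a haord, hpos v hvord, hord, List.mem_iff_idxOf_lt (q := q₀) hvp a]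
    omega
  have hKn : K.Nodup := (hN.nodup v).filter _
  have hKle : K.length ≤ (N v).length := List.length_filter_le _ _
  have hKle' : K.length * n ≤ (N v).length * n := Nat.mul_le_mul_right _ hKle
  refine Runs.seq (T₁ := 10) (T₂ := 270 * ((N v).length * n) + 39)
    (Runs.mono (recordVertex_runs (hs.same f₁ (by decide)) (by rw [f₁.reg 21 (by decide), hv]) hvn
      (hbest.same f₁ (by decide))) le_rfl ?_) (by omega)
  intro s₂ f₂ hb₂ _
  have g₂ := (f₁.mono (l' := processVertex.locs) (by decide)).trans (f₂.mono (by decide))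
  have hready₂ := (hready.same f₁ (by decide)).same f₂ (by decide)
  refine Runs.seq (T₁ := 120 * (K.length * n) + 10) (T₂ := 150 * (K.length * n) + 10)
    (Runs.mono (lexBFS_runs hN (hs.same g₂ (by decide)) hKn (fun a ha => hN.lt ((hK a).1 ha).1)
      (by rw [f₂.reg 1 (by decide), hlen]) (by rw [f₂.arr 2 (by decide)]; exact hlist)
      hready₂.lex hready₂.num) le_rfl ?_) (by omega)
  rintro s₃ f₃ ⟨O, hO⟩ -
  have g₃ := g₂.trans (f₃.mono (l' := processVertex.locs) (by decide))
  exact scanAll_runs hN (hs.same g₃ (by decide)) hord hK hKn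
    (by rw [f₃.reg 1 (by decide), f₂.reg 1 (by decide), hlen])
    (by rw [f₃.arr 2 (by decide), f₂.arr 2 (by decide)]; exact hlist) hO
    (by rw [g₃.reg 21 (by decide), hv]) hvn (by rw [g₃.arr 13 (by decide), hvpos])
    (by rw [f₃.reg 4 (by decide), f₂.reg 4 (by decide), f₁.reg 4 (by decide), h4])
    (hb₂.same f₃ (by decide))

theorem mainLoop_runs (hN : IsNbrs n N) {s : State} (hs : Input n N w s) {ord : List ℕ}
    (hperm : ord.Perm (List.range n)) (hord : OrderIs ord s) (hr : Ready s) (h4 : s.reg 4 = 0)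
    (h5 : s.reg 5 = 0) (h0 : s.wreg 0 = 0) :
    Runs mainLoop s (280 * (n * ∑ v ∈ Finset.range n, (N v).length) + 63 * n + 10) fun s' =>
      MainState n N w ord ord s' := by
  refine Runs.block_seq
    (T₂ := 280 * (n * ∑ v ∈ Finset.range n, (N v).length) + 63 * n + 1) ?_ (by simp; omega)
  intro s₁ f₁ e₁
  have hlen : ord.length = n := by rw [hperm.length_eq]; simp
  have hs₁ := hs.same f₁ (by decide)
  refine Runs.forEach ord (fun o s' => MainState n N w ord o s')
    (fun v => 280 * ((N v).length * n) + 60) (by decide) (by simp [e₁, Instr.run] : s₁.reg 20 = 0)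
    (by rw [hs₁.size, hlen, zero_add]) (by rw [f₁.arr 12 (by decide)]; exact hord.list) ?_ ?_ ?_ ?_
    (fun s' _ h => h)
  · exact fun l s k h => ⟨h.same (sameOutside_update _ _ _) (by decide),
      h.same (sameOutside_update _ _ _) (by decide)⟩
  · refine Or.inl ⟨by rw [f₁.reg 4 (by decide), h4], hr.same f₁ (by decide),
      ⟨[], by simp, by simp, fun a ha => by simp at ha, by rw [f₁.reg 5 (by decide), h5]; rfl,
        fun j hj => by simp at hj, by rw [f₁.wreg 0 (by decide), h0]; simp⟩, ?_⟩
    intro T hT _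
    have : T = ∅ := by simpa using hT
    simp [this]
  · intro p₀ v q₀ s₂ hl f₂ _ h21 hst
    exact processVertex_runs hN (hs₁.same f₂ (by decide)) hperm hl
      (by rw [f₂.arr 13 (by decide), f₁.arr 13 (by decide)]; exact hord.pos) h21 hst
  · have e : (ord.map fun v => 280 * ((N v).length * n) + 60 + 3).sum =
        ∑ v ∈ Finset.range n, (280 * ((N v).length * n) + 60 + 3) := by
      rw [(hperm.map _).sum_eq, ← List.sum_toFinset _ List.nodup_range, List.toFinset_range]
    rw [e, Finset.sum_add_distrib, Finset.sum_add_distrib, ← Finset.mul_sum, ← Finset.sum_mul]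
    simp only [Finset.sum_const, Finset.card_range, smul_eq_mul]
    rw [mul_comm n (∑ v ∈ Finset.range n, (N v).length)]
    omega

end RAM

/-! ### Levels of a breadth-first search -/

section Levels

variable {n : ℕ} {N : ℕ → List ℕ}

/-- The levels of a breadth-first search from `p` in the set `D`, up to level `r`. The level of `p`
is `2`, vertices of `D` that have not been reached have level `1`, the others have level `0`. -/
structure Levels (N : ℕ → List ℕ) (D : ℕ → Prop) (p r : ℕ) (lev par : ℕ → ℕ) : Prop where
  le : ∀ b, lev b ≤ r
  dom : ∀ b, lev b ≠ 0 ↔ D b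
  par : ∀ b, 2 < lev b → lev (par b) + 1 = lev b ∧ b ∈ N (par b)
  root : ∀ b, lev b = 2 ↔ b = p
  step : ∀ a b, 2 ≤ lev a → lev a < r → D b → b ∈ N a → 2 ≤ lev b ∧ lev b ≤ lev a + 1

/-- One round of the search: the vertices of level `r` reach their neighbours of level `1`. The pairs
`A` have been treated. -/
structure Round (N : ℕ → List ℕ) (r : ℕ) (lev par : ℕ → ℕ) (A : ℕ → ℕ → Prop)
    (lev' par' : ℕ → ℕ) : Prop where
  change : ∀ b, lev' b = lev b ∧ par' b = par b ∨
    lev b = 1 ∧ lev' b = r + 1 ∧ lev (par' b) = r ∧ b ∈ N (par' b)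
  done : ∀ a b, A a b → lev a = r → lev' b ≠ 1

theorem Levels.round {D : ℕ → Prop} {p r : ℕ} {lev par lev' par' : ℕ → ℕ}
    (h : Levels N D p r lev par) (hr : 2 ≤ r)
    (h' : Round N r lev par (fun a b => b ∈ N a) lev' par') :
    Levels N D p (r + 1) lev' par' := by
  have keep : ∀ a, lev a ≠ 1 → lev' a = lev a := fun a ha =>
    (h'.change a).elim (fun h => h.1) fun h => absurd h.1 ha
  have hdom : ∀ b, lev' b ≠ 0 ↔ D b := fun b => by
    rw [← h.dom]
    rcases h'.change b with h1 | h1 <;> omega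
  have hle : ∀ b, lev' b ≤ r + 1 := fun b => by
    have := h.le b
    rcases h'.change b with h1 | h1 <;> omega
  refine ⟨hle, hdom, fun b hb => ?_, fun b => ?_, fun a b ha har hb hab => ?_⟩
  · rcases h'.change b with ⟨h1, h2⟩ | ⟨h1, h2, h3, h4⟩
    · rw [h1] at hb ⊢
      rw [h2]
      have := h.par b hb
      rw [keep _ (by omega)]
      exact this
    · rw [keep _ (by omega)]
      exact ⟨by omega, h4⟩
  · rw [← h.root]
    rcases h'.change b with h1 | h1 <;> omega
  · have ha' : lev' a = lev a := by rcases h'.change a with h1 | h1 <;> omega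
    rw [ha'] at ha har ⊢
    rcases Nat.lt_or_ge (lev a) r with hlt | hge
    · have := h.step a b ha hlt hb hab
      rw [keep _ (by omega)]
      exact this
    · have h1 := h'.done a b hab (by omega)
      have h2 := (hdom b).2 hb
      have h3 := hle b
      omega

/-- No vertex of `D` remains to be reached. -/
def Saturated (N : ℕ → List ℕ) (D : ℕ → Prop) (lev : ℕ → ℕ) : Prop :=
  ∀ a b, 2 ≤ lev a → D b → b ∈ N a → 2 ≤ lev b

/-- As long as some vertex can still be reached, a round reaches a new one. The number of rounds is
thus bounded by the size of `O`, and idle rounds at the end are harmless. -/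
theorem Levels.round_grows {D : ℕ → Prop} {p r : ℕ} {lev par lev' par' : ℕ → ℕ} {O : Finset ℕ}
    (h : Levels N D p r lev par) (hr : 2 ≤ r) (hO : ∀ b, D b → b ∈ O)
    (h' : Round N r lev par (fun a b => b ∈ N a) lev' par')
    (hg : Saturated N D lev ∨ r ≤ (O.filter fun b => 2 ≤ lev b).card + 1) :
    Saturated N D lev' ∨ r + 1 ≤ (O.filter fun b => 2 ≤ lev' b).card + 1 := by
  by_cases hs : Saturated N D lev
  · left
    have : lev' = lev := by
      funext b
      rcases h'.change b with h1 | ⟨h1, h2, h3, h4⟩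
      · exact h1.1
      · have := hs _ b (by omega) ((h.dom b).1 (by omega)) h4
        omega
    rwa [this]
  · right
    have hc := hg.resolve_left hs
    unfold Saturated at hs
    push Not at hs
    obtain ⟨a, b, ha, hb, hab, hlb⟩ := hs
    have hb0 := (h.dom b).2 hb
    have har : lev a = r := by
      have h1 := h.le a
      by_contra hne
      have := h.step a b ha (by omega) hb hab
      omega
    have hb' : 2 ≤ lev' b := by
      have h1 := h'.done a b hab har
      rcases h'.change b with h2 | h2 <;> omega
    have hss : (O.filter fun b => 2 ≤ lev b) ⊂ O.filter fun b => 2 ≤ lev' b := by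
      rw [Finset.ssubset_iff_of_subset]
      · exact ⟨b, by simp [hO b hb, hb'], by simp; omega⟩
      · intro x hx
        rw [Finset.mem_filter] at hx ⊢
        refine ⟨hx.1, ?_⟩
        rcases h'.change x with h2 | h2 <;> omega
    have := Finset.card_lt_card hss
    omega

/-- Along parents the level drops by exactly one, and no edge of the search skips a level. So the
path has no chords. -/
theorem Levels.path {D : ℕ → Prop} {p r : ℕ} {lev par : ℕ → ℕ} (hN : RAM.IsNbrs n N)
    (h : Levels N D p r lev par) : ∀ (k x : ℕ), lev x = k + 2 →
    IndPath hN.graph (List.iterate par x (k + 1)) ∧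
      (List.iterate par x (k + 1)).getLast? = some p ∧
      ∀ y ∈ List.iterate par x (k + 1), 2 ≤ lev y ∧ (y = x ∨ lev y < lev x)
  | 0, x, hx => by
    have hxp := (h.root x).1 hx
    simp [List.iterate, IndPath, hxp, (h.root p).2 rfl]
  | k + 1, x, hx => by
    obtain ⟨h1, h2⟩ := h.par x (by omega)
    obtain ⟨i1, i2, i3⟩ := h.path hN k (par x) (by omega)
    have hhead : (List.iterate par (par x) (k + 1)).head? = some (par x) := rfl
    refine ⟨?_, ?_, ?_⟩
    · rw [List.iterate, IndPath.cons_iff]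
      refine ⟨i1, fun y hy => ⟨?_, ?_⟩⟩
      · rintro rfl
        rcases (i3 _ hy).2 with h3 | h3
        · rw [← h3] at h1; omega
        · omega
      · rw [hhead]
        constructor
        · intro hxy
          by_contra hne
          obtain ⟨h3, h4⟩ := i3 y hy
          have h5 := h4.resolve_left fun hh => hne (by rw [hh])
          have h6 := h.le x
          have := h.step y x h3 (by omega) ((h.dom x).1 (by omega)) hxy
          omega
        · intro hxy
          obtain rfl := Option.some.inj hxy
          exact h2
    · rw [List.iterate, List.getLast?_cons, i2]
      rfl
    · intro y hy
      rw [List.iterate] at hy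
      rcases List.mem_cons.1 hy with rfl | hy
      · exact ⟨by omega, Or.inl rfl⟩
      · obtain ⟨h3, h4⟩ := i3 y hy
        refine ⟨h3, Or.inr ?_⟩
        rcases h4 with rfl | h4 <;> omega

end Levels

namespace RAM

variable {n : ℕ} {N : ℕ → List ℕ} {w : ℕ → ℝ≥0}

/-! ### From a failed test to a hole. -/

section Conflict

variable {p₀ O o₁ o₂ : List ℕ} {v u p q : ℕ} {s : State}

/-- The vertices in which the search from `p` takes place. -/
def Conflict.dom (N : ℕ → List ℕ) (o₁ : List ℕ) (u p q a : ℕ) : Prop :=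
  a ∈ o₁ ∧ a ∉ N u ∨ a = p ∨ a = q

theorem Conflict.u_notMem (h : Conflict N p₀ v O o₁ u o₂ p q s) : u ∉ o₁ := fun hh => by
  have := h.nodup
  rw [h.split] at this
  exact (List.nodup_append.1 this).2.2 u hh u (by simp) rfl

theorem Conflict.dom_mem (h : Conflict N p₀ v O o₁ u o₂ p q s) {a : ℕ}
    (ha : Conflict.dom N o₁ u p q a) : a ∈ o₁ := by
  rcases ha with ha | rfl | rfl
  · exact ha.1
  · exact h.hp.1
  · exact h.hq.1

/-- Apply `LexRule.exists_conn` to the ordering up to `u`. Since `p` and `q` miss each other, both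
have neighbours in one connected set of non-neighbours of `u`. The search from `p` enters this set,
exhausts it and leaves it to `q`. -/
theorem Conflict.reached (hN : IsNbrs n N) (h : Conflict N p₀ v O o₁ u o₂ p q s) {r : ℕ}
    {lev par : ℕ → ℕ} (hl : Levels N (Conflict.dom N o₁ u p q) p r lev par)
    (hs : Saturated N (Conflict.dom N o₁ u p q) lev) : 2 ≤ lev q := by
  classical
  set o := o₁ ++ [u] with ho
  have hsplit : O = o ++ o₂ := by rw [h.split]; simp [ho]
  have hnd : o.Nodup := by
    have := h.nodup
    rw [hsplit] at this
    exact (List.nodup_append.1 this).1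
  have hlex : LexList N o := by
    have := h.lex
    rw [hsplit] at this
    exact this.of_append
  obtain ⟨C, hCB, hC, hCu, hatt⟩ := (hlex.lexRule hN hnd).exists_conn
    (fun x hx y _ hxy => (List.idxOf_inj (List.mem_toFinset.1 hx)).1 hxy) (z := u) (by simp [ho])
    (fun x hx hxu => by
      have hx' : x ∈ o₁ := by simpa [ho, hxu] using hx
      exact (List.mem_iff_idxOf_lt (q := []) h.u_notMem x).1 hx')
    (p := p) (q := q) (by simp [ho, h.hp.1]) (by simp [ho, h.hq.1]) (hN.symm h.hp.2)
    (hN.symm h.hq.2) h.hpq.1 (fun hh => h.hpq.2 (hN.symm hh))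
  have hCD : ∀ c ∈ C, Conflict.dom N o₁ u p q c := fun c hc => by
    have h1 := hCB hc
    obtain ⟨h2, h3⟩ := hCu c hc
    exact Or.inl ⟨by simpa [ho, h2] using h1, fun hh => h3 (hN.symm hh)⟩
  obtain ⟨c, hc, hcp⟩ := hatt p (by simp [ho, h.hp.1]) (hN.symm h.hp.2)
    ⟨q, by simp [ho, h.hq.1], hN.symm h.hq.2, h.hpq.1.symm, h.hpq.2⟩
  obtain ⟨d, hd, hdq⟩ := hatt q (by simp [ho, h.hq.1]) (hN.symm h.hq.2)
    ⟨p, by simp [ho, h.hp.1], hN.symm h.hp.2, h.hpq.1, fun hh => h.hpq.2 (hN.symm hh)⟩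
  have hp2 : lev p = 2 := (hl.root p).2 rfl
  have hc2 : 2 ≤ lev c := hs p c (by omega) (hCD c hc) hcp
  have hall : C.filter (fun x => 2 ≤ lev x) = C := by
    by_contra hne
    obtain ⟨a, ha, b, hb, hb', hab⟩ := hC.2 _ (Finset.filter_subset _ _)
      ⟨c, Finset.mem_filter.2 ⟨hc, hc2⟩⟩ hne
    exact hb' (Finset.mem_filter.2 ⟨hb, hs a b (Finset.mem_filter.1 ha).2 (hCD b hb)
      (hN.symm hab)⟩)
  have hd2 : 2 ≤ lev d := (Finset.mem_filter.1 (by rw [hall]; exact hd : d ∈ _)).2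
  exact hs d q hd2 (Or.inr (Or.inr rfl)) (hN.symm hdq)

/-- In the domain of the search the only neighbours of `u` are `p` and `q`, the two ends of the
path. The levels `2` and `3` are excluded for `q`, since `q` is neither `p` nor a neighbour of `p`,
so the hole has at least four vertices. -/
theorem Conflict.closes (hN : IsNbrs n N) (h : Conflict N p₀ v O o₁ u o₂ p q s) {r : ℕ}
    {lev par : ℕ → ℕ} (hl : Levels N (Conflict.dom N o₁ u p q) p r lev par) (hq : 2 ≤ lev q) :
    3 ≤ lev q - 1 ∧ Closes hN.graph u (List.iterate par q (lev q - 1)) ∧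
      ∀ y ∈ u :: List.iterate par q (lev q - 1), y ∈ N v ∧ y ∈ p₀ := by
  have h2 : lev q ≠ 2 := fun hh => h.hpq.1 ((hl.root q).1 hh).symm
  have h3 : lev q ≠ 3 := fun hh => by
    obtain ⟨h1, h2⟩ := hl.par q (by omega)
    rw [(hl.root (par q)).1 (by omega)] at h2
    exact h.hpq.2 h2
  obtain ⟨i1, i2, i3⟩ := hl.path hN (lev q - 2) q (by omega)
  have e : lev q - 2 + 1 = lev q - 1 := by omega
  rw [e] at i1 i2 i3
  have hdom : ∀ y ∈ List.iterate par q (lev q - 1), Conflict.dom N o₁ u p q y := fun y hy => by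
    have := (i3 y hy).1
    exact (hl.dom y).1 (by omega)
  have hhead : (List.iterate par q (lev q - 1)).head? = some q := by
    rw [← e]; rfl
  have hO : ∀ y ∈ o₁, y ∈ O := fun y hy => by rw [h.split]; simp [hy]
  refine ⟨by omega, ⟨i1, by rw [List.length_iterate]; omega, fun y hy => ⟨?_, ?_⟩⟩, ?_⟩
  · rintro rfl
    exact h.u_notMem (h.dom_mem (hdom _ hy))
  · rw [hhead, i2]
    constructor
    · intro huy
      rcases hdom y hy with h4 | rfl | rfl
      · exact absurd (hN.symm huy) h4.2
      · exact Or.inr rfl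
      · exact Or.inl rfl
    · rintro (hh | hh) <;> obtain rfl := Option.some.inj hh
      · exact hN.symm h.hq.2
      · exact hN.symm h.hp.2
  · intro y hy
    rw [← h.mem]
    rcases List.mem_cons.1 hy with rfl | hy
    · rw [h.split]; simp
    · exact hO y (h.dom_mem (hdom y hy))

end Conflict

/-! ### The search for a hole -/

/-- Array `11` becomes the levels at the start of the search. -/
def initLevels : Program :=
  .seq (block [.const 45 1, .const 22 0]) (.seq (forEach 22 1 23 7 (.seq (block [.load 28 8 23])
    (.cond (.lt 28 27) (block [.store 11 23 45]) .skip)))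
    (.seq (nbrLoop 24 25 26 41 (block [.store 11 26 3]))
      (block [.store 11 32 45, .const 29 2, .store 11 30 29])))

def reachNbrs : Program :=
  nbrLoop 24 25 26 23 (.seq (block [.load 28 11 26])
    (.cond (.eq 28 45) (block [.store 11 26 44, .store 14 26 23]) .skip))

/-- One round, for the vertices whose level is in register `42`. -/
def searchRound : Program :=
  .seq (block [.copy 44 42, .inc 44, .const 22 0]) (forEach 22 1 23 7
    (.seq (block [.load 28 11 23]) (.cond (.eq 28 42) reachNbrs .skip)))

def search : Program :=
  .seq (block [.const 42 2, .copy 43 1, .inc 43, .inc 43]) (forRange 42 43 searchRound)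

/-- Append the path from the vertex in register `32` to the output. -/
def emitPath : Program :=
  .seq (block [.copy 46 32, .emit 46, .load 47 11 46, .const 48 2])
    (.loop (.lt 48 47) (block [.load 46 14 46, .emit 46, .load 47 11 46]))

def emitHole : Program :=
  .seq initLevels (.seq search (.seq (block [.emit 41]) emitPath))

variable {p₀ O o₁ o₂ : List ℕ} {v u p q : ℕ}

/-- The order of the writes matters. As neighbours of `u`, the vertices `p` and `q` are cleared with
the others, and only then do they receive their levels. -/
theorem initLevels_runs (hN : IsNbrs n N) {s : State} (hs : Input n N w s)
    (h : Conflict N p₀ v O o₁ u o₂ p q s) (h11 : ∀ a, s.arr 11 a = 0) :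
    Runs initLevels s (10 * O.length + 10 * (N u).length + 20) fun s' => s'.reg 45 = 1 ∧
      Levels N (Conflict.dom N o₁ u p q) p 2 (s'.arr 11) (s'.arr 14) := by
  have hun : u < n := hN.lt (hN.symm h.hp.2)
  refine Runs.block_seq (T₂ := 10 * O.length + 10 * (N u).length + 17) ?_ (by simp; omega)
  intro s₁ f₁ e₁
  refine Runs.seq (T₁ := 10 * O.length + 1) (T₂ := 10 * (N u).length + 16)
    (Runs.forEach O (fun l s' => ∀ a, s'.arr 11 a = if a ∈ l ∧ a ∈ o₁ then 1 else 0) (fun _ => 6)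
      (by decide) (by simp [e₁, Instr.run] : s₁.reg 22 = 0)
      (by rw [f₁.reg 1 (by decide), h.len, zero_add])
      (by rw [f₁.arr 7 (by decide)]; exact h.order) (fun l s k h => ⟨h, h⟩)
      (fun a => by rw [f₁.arr 11 (by decide), h11]; simp) ?_ (by simp; omega) ?_) (by omega)
  · intro l₁ a l₂ s₂ hl f₂ _ h23 hI
    refine Runs.block_seq (T₂ := 4) ?_ (by simp)
    intro s₃ f₃ e₃
    have haO : a ∈ O := by rw [hl]; simp
    have hb : (Test.lt 28 27).Holds s₃ ↔ a ∈ o₁ := by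
      have e1 : s₃.reg 28 = numOf O a := by
        simp [e₃, Instr.run, h23, f₂.arr 8 (by decide), f₁.arr 8 (by decide), h.num]
      have e2 : s₃.reg 27 = numOf O u := by
        rw [f₃.reg 27 (by decide), f₂.reg 27 (by decide), f₁.reg 27 (by decide), h.reg27, h.split,
          numOf_eq h.u_notMem]
      have e3 := numOf_lt_iff (o₂ := o₂) h.u_notMem a
      rw [← h.split, numOf_pos] at e3
      rw [Test.Holds, e1, e2, ← e3]
      simp [haO]
    have h11₃ : s₃.arr 11 = s₂.arr 11 := f₃.arr 11 (by decide)
    refine Runs.cond (T := 3) (fun hc => Runs.block' ?_ (by simp))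
      (fun hc => Runs.skip ?_ (by simp)) (by omega)
    · intro s₄ e₄ b
      rw [hb] at hc
      have : s₄.arr 11 = Function.update (s₂.arr 11) a 1 := by
        simp [e₄, Instr.run, h11₃, f₃.reg 23 (by decide), h23, f₃.reg 45 (by decide),
          f₂.reg 45 (by decide), e₁]
      rw [this, Function.update_apply]
      by_cases hba : b = a
      · simp [hba, hc]
      · rw [if_neg hba, hI]; simp [hba]
    · intro b
      rw [hb] at hc
      rw [h11₃, hI]
      by_cases hba : b = a
      · simp [hba, hc]
      · simp [hba]
  · intro s₂ f₂ hl₂ _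
    have g₂ := (f₁.mono (l' := initLevels.locs) (by decide)).trans (f₂.mono (by decide))
    have hs₂ := hs.same g₂ (by decide)
    refine Runs.seq (T₁ := 10 * (N u).length + 6) (T₂ := 10)
      (Runs.nbrLoop (fun l s' => ∀ a, s'.arr 11 a = if a ∈ o₁ ∧ a ∉ l then 1 else 0) 2 hs₂
        (by rw [g₂.reg 41 (by decide), h.reg41]) hun (by decide) (by decide)
        (fun l s' k h => ⟨h, h, h⟩) ?_ ?_ (by omega) ?_) (by omega)
    · intro a
      rw [hl₂]
      have : a ∈ o₁ → a ∈ O := fun ha => by rw [h.split]; simp [ha]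
      simp
      by_cases ha : a ∈ o₁ <;> simp [ha, this]
    · intro l₁ a l₂ s₃ _ f₃ h26 hI
      refine Runs.block' ?_ (by simp)
      intro s₄ e₄ b
      have : s₄.arr 11 = Function.update (s₃.arr 11) a 0 := by
        simp [e₄, Instr.run, h26, (hs₂.same f₃ (by decide)).zero]
      rw [this, Function.update_apply]
      by_cases hba : b = a
      · simp [hba]
      · rw [if_neg hba, hI]; simp [hba]
    · intro s₃ f₃ hl₃ _
      have g₃ := g₂.trans (f₃.mono (l' := initLevels.locs) (by decide))
      have h45 : s₃.reg 45 = 1 := by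
        rw [f₃.reg 45 (by decide), f₂.reg 45 (by decide)]; simp [e₁, Instr.run]
      refine Runs.block' ?_ (by simp)
      intro s₄ e₄
      have hlev : ∀ a, s₄.arr 11 a =
          if a = p then 2 else if a = q then 1 else if a ∈ o₁ ∧ a ∉ N u then 1 else 0 := by
        intro a
        have : s₄.arr 11 = Function.update (Function.update (s₃.arr 11) q 1) p 2 := by
          simp [e₄, Instr.run, h45, g₃.reg 32 (by decide), g₃.reg 30 (by decide), h.reg30, h.reg32]
        rw [this, Function.update_apply, Function.update_apply, hl₃]
      have hle : ∀ a, s₄.arr 11 a ≤ 2 := fun a => by rw [hlev]; split_ifs <;> omega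
      refine ⟨by simp [e₄, Instr.run, h45], hle, fun b => ?_, fun b hb => ?_, fun b => ?_,
        fun a b ha har => by omega⟩
      · rw [hlev, Conflict.dom]
        split_ifs <;> simp_all
      · have := hle b; omega
      · rw [hlev]
        split_ifs <;> simp_all

theorem reachNbrs_runs {s : State} (hs : Input n N w s) {r a : ℕ} {o : List ℕ}
    {lev par : ℕ → ℕ} (h45 : s.reg 45 = 1) (h44 : s.reg 44 = r + 1) (h23 : s.reg 23 = a)
    (han : a < n) (hr : 2 ≤ r) (ha : lev a = r)
    (hR : Round N r lev par (fun a b => a ∈ o ∧ b ∈ N a) (s.arr 11) (s.arr 14)) :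
    Runs reachNbrs s (10 * (N a).length + 6) fun s' =>
      Round N r lev par (fun x b => x ∈ o ++ [a] ∧ b ∈ N x) (s'.arr 11) (s'.arr 14) := by
  refine Runs.nbrLoop (fun l s' => Round N r lev par
    (fun x b => x ∈ o ∧ b ∈ N x ∨ x = a ∧ b ∈ l) (s'.arr 11) (s'.arr 14)) 6 hs h23 han (by decide)
    (by decide) (fun l s' k h => ⟨h, h, h⟩) ?_ ?_ (by omega) ?_
  · exact ⟨hR.change, fun x b hx => hR.done x b (by simpa using hx)⟩
  · intro l₁ b l₂ s₁ hl f₁ h26 hI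
    have hab : b ∈ N a := by rw [hl]; simp
    refine Runs.block_seq (T₂ := 4) ?_ (by simp)
    intro s₂ f₂ e₂
    have hb : (Test.eq 28 45).Holds s₂ ↔ s₁.arr 11 b = 1 := by
      simp [e₂, Instr.run, Test.Holds, h26, f₁.reg 45 (by decide), h45]
    have g11 : s₂.arr 11 = s₁.arr 11 := f₂.arr 11 (by decide)
    have g14 : s₂.arr 14 = s₁.arr 14 := f₂.arr 14 (by decide)
    refine Runs.cond (T := 3) (fun hc => Runs.block' ?_ (by simp))
      (fun hc => Runs.skip ?_ (by simp)) (by omega)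
    · intro s₃ e₃
      rw [hb] at hc
      have h26' : s₂.reg 26 = b := by rw [f₂.reg 26 (by decide), h26]
      have k11 : s₃.arr 11 = Function.update (s₁.arr 11) b (r + 1) := by
        simp [e₃, Instr.run, h26', g11, f₂.reg 44 (by decide), f₁.reg 44 (by decide), h44]
      have k14 : s₃.arr 14 = Function.update (s₁.arr 14) b a := by
        simp [e₃, Instr.run, h26', g14, f₂.reg 23 (by decide), f₁.reg 23 (by decide), h23]
      rw [k11, k14]
      refine ⟨fun x => ?_, fun x c hx hxr => ?_⟩
      · by_cases hxb : x = b
        · subst hxb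
          right
          rw [Function.update_self, Function.update_self]
          refine ⟨?_, rfl, ha, hab⟩
          rcases hI.change x with h1 | h1 <;> omega
        · rw [Function.update_of_ne hxb, Function.update_of_ne hxb]
          exact hI.change x
      · by_cases hcb : c = b
        · rw [hcb, Function.update_self]; omega
        · rw [Function.update_of_ne hcb]
          refine hI.done x c ?_ hxr
          simpa [hcb] using hx
    · rw [hb] at hc
      rw [g11, g14]
      refine ⟨hI.change, fun x c hx hxr => ?_⟩
      by_cases hcb : c = b
      · rw [hcb]; exact hc
      · refine hI.done x c ?_ hxr
        simpa [hcb] using hx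
  · intro s' _ h
    refine ⟨h.change, fun x b hx => h.done x b ?_⟩
    rcases hx with ⟨hx, hb⟩
    rcases List.mem_append.1 hx with hx | hx
    · exact Or.inl ⟨hx, hb⟩
    · rw [List.mem_singleton] at hx
      exact Or.inr ⟨hx, hx ▸ hb⟩

theorem searchRound_runs {s : State} (hs : Input n N w s) {r : ℕ} (h1 : s.reg 1 = O.length)
    (hO : Holds (s.arr 7) 0 O) (hOn : ∀ a ∈ O, a < n) (h42 : s.reg 42 = r) (h45 : s.reg 45 = 1)
    (hr : 2 ≤ r) (hdom : ∀ a, s.arr 11 a = r → a ∈ O) :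
    Runs searchRound s ((O.map fun a => 10 * (N a).length + 13).sum + 5) fun s' =>
      Round N r (s.arr 11) (s.arr 14) (fun a b => b ∈ N a) (s'.arr 11) (s'.arr 14) := by
  refine Runs.block_seq (T₂ := (O.map fun a => 10 * (N a).length + 13).sum + 1) ?_
    (by simp; omega)
  intro s₁ f₁ e₁
  refine Runs.forEach O (fun o s' => Round N r (s.arr 11) (s.arr 14)
    (fun a b => a ∈ o ∧ b ∈ N a) (s'.arr 11) (s'.arr 14)) (fun a => 10 * (N a).length + 10)
    (by decide) (by simp [e₁, Instr.run] : s₁.reg 22 = 0)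
    (by rw [f₁.reg 1 (by decide), h1, zero_add]) (by rw [f₁.arr 7 (by decide)]; exact hO)
    (fun l s k h => ⟨h, h⟩) ?_ ?_ le_rfl ?_
  · rw [f₁.arr 11 (by decide), f₁.arr 14 (by decide)]
    exact ⟨fun b => Or.inl ⟨rfl, rfl⟩, fun a b h => by simp at h⟩
  · intro o a o' s₂ hl f₂ _ h23 hI
    have han : a < n := hOn a (by rw [hl]; simp)
    have g₂ := (f₁.mono (l' := searchRound.locs) (by decide)).trans (f₂.mono (by decide))
    refine Runs.block_seq (T₂ := 10 * (N a).length + 8) ?_ (by simp; omega)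
    intro s₃ f₃ e₃
    have g₃ := g₂.trans (f₃.mono (by decide))
    have g11 : s₃.arr 11 = s₂.arr 11 := f₃.arr 11 (by decide)
    have g14 : s₃.arr 14 = s₂.arr 14 := f₃.arr 14 (by decide)
    have hb : (Test.eq 28 42).Holds s₃ ↔ s.arr 11 a = r := by
      have : (Test.eq 28 42).Holds s₃ ↔ s₂.arr 11 a = r := by
        simp [e₃, Instr.run, Test.Holds, h23, g₂.reg 42 (by decide), h42]
      rw [this]
      rcases hI.change a with h1 | h1 <;> omega
    refine Runs.cond (T := 10 * (N a).length + 6) (fun hc => ?_)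
      (fun hc => Runs.skip ?_ (by omega)) (by omega)
    · rw [hb] at hc
      refine reachNbrs_runs (hs.same g₃ (by decide)) (by rw [g₃.reg 45 (by decide), h45]) ?_
        (by rw [f₃.reg 23 (by decide), h23]) han hr hc (by rw [g11, g14]; exact hI)
      rw [f₃.reg 44 (by decide), f₂.reg 44 (by decide)]
      simp [e₁, Instr.run, h42]
    · rw [hb] at hc
      rw [g11, g14]
      refine ⟨hI.change, fun x b hx hxr => hI.done x b ⟨?_, hx.2⟩ hxr⟩
      rcases List.mem_append.1 hx.1 with h | h
      · exact h
      · rw [List.mem_singleton.1 h] at hxr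
        exact absurd hxr hc
  · intro s' _ h
    exact ⟨h.change, fun a b hab har => h.done a b ⟨hdom a har, hab⟩ har⟩

theorem search_runs {s : State} (hs : Input n N w s) {D : ℕ → Prop}
    (h1 : s.reg 1 = O.length) (hO : Holds (s.arr 7) 0 O) (hOn : ∀ a ∈ O, a < n)
    (h45 : s.reg 45 = 1) (hD : ∀ a, D a → a ∈ O)
    (hl : Levels N D p 2 (s.arr 11) (s.arr 14)) :
    Runs search s (O.length * ((O.map fun a => 10 * (N a).length + 13).sum + 7) + 6) fun s' =>
      Levels N D p (O.length + 2) (s'.arr 11) (s'.arr 14) ∧ Saturated N D (s'.arr 11) := by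
  refine Runs.block_seq (T₂ := O.length * ((O.map fun a => 10 * (N a).length + 13).sum + 7) + 1) ?_
    (by simp; omega)
  intro s₁ f₁ e₁
  refine Runs.forRange (fun r s' => Levels N D p r (s'.arr 11) (s'.arr 14) ∧
    (Saturated N D (s'.arr 11) ∨ r ≤ (O.toFinset.filter fun b => 2 ≤ s'.arr 11 b).card + 1))
    (fun _ => (O.map fun a => 10 * (N a).length + 13).sum + 5) (by decide)
    (by simp [e₁, Instr.run] : s₁.reg 42 = 2) (by simp [e₁, Instr.run, h1] : s₁.reg 43 =
      O.length + 2) (by omega) (fun r s k h => h) ?_ ?_ (by simp) ?_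
  · rw [f₁.arr 11 (by decide), f₁.arr 14 (by decide)]
    refine ⟨hl, Or.inr ?_⟩
    have hp2 := (hl.root p).2 rfl
    have : 0 < (O.toFinset.filter fun b => 2 ≤ s.arr 11 b).card := by
      refine Finset.card_pos.2 ⟨p, Finset.mem_filter.2 ⟨List.mem_toFinset.2 (hD p ?_), ?_⟩⟩
      · exact (hl.dom p).1 (by omega)
      · omega
    omega
  · rintro r s₂ hr - f₂ h42 ⟨hl₂, hg⟩
    have g₂ := (f₁.mono (l' := search.locs) (by decide)).trans (f₂.mono (by decide))
    refine Runs.mono (searchRound_runs (hs.same g₂ (by decide)) (by rw [g₂.reg 1 (by decide), h1])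
      (by rw [g₂.arr 7 (by decide)]; exact hO) hOn h42 (by rw [g₂.reg 45 (by decide), h45]) hr
      (fun a ha => hD a ((hl₂.dom a).1 (by omega)))) le_rfl ?_
    intro s₃ _ hR
    exact ⟨hl₂.round hr hR, hl₂.round_grows hr (fun b hb => List.mem_toFinset.2 (hD b hb)) hR hg⟩
  · rintro s₂ - - ⟨hl₂, hg⟩
    -- If vertices were still to be reached at `r = O.length + 2`, the search would have reached
    -- more than `O.length` vertices, all of them in `O`.
    refine ⟨hl₂, hg.resolve_right fun hh => ?_⟩
    have h1 := Finset.card_filter_le O.toFinset fun b => 2 ≤ s₂.arr 11 b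
    have h2 := O.toFinset_card_le
    omega

theorem emitPath_runs {s : State} {D : ℕ → Prop} {r : ℕ}
    (hl : Levels N D p r (s.arr 11) (s.arr 14)) (h32 : s.reg 32 = q) (hq : 2 ≤ s.arr 11 q) :
    Runs emitPath s (5 * r + 10) fun s' =>
      s'.out = s.out ++ List.iterate (s.arr 14) q (s.arr 11 q - 1) := by
  refine Runs.block_seq (T₂ := 5 * r + 5) ?_ (by simp; omega)
  intro s₁ f₁ e₁
  have hr := hl.le q
  -- Here `k` is the number of steps left to the vertex `p` of level `2`. The output so far followed
  -- by the `k` vertices to come is the same in every round.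
  let I : ℕ → State → Prop := fun k s' => s'.arr 11 = s.arr 11 ∧ s'.arr 14 = s.arr 14 ∧
    s'.reg 48 = 2 ∧ s'.reg 47 = k + 2 ∧ s.arr 11 (s'.reg 46) = k + 2 ∧
    s'.out ++ List.iterate (s.arr 14) (s.arr 14 (s'.reg 46)) k =
      s.out ++ List.iterate (s.arr 14) q (s.arr 11 q - 1)
  have hloop := Runs.loop (b := .lt 48 47) (p := block [.load 46 14 46, .emit 46, .load 47 11 46])
    (c := 4) I ?_ ?_ (s.arr 11 q - 2) s₁ ?_
  · refine Runs.mono hloop (by omega) ?_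
    rintro s₂ _ ⟨hb, k, -, -, h48, h47, -, hout⟩
    simp only [Test.Holds, h48, h47] at hb
    obtain rfl : k = 0 := by omega
    simpa [List.iterate] using hout
  · rintro s' ⟨-, -, h48, h47, -⟩
    simp [Test.Holds, h48, h47]
  · rintro k s' ⟨h11, h14, h48, h47, h46, hout⟩ -
    refine Runs.block' ?_ (by simp)
    intro s₂ e₂
    have hx := (hl.par (s'.reg 46) (by omega)).1
    have k46 : s₂.reg 46 = s.arr 14 (s'.reg 46) := by simp [e₂, Instr.run, h14]
    refine ⟨by simp [e₂, Instr.run, h11], by simp [e₂, Instr.run, h14],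
      by simp [e₂, Instr.run, h48], ?_, by rw [k46]; omega, ?_⟩
    · have : s₂.reg 47 = s.arr 11 (s.arr 14 (s'.reg 46)) := by simp [e₂, Instr.run, h11, h14]
      rw [this]; omega
    · have : s₂.out = s'.out ++ [s.arr 14 (s'.reg 46)] := by simp [e₂, Instr.run, h14]
      rw [← hout, this, k46, List.iterate]
      simp
  · refine ⟨by simp [e₁, Instr.run], by simp [e₁, Instr.run], by simp [e₁, Instr.run], ?_, ?_, ?_⟩
    · simp [e₁, Instr.run, h32]; omega
    · simp [e₁, Instr.run, h32]; omega
    · have e : s.arr 11 q - 1 = s.arr 11 q - 2 + 1 := by omega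
      rw [e, List.iterate]
      simp [e₁, Instr.run, h32]

theorem sum_length_le {K : List ℕ} (hn : K.Nodup) (hK : ∀ a ∈ K, a < n) :
    (K.map fun a => (N a).length).sum ≤ ∑ v ∈ Finset.range n, (N v).length := by
  rw [← List.sum_toFinset _ hn]
  exact Finset.sum_le_sum_of_subset fun a ha => by simpa using hK a (List.mem_toFinset.1 ha)

/-- Every round scans all lists of neighbours of `O`. With at most `n` rounds this remains within
`O(nm)`, because the search is carried out only once. -/
theorem emitHole_runs (hN : IsNbrs n N) {s : State} (hs : Input n N w s)
    (h : Conflict N p₀ v O o₁ u o₂ p q s) (h11 : ∀ a, s.arr 11 a = 0) :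
    Runs emitHole s (30 * (n * ∑ v ∈ Finset.range n, (N v).length) + 40 * n + 80) fun s' =>
      ∃ P, s'.out = s.out ++ u :: P ∧ 3 ≤ P.length ∧ Closes hN.graph u P ∧
        ∀ y ∈ u :: P, y ∈ N v ∧ y ∈ p₀ := by
  set M := ∑ v ∈ Finset.range n, (N v).length with hM
  have hON : ∀ a ∈ O, a ∈ N v := fun a ha => ((h.mem a).1 ha).1
  have hOn : ∀ a ∈ O, a < n := fun a ha => hN.lt (hON a ha)
  have hOlen : O.length ≤ n := by
    have : O.toFinset ⊆ Finset.range n := fun a ha => by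
      simpa using hOn a (List.mem_toFinset.1 ha)
    simpa [List.toFinset_card_of_nodup h.nodup] using Finset.card_le_card this
  have hOM : O.length ≤ M := length_le_sum h.nodup hOn fun a ha =>
    List.ne_nil_of_mem (hN.symm (hON a ha))
  have hcost : (O.map fun a => 10 * (N a).length + 13).sum ≤ 23 * M := by
    have h1 := sum_length_le (N := N) h.nodup hOn
    rw [List.sum_map_add, List.sum_map_mul_left, List.map_const', List.sum_replicate, smul_eq_mul]
    omega
  have hcost' : O.length * ((O.map fun a => 10 * (N a).length + 13).sum + 7) ≤ n * (23 * M + 7) :=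
    Nat.mul_le_mul hOlen (by omega)
  have hcost'' : n * (23 * M + 7) = 23 * (n * M) + 7 * n := by ring
  have hun := hN.length_le u
  refine Runs.seq (T₁ := 10 * O.length + 10 * (N u).length + 20)
    (T₂ := 30 * (n * M) + 20 * n + 60)
    (Runs.mono (initLevels_runs hN hs h h11) le_rfl ?_) (by omega)
  rintro s₁ f₁ ⟨h45, hl₁⟩ -
  have hc₁ := h.same f₁ (by decide)
  refine Runs.seq (T₁ := O.length * ((O.map fun a => 10 * (N a).length + 13).sum + 7) + 6)
    (T₂ := 7 * (n * M) + 13 * n + 50)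
    (Runs.mono (search_runs (hs.same f₁ (by decide)) hc₁.len hc₁.order hOn h45
      (fun a ha => by rw [h.split]; simp [h.dom_mem ha]) hl₁) le_rfl ?_) (by omega)
  rintro s₂ f₂ ⟨hl₂, hsat⟩ -
  have hc₂ := hc₁.same f₂ (by decide)
  have hq := hc₂.reached hN hl₂ hsat
  obtain ⟨c1, c2, c3⟩ := hc₂.closes hN hl₂ hq
  refine Runs.block_seq (T₂ := 5 * (O.length + 2) + 10) ?_ (by simp; omega)
  intro s₃ f₃ e₃
  have g11 : s₃.arr 11 = s₂.arr 11 := f₃.arr 11 (by decide)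
  have g14 : s₃.arr 14 = s₂.arr 14 := f₃.arr 14 (by decide)
  refine Runs.mono (emitPath_runs (s := s₃) (by rw [g11, g14]; exact hl₂)
    (hc₂.same f₃ (by decide)).reg32 (by rw [g11]; exact hq)) le_rfl ?_
  intro s₄ _ hout
  refine ⟨List.iterate (s₂.arr 14) q (s₂.arr 11 q - 1), ?_, by rw [List.length_iterate]; omega,
    c2, c3⟩
  rw [hout, g11, g14]
  simp [e₃, Instr.run, hc₂.reg41, f₂.out (by decide), f₁.out (by decide)]

end RAM

namespace RAM

variable {n : ℕ} {N : ℕ → List ℕ} {w : ℕ → ℝ≥0}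

/-! ### The algorithm -/

/-- Output the list in array `A`, whose length is in register `y`. -/
def emitList (y A : ℕ) : Program :=
  .seq (block [.const 24 0]) (forEach 24 y 26 A (block [.emit 26]))

theorem emitList_runs {y A : ℕ} {s : State} {l : List ℕ} (hy : y ≠ 24 ∧ y ≠ 26)
    (hl : s.reg y = l.length) (hA : Holds (s.arr A) 0 l) :
    Runs (emitList y A) s (5 * l.length + 3) fun s' => s'.out = s.out ++ l := by
  refine Runs.block_seq (T₂ := 5 * l.length + 1) ?_ (by simp; omega)
  intro s₁ f₁ e₁
  refine Runs.forEach l (fun l₁ s' => s'.out = s.out ++ l₁) (fun _ => 2)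
    ⟨by decide, by simp [block, Program.locs, Instr.loc], by simp [block, Program.locs, Instr.loc],
      hy.1.symm, by decide, hy.2⟩
    (by simp [e₁, Instr.run] : s₁.reg 24 = 0)
    (by simp [e₁, Instr.run, hy.1, hl]) (by rw [f₁.arr A (by simp [block, Program.locs, Instr.loc])]; exact hA)
    (fun l s k h => ⟨h, h⟩) (by simp [e₁, Instr.run]) ?_ (by simp; omega) (fun s' _ h => h)
  intro l₁ a l₂ s₂ _ _ _ h26 hI
  refine Runs.block' ?_ (by simp)
  intro s₃ e₃
  simp [e₃, Instr.run, h26, hI]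

def emitCertificate : Program :=
  .seq (block [.const 28 1, .emit 28, .emit 40]) (.seq (emitList 0 12) emitHole)

/-- Compute a maximum-weight clique or a certificate. -/
def cliqueOrHole : Program :=
  .seq lexOrder (.seq mainLoop (.cond (.eq 4 3) (.seq (block [.emit 3]) (emitList 5 10))
    emitCertificate))

/-- The output is a clique of maximum weight. -/
def CliqueOut (n : ℕ) (N : ℕ → List ℕ) (w : ℕ → ℝ≥0) (out : List ℕ) : Prop :=
  ∃ B : List ℕ, B.Nodup ∧ (∀ a ∈ B, a < n) ∧ Cliq N (· ∈ B) ∧ out = 0 :: B ∧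
    ∀ T : Finset ℕ, (∀ a ∈ T, a < n) → Cliq N (· ∈ T) → ∑ a ∈ T, w a ≤ (B.map w).sum

/-- The output is a certificate. -/
def CertificateOut (hN : IsNbrs n N) (out : List ℕ) : Prop :=
  ∃ (p : List ℕ) (v : ℕ) (q : List ℕ) (u : ℕ) (P : List ℕ), (p ++ v :: q).Perm (List.range n) ∧
    LexList N (p ++ v :: q) ∧ out = 1 :: p.length :: ((p ++ v :: q) ++ u :: P) ∧ 3 ≤ P.length ∧
    Closes hN.graph u P ∧ ∀ y ∈ u :: P, y ∈ N v ∧ y ∈ p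

theorem cliqueOrHole_runs (hN : IsNbrs n N) {s : State} (hs : Input n N w s) (hr : Ready s)
    (h4 : s.reg 4 = 0) (h5 : s.reg 5 = 0) (h0 : s.wreg 0 = 0) (h11 : ∀ a, s.arr 11 a = 0)
    (hout : s.out = []) :
    Runs cliqueOrHole s (440 * (n * ∑ v ∈ Finset.range n, (N v).length) + 200 * n + 200) fun s' =>
      CliqueOut n N w s'.out ∨ CertificateOut hN s'.out := by
  set M := ∑ v ∈ Finset.range n, (N v).length with hM
  refine Runs.seq (T₁ := 130 * (n * M) + 40 * n + 20) (T₂ := 310 * (n * M) + 160 * n + 180)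
    (Runs.mono (lexOrder_runs hN hs hr) le_rfl ?_) (by omega)
  rintro s₁ f₁ ⟨ord, hperm, hlex, hord, hr₁⟩ -
  have hlen : ord.length = n := by rw [hperm.length_eq]; simp
  have hs₁ := hs.same f₁ (by decide)
  refine Runs.seq (T₁ := 280 * (n * M) + 63 * n + 10) (T₂ := 30 * (n * M) + 90 * n + 170)
    (Runs.mono (mainLoop_runs hN hs₁ hperm hord hr₁ (by rw [f₁.reg 4 (by decide), h4])
      (by rw [f₁.reg 5 (by decide), h5]) (by rw [f₁.wreg 0 (by decide), h0])) le_rfl ?_) (by omega)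
  rintro s₂ f₂ hmain -
  have hs₂ := hs₁.same f₂ (by decide)
  have hout₂ : s₂.out = [] := by rw [f₂.out (by decide), f₁.out (by decide), hout]
  refine Runs.cond (T := 30 * (n * M) + 90 * n + 169) (fun hc => ?_) (fun hc => ?_) (by omega)
  · rcases hmain with ⟨-, -, ⟨B, b1, b2, b3, b4, b5, b6⟩, hle⟩ | ⟨h, -⟩
    swap
    · have : s₂.reg 4 = s₂.reg 3 := hc
      rw [h, hs₂.zero] at this
      omega
    have hBlen : B.length ≤ n := by
      have : B.toFinset ⊆ Finset.range n := fun a ha => by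
        simpa using b2 a (List.mem_toFinset.1 ha)
      simpa [List.toFinset_card_of_nodup b1] using Finset.card_le_card this
    refine Runs.block_seq (T₂ := 5 * B.length + 3) ?_ (by simp; omega)
    intro s₃ f₃ e₃
    refine Runs.mono (emitList_runs (l := B) (by decide) (by rw [f₃.reg 5 (by decide), b4])
      (by rw [f₃.arr 10 (by decide)]; exact b5)) le_rfl ?_
    intro s₄ _ h
    refine Or.inl ⟨B, b1, b2, b3, ?_, fun T hT hTc => ?_⟩
    · rw [h]; simp [e₃, Instr.run, hout₂, hs₂.zero]
    · rw [← b6]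
      refine hle T (fun a ha => ?_) hTc
      rw [List.mem_toFinset, hperm.mem_iff]
      simpa using hT a ha
  · rcases hmain with ⟨h, -⟩ | ⟨-, p₀, v, q₀, O, o₁, u, o₂, p, q, rfl, hcf⟩
    · exact absurd (show s₂.reg 4 = s₂.reg 3 by rw [h, hs₂.zero]) hc
    refine Runs.block_seq (T₂ := 30 * (n * M) + 90 * n + 165) ?_ (by simp; omega)
    intro s₃ f₃ e₃
    have hs₃ := hs₂.same f₃ (by decide)
    refine Runs.seq (T₁ := 5 * n + 3) (T₂ := 30 * (n * M) + 40 * n + 80)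
      (Runs.mono (emitList_runs (l := p₀ ++ v :: q₀) (by decide) (by rw [hs₃.size, hlen])
        (by rw [f₃.arr 12 (by decide), f₂.arr 12 (by decide)]; exact hord.list))
        (by rw [hlen]) ?_) (by omega)
    intro s₄ f₄ h₄ _
    refine Runs.mono (emitHole_runs hN (hs₃.same f₄ (by decide))
      ((hcf.same f₃ (by decide)).same f₄ (by decide)) (by
        rw [f₄.arr 11 (by decide), f₃.arr 11 (by decide), f₂.arr 11 (by decide),
          f₁.arr 11 (by decide)]; exact h11)) le_rfl ?_
    rintro s₅ _ ⟨P, hP, hP3, hP', hmem⟩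
    refine Or.inr ⟨p₀, v, q₀, u, P, hperm, hlex, ?_, hP3, hP', hmem⟩
    rw [hP, h₄]
    simp [e₃, Instr.run, hout₂, hcf.reg40]

end RAM

/-! ### Input and output -/

section Input

open RAM

variable {n : ℕ}

/-- Lists of neighbours as lists of natural numbers. -/
def natNbrs (L : Fin n → List (Fin n)) (v : ℕ) : List ℕ :=
  if h : v < n then (L ⟨v, h⟩).map Fin.val else []

def natWeight (w : Fin n → ℝ≥0) (v : ℕ) : ℝ≥0 := if h : v < n then w ⟨v, h⟩ else 0

variable {G : SimpleGraph (Fin n)} {L : Fin n → List (Fin n)} (w : Fin n → ℝ≥0)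

theorem natNbrs_val (L : Fin n → List (Fin n)) (v : Fin n) :
    natNbrs L v = (L v).map Fin.val := by
  simp [natNbrs]

theorem IsAdjacencyLists.mem_natNbrs (hL : IsAdjacencyLists G L) (u v : Fin n) :
    u.val ∈ natNbrs L v ↔ G.Adj v u := by
  rw [natNbrs_val, List.mem_map, ← (hL v).2 u]
  exact ⟨fun ⟨a, ha, h⟩ => Fin.ext h ▸ ha, fun h => ⟨u, h, rfl⟩⟩

theorem exists_of_mem_natNbrs {u v : ℕ} (h : u ∈ natNbrs L v) : u < n ∧ v < n := by
  unfold natNbrs at h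
  split_ifs at h with hv
  · obtain ⟨a, -, rfl⟩ := List.mem_map.1 h
    exact ⟨a.2, hv⟩
  · simp at h

theorem IsAdjacencyLists.isNbrs (hL : IsAdjacencyLists G L) : IsNbrs n (natNbrs L) := by
  refine ⟨fun h => (exists_of_mem_natNbrs h).1, fun {u v} h => ?_, fun v h => ?_, fun v => ?_⟩
  · obtain ⟨hu, hv⟩ := exists_of_mem_natNbrs h
    exact (hL.mem_natNbrs ⟨v, hv⟩ ⟨u, hu⟩).2 ((hL.mem_natNbrs ⟨u, hu⟩ ⟨v, hv⟩).1 h).symm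
  · obtain ⟨hv, -⟩ := exists_of_mem_natNbrs h
    exact G.loopless.irrefl _ ((hL.mem_natNbrs ⟨v, hv⟩ ⟨v, hv⟩).1 h)
  · unfold natNbrs
    split_ifs with hv
    · exact (hL ⟨v, hv⟩).1.map Fin.val_injective
    · exact List.nodup_nil

theorem inputState_arr_zero (L : Fin n → List (Fin n)) {k : ℕ} (hk : k ≤ n) :
    (inputState w L).arr 0 k = (((List.finRange n).take k).flatMap L).length := by
  have : ((List.finRange n).take k).toFinset = Finset.univ.filter fun v : Fin n => v.val < k := by
    ext i
    simp only [List.mem_toFinset, List.mem_take_iff_getElem, List.getElem_finRange,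
      Finset.mem_filter, Finset.mem_univ, true_and]
    constructor
    · rintro ⟨j, hj, rfl⟩
      simp at hj ⊢
      omega
    · intro h
      exact ⟨i.val, by simp [h], rfl⟩
  simp only [inputState, if_true, if_pos hk]
  rw [List.length_flatMap, ← this,
    List.sum_toFinset _ ((List.nodup_finRange n).sublist (List.take_sublist _ _))]

theorem finRange_take_succ {v : ℕ} (hv : v < n) :
    (List.finRange n).take (v + 1) = (List.finRange n).take v ++ [⟨v, hv⟩] := by
  rw [List.take_succ_eq_append_getElem (by simpa using hv)]
  simp

theorem input_inputState (L : Fin n → List (Fin n)) :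
    Input n (natNbrs L) (natWeight w) (inputState w L) := by
  refine ⟨by simp [inputState], by simp [inputState], fun v hv => ?_, fun v hv j hj => ?_,
    fun v hv => by simp [inputState, natWeight]⟩
  · rw [inputState_arr_zero w L hv.le, inputState_arr_zero w L hv, finRange_take_succ hv]
    simp [natNbrs, hv]
  · rw [inputState_arr_zero w L hv.le]
    have hj' : j < (L ⟨v, hv⟩).length := by simpa [natNbrs, hv] using hj
    have e : (List.finRange n).flatMap L = ((List.finRange n).take v).flatMap L ++
        (L ⟨v, hv⟩ ++ ((List.finRange n).drop (v + 1)).flatMap L) := by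
      conv_lhs => rw [← List.take_append_drop (v + 1) (List.finRange n), finRange_take_succ hv]
      simp
    have : (inputState w L).arr 1 = fun k => (((List.finRange n).flatMap L).map Fin.val).getD k 0 := by
      simp [inputState]
    rw [this]
    simp only [e, List.map_append, List.getD_eq_getElem?_getD]
    rw [List.getElem?_append_right (by simp), List.length_map, Nat.add_sub_cancel_left,
      List.getElem?_append_left (by simpa using hj')]
    simp [natNbrs, hv, hj']

theorem IsAdjacencyLists.sum_length (hL : IsAdjacencyLists G L) :
    ∑ v ∈ Finset.range n, (natNbrs L v).length = 2 * G.edgeSet.ncard := by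
  classical
  have h := G.sum_degrees_eq_twice_card_edges
  rw [Set.ncard_eq_toFinset_card', ← SimpleGraph.edgeFinset, ← h, Finset.sum_range]
  refine Finset.sum_congr rfl fun v _ => ?_
  rw [natNbrs_val, List.length_map, ← List.toFinset_card_of_nodup (hL v).1, SimpleGraph.degree]
  congr 1
  ext u
  rw [List.mem_toFinset, (hL v).2, SimpleGraph.mem_neighborFinset]

theorem exists_map_val {l : List ℕ} (h : ∀ a ∈ l, a < n) :
    ∃ l' : List (Fin n), l'.map Fin.val = l :=
  ⟨l.pmap Fin.mk h, by simp [List.map_pmap]⟩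

theorem RAM.CliqueOut.isMaxWeightClique (hL : IsAdjacencyLists G L) {out : List ℕ}
    (h : CliqueOut n (natNbrs L) (natWeight w) out) :
    ∃ S : Finset (Fin n), IsMaxWeightClique G w S ∧ IsCliqueOutput out S := by
  classical
  obtain ⟨B, hBn, hB, hc, rfl, hmax⟩ := h
  obtain ⟨l, rfl⟩ := exists_map_val hB
  have hl : l.Nodup := hBn.of_map _
  refine ⟨l.toFinset, ⟨fun a ha b hb hab => ?_, fun T hT => ?_⟩, l, hl, rfl, rfl⟩
  · rw [List.coe_toFinset, Set.mem_ofPred_eq] at ha hb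
    exact (hL.mem_natNbrs a b).1 (hc a (List.mem_map_of_mem ha) b (List.mem_map_of_mem hb)
      fun hh => hab (Fin.ext hh)) |>.symm
  · have e : ∀ v : Fin n, natWeight w v = w v := fun v => by simp [natWeight]
    have := hmax (T.map Fin.valEmbedding) (fun a ha => ?_) (fun a ha b hb hab => ?_)
    · rw [Finset.sum_map, List.map_map] at this
      simp only [Fin.valEmbedding_apply, e] at this
      rw [List.sum_toFinset _ hl]
      refine this.trans (le_of_eq ?_)
      congr 1
      exact List.map_congr_left fun v _ => e v
    · obtain ⟨x, -, rfl⟩ := Finset.mem_map.1 ha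
      exact x.2
    · obtain ⟨x, hx, rfl⟩ := Finset.mem_map.1 ha
      obtain ⟨y, hy, rfl⟩ := Finset.mem_map.1 hb
      exact (hL.mem_natNbrs x y).2 (hT hy hx fun hh => hab (by rw [hh]))

theorem IndPath.of_map {V W : Type*} {G : SimpleGraph V} {H : SimpleGraph W} {f : V → W}
    (hG : ∀ a b, H.Adj (f a) (f b) ↔ G.Adj a b) : ∀ l : List V, IndPath H (l.map f) → IndPath G l
  | [], _ => trivial
  | [_], _ => trivial
  | a :: b :: l, h => by
    obtain ⟨h1, h2, h3⟩ := h
    refine ⟨(hG a b).1 h1, fun x hx => ?_, IndPath.of_map hG (b :: l) h3⟩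
    obtain ⟨h4, h5⟩ := h2 (f x) (List.mem_map_of_mem hx)
    exact ⟨fun hh => h4 (by rw [hh]), fun hh => h5 ((hG a x).2 hh)⟩

theorem Closes.of_map {V W : Type*} {G : SimpleGraph V} {H : SimpleGraph W} {f : V → W}
    (hf : Function.Injective f) (hG : ∀ a b, H.Adj (f a) (f b) ↔ G.Adj a b) {c : V} {l : List V}
    (h : Closes H (f c) (l.map f)) : Closes G c l := by
  obtain ⟨h1, h2, h3⟩ := h
  refine ⟨h1.of_map hG, by simpa using h2, fun x hx => ?_⟩
  obtain ⟨h4, h5⟩ := h3 (f x) (List.mem_map_of_mem hx)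
  refine ⟨fun hh => h4 (by rw [hh]), ?_⟩
  rw [hG, List.head?_map, List.getLast?_map] at h5
  have e : ∀ o : Option V, o.map f = some (f x) ↔ o = some x := fun o => by
    rw [← Option.map_some, (Option.map_injective hf).eq_iff]
  rw [h5, e, e]

/-- The permutation given by a list of all vertices. -/
theorem exists_perm_of_list {o : List ℕ} (ho : o.Perm (List.range n)) :
    ∃ σ : Equiv.Perm (Fin n), (List.ofFn σ).map Fin.val = o := by
  have hlen : o.length = n := by rw [ho.length_eq]; simp
  have hlt : ∀ i : Fin n, o[i.val]'(by omega) < n := fun i => by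
    have := ho.mem_iff.1 (List.getElem_mem (l := o) (n := i.val) (by omega))
    simpa using this
  have hinj : Function.Injective fun i : Fin n => (⟨o[i.val]'(by omega), hlt i⟩ : Fin n) := by
    intro i j hij
    have hnd : o.Nodup := ho.nodup_iff.2 List.nodup_range
    exact Fin.ext ((hnd.getElem_inj_iff).1 (Fin.mk.inj hij))
  refine ⟨Equiv.ofBijective _ (Finite.injective_iff_bijective.1 hinj), ?_⟩
  apply List.ext_getElem
  · simp [hlen]
  · intro i h1 h2
    simp

theorem LexList.isLexBFSOrdering (hL : IsAdjacencyLists G L) {σ : Equiv.Perm (Fin n)}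
    (h : LexList (natNbrs L) ((List.ofFn σ).map Fin.val)) : IsLexBFSOrdering G σ := by
  rw [isLexBFSOrdering_iff]
  intro i j hij d hdi h1 h2 h3
  have hij' : i < j := lt_of_le_of_ne hij fun hh => h2 (hh ▸ h1)
  set o := (List.ofFn σ).map Fin.val with ho
  have hlen : o.length = n := by simp [ho]
  have hget : ∀ k : Fin n, o[k.val]'(by omega) = (σ k).val := fun k => by simp [ho]
  have hsplit : o = o.take i ++ (σ i).val :: o.drop (i + 1) := by
    rw [← hget i, List.getElem_cons_drop, List.take_append_drop]
  have hj : (σ j).val ∈ o.drop (i + 1) := by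
    rw [List.mem_drop_iff_getElem]
    refine ⟨j.val - (i.val + 1), by have := j.2; omega, ?_⟩
    have hij'' : i.val < j.val := hij'
    have e' : i.val + 1 + (j.val - (i.val + 1)) = j.val := by omega
    simp only [e']
    exact hget j
  have hdi' : d.val < i.val := hdi
  refine h _ _ _ hsplit _ hj ⟨o.take d, (σ d).val, (o.take i).drop (d + 1), ?_, ?_,
    (hL.mem_natNbrs _ _).2 h1, fun hh => h2 ((hL.mem_natNbrs _ _).1 hh)⟩
  · have hdlen : d.val < (o.take i.val).length := by
      rw [List.length_take]; have := i.2; omega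
    have e1 : (o.take i.val)[d.val] = (σ d).val := by rw [List.getElem_take]; exact hget d
    have e2 : (o.take i.val).take d.val = o.take d.val := by
      rw [List.take_take, Nat.min_eq_left hdi'.le]
    rw [← e1, List.getElem_cons_drop, ← e2, List.take_append_drop]
  · intro e he
    obtain ⟨k, hk, rfl⟩ := List.mem_take_iff_getElem.1 he
    have hk' : k < d.val := by omega
    have hkn : k < n := by omega
    rw [hget ⟨k, hkn⟩, hL.mem_natNbrs, hL.mem_natNbrs]
    exact (h3 ⟨k, hkn⟩ hk').symm

theorem RAM.CertificateOut.exists_valid (hL : IsAdjacencyLists G L) {out : List ℕ}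
    (h : CertificateOut hL.isNbrs out) : ∃ c : Certificate n, c.Valid G ∧ out = c.encode := by
  obtain ⟨p, v, q, u, P, hperm, hlex, rfl, hP3, hcl, hmem⟩ := h
  obtain ⟨σ, hσ⟩ := exists_perm_of_list hperm
  have hlen : (p ++ v :: q).length = n := by rw [hperm.length_eq]; simp
  have hpn : p.length < n := by rw [← hlen]; simp
  have hget : ∀ (k : ℕ) (hk : k < n), (σ ⟨k, hk⟩).val = (p ++ v :: q)[k]'(by omega) := fun k hk => by
    simp only [← hσ]; simp
  have hv : (σ ⟨p.length, hpn⟩).val = v := by rw [hget]; simp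
  have hpos : ∀ x : Fin n, x.val ∈ p → σ.symm x < ⟨p.length, hpn⟩ := by
    intro x hx
    obtain ⟨k, hk, hkx⟩ := List.getElem_of_mem hx
    have hkn : k < n := by omega
    have : σ ⟨k, hkn⟩ = x := Fin.ext (by rw [hget, List.getElem_append_left hk, hkx])
    rw [← this, Equiv.symm_apply_apply]
    exact hk
  have hlt : ∀ a ∈ u :: P, a < n := fun a ha => hL.isNbrs.lt (hmem a ha).1
  obtain ⟨l, hl⟩ := exists_map_val hlt
  obtain ⟨u', P', rfl⟩ : ∃ u' P', l = u' :: P' := by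
    cases l with
    | nil => simp at hl
    | cons a l => exact ⟨a, l, rfl⟩
  rw [List.map_cons, List.cons.injEq] at hl
  obtain ⟨rfl, rfl⟩ := hl
  have hcl' : Closes G u' P' := hcl.of_map Fin.val_injective fun a b =>
    (hL.mem_natNbrs a b).trans ⟨fun h => h.symm, fun h => h.symm⟩
  obtain ⟨f, hf⟩ := hcl'.exists_embedding
  refine ⟨⟨σ, ⟨p.length, hpn⟩, u' :: P'⟩, ⟨LexList.isLexBFSOrdering hL (by rw [hσ]; exact hlex),
    P'.length + 1, by simpa using hP3, f, hf.symm, fun j => ?_⟩, by simp [Certificate.encode, hσ]⟩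
  have hj : (f j).val ∈ u'.val :: P'.map Fin.val := by
    rw [← List.map_cons, ← hf]
    exact List.mem_map_of_mem (by rw [List.mem_ofFn]; exact ⟨j, rfl⟩)
  obtain ⟨h1, h2⟩ := hmem _ hj
  refine ⟨?_, hpos _ h2⟩
  rw [← hv] at h1
  exact (hL.mem_natNbrs _ _).1 h1

end Input

/-! ### The main theorem. -/

theorem mainTheorem7 :
    (∃ (A : RAM.Program) (C : ℕ),
      ∀ (n : ℕ) (G : SimpleGraph (Fin n)) (w : Fin n → ℝ≥0) (L : Fin n → List (Fin n)),
        IsAdjacencyLists G L →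
        ∃ (s : RAM.State) (t : ℕ),
          RAM.Exec A (inputState w L) s t ∧
          t ≤ C * (max n 1 * max G.edgeSet.ncard 1) ∧
          ((∃ S : Finset (Fin n), IsMaxWeightClique G w S ∧ IsCliqueOutput s.out S) ∨
            (∃ c : Certificate n, c.Valid G ∧ s.out = c.encode)) ∧
          (EvenHoleFree G →
            ∃ S : Finset (Fin n), IsMaxWeightClique G w S ∧ IsCliqueOutput s.out S)) ∧
    (∀ (n : ℕ) (G : SimpleGraph (Fin n)) (c : Certificate n),
      c.Valid G → ¬ (FourHoleFree G ∧ OddSignable G)) := by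
  -- The sum of the degrees is `2m`, so the bound of `cliqueOrHole_runs` is `880 nm + 200 n + 200`,
  -- and `880 + 200 + 200 = 1280`.
  refine ⟨⟨RAM.cliqueOrHole, 1280, fun n G w L hL => ?_⟩,
    fun n G c hc => hc.not_fourHoleFree_and_oddSignable⟩
  obtain ⟨s, t, hex, ht, hout⟩ := RAM.cliqueOrHole_runs hL.isNbrs (input_inputState w L)
    ⟨⟨by simp [inputState], by simp [inputState], by simp [inputState]⟩, by simp [inputState]⟩
    (by simp [inputState]) (by simp [inputState]) (by simp [inputState]) (by simp [inputState])
    (by simp [inputState])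
  have hres : (∃ S : Finset (Fin n), IsMaxWeightClique G w S ∧ IsCliqueOutput s.out S) ∨
      ∃ c : Certificate n, c.Valid G ∧ s.out = c.encode :=
    hout.imp (fun h => h.isMaxWeightClique w hL) fun h => h.exists_valid hL
  refine ⟨s, t, hex, ht.trans ?_, hres, fun hG => hres.resolve_right ?_⟩
  · rw [hL.sum_length]
    have h1 : n * G.edgeSet.ncard ≤ max n 1 * max G.edgeSet.ncard 1 :=
      Nat.mul_le_mul (le_max_left _ _) (le_max_left _ _)
    have h2 : n * 1 ≤ max n 1 * max G.edgeSet.ncard 1 :=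
      Nat.mul_le_mul (le_max_left _ _) (le_max_right _ _)
    have h3 : 1 * 1 ≤ max n 1 * max G.edgeSet.ncard 1 :=
      Nat.mul_le_mul (le_max_right _ _) (le_max_right _ _)
    rw [Nat.mul_left_comm n 2]
    omega
  -- An even-hole-free graph is 4-hole-free and odd-signable, so a certificate cannot be the output.
  · rintro ⟨c, hc, -⟩
    exact hc.not_fourHoleFree_and_oddSignable ⟨hG.fourHoleFree, hG.oddSignable⟩
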